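/- Let $T$ be one of the three regular tilings of the plane (square, triangular or hexagonal) with edges of unit length, regarded as an infinite plane graph whose vertices are given by integer lattice coordinates. For paths $P=(p_1,\dots,p_n)$ and $Q=(q_1,\dots,q_m)$ in this graph ($n,m\ge 1$; a path visits no vertex twice), the discrete Fréchet distance is $$D_{\mathcal F}(P,Q)=\min_{F}\ \max_{(i,j)\in F}\operatorname{dist}_T(p_i,q_j),$$ where $\operatorname{dist}_T$ is the shortest-path distance in the graph $T$ and $F$ ranges over the monotone walks from $(1,1)$ to $(n,m)$, that is, the finite sequences of index pairs $(a_1,b_1)=(1,1),\dots,(a_k,b_k)=(n,m)$ with $a_{i+1}\in\{a_i,a_i+1\}$ and $b_{i+1}\in\{b_i,b_i+1\}$ for all $i<k$. There is a deterministic word-RAM algorithm that, given such $P$ and $Q$ and a threshold $\Delta\in\mathbb R$, decides whether $D_{\mathcal F}(P,Q)\le\Delta$ in $O\big((n+m)^{1.5}\log(n+m)\big)$ time. Here every operation takes unit time, words have $O(\log(n+m+U))$ bits, where $U$ bounds the absolute values of the input coordinates, and the real number $\Delta$ is accessed only through unit-time comparisons of a word with $\Delta$. The constants are absolute. -/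

import Mathlib

namespace FrechetTiling

/-! ## The regular unit tilings and their graphs -/

/-- The three regular tilings of the plane. -/
inductive RegularTiling where
  | square
  | triangular
  | hexagonal

namespace RegularTiling

/-- The point of the plane `ℂ` with lattice coordinates `(a, b)`: `a + b i` for the square tiling
and `a + b e ^ (i π / 3)` for the triangular and the hexagonal tiling. -/
noncomputable def pos : RegularTiling → ℤ × ℤ → ℂ
  | square, p => ⟨p.1, p.2⟩
  | triangular, p => ⟨p.1 + p.2 / 2, p.2 * (Real.sqrt 3 / 2)⟩
  | hexagonal, p => ⟨p.1 + p.2 / 2, p.2 * (Real.sqrt 3 / 2)⟩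

/-- The lattice points that are vertices of the tiling. For the hexagonal tiling the lattice points
`(a, b)` with `a - b ≡ 2 (mod 3)` are the centres of the hexagons, and all others are vertices. -/
def IsVertex : RegularTiling → ℤ × ℤ → Prop
  | square, _ => True
  | triangular, _ => True
  | hexagonal, p => (p.1 - p.2) % 3 ≠ 2

/-- The vertex set `V(T)`, in lattice coordinates. -/
def Vertex (T : RegularTiling) : Type := {p : ℤ × ℤ // T.IsVertex p}

/-- The graph of the unit tiling: the edges join the vertices at Euclidean distance one. -/
noncomputable def graph (T : RegularTiling) : SimpleGraph T.Vertex where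
  Adj u v := dist (T.pos u.1) (T.pos v.1) = 1
  symm := ⟨fun u v h => by rw [dist_comm]; exact h⟩
  loopless := ⟨fun u h => by simp at h⟩

end RegularTiling

/-! ## The discrete Fréchet distance -/

/-- One step of a monotone walk: each index stays or increases by one. -/
def MonotoneStep (u v : ℕ × ℕ) : Prop :=
  (v.1 = u.1 ∨ v.1 = u.1 + 1) ∧ (v.2 = u.2 ∨ v.2 = u.2 + 1)

/-- `F` is a monotone walk of index pairs from `(0, 0)` to `(k, l)`. -/
def IsMonotoneWalk (k l : ℕ) (F : List (ℕ × ℕ)) : Prop :=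
  F.head? = some (0, 0) ∧ F.getLast? = some (k, l) ∧ F.IsChain MonotoneStep

section Frechet

variable {V : Type*} {G : SimpleGraph V} {u v u' v' : V}

/-- The cost of a monotone walk: the largest graph distance of a pair of vertices it visits. -/
noncomputable def walkCost (P : G.Walk u v) (Q : G.Walk u' v') (F : List (ℕ × ℕ)) : ℕ :=
  F.toFinset.sup fun ij => G.dist (P.getVert ij.1) (Q.getVert ij.2)

/-- The discrete Fréchet distance of two walks in `G`: the minimum cost of a monotone walk from the
pair of first vertices to the pair of last vertices (indices count from zero). -/
noncomputable def frechetDist (P : G.Walk u v) (Q : G.Walk u' v') : ℕ :=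
  sInf {d | ∃ F, IsMonotoneWalk P.length Q.length F ∧ walkCost P Q F = d}

end Frechet

/-! ## A word RAM with unit cost

A program has finitely many integer variables and finitely many integer arrays with random access.
A word holds an integer of absolute value at most `W`; an operation whose operand or result does not
fit into a word has no execution. The real threshold `Δ` is not a word: it can only be compared with
a word. Every arithmetic operation, array access, comparison and branch takes unit time. -/

/-- Memory: the values of the variables and the entries of the arrays. -/
structure State where
  var : ℕ → ℤ
  arr : ℕ → ℤ → ℤ

/-- Store `k` in the variable `x`. -/
def State.setVar (s : State) (x : ℕ) (k : ℤ) : State where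
  var := Function.update s.var x k
  arr := s.arr

/-- Store `k` in the array `a` at the address `i`. -/
def State.setArr (s : State) (a : ℕ) (i k : ℤ) : State where
  var := s.var
  arr := Function.update s.arr a (Function.update (s.arr a) i k)

/-- Arithmetic expressions over variables and array entries. -/
inductive RExpr where
  | const (k : ℤ)
  | var (x : ℕ)
  | read (a : ℕ) (i : RExpr)
  | add (e f : RExpr)
  | sub (e f : RExpr)
  | mul (e f : RExpr)
  | div (e f : RExpr)
  | mod (e f : RExpr)

namespace RExpr

/-- The value of an expression; `div` and `mod` are integer quotient and remainder. -/
def eval (s : State) : RExpr → ℤ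
  | const k => k
  | var x => s.var x
  | read a i => s.arr a (i.eval s)
  | add e f => e.eval s + f.eval s
  | sub e f => e.eval s - f.eval s
  | mul e f => e.eval s * f.eval s
  | div e f => e.eval s / f.eval s
  | mod e f => e.eval s % f.eval s

/-- All values that occur in the evaluation fit into words, array addresses included. -/
def Fits (W : ℕ) (s : State) (e : RExpr) : Prop :=
  |e.eval s| ≤ (W : ℤ) ∧
    match e with
    | const _ => True
    | var _ => True
    | read _ i => i.Fits W s
    | add e f => e.Fits W s ∧ f.Fits W s
    | sub e f => e.Fits W s ∧ f.Fits W s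
    | mul e f => e.Fits W s ∧ f.Fits W s
    | div e f => e.Fits W s ∧ f.Fits W s
    | mod e f => e.Fits W s ∧ f.Fits W s

/-- The time to evaluate an expression: the number of its constants, variables and operations. -/
def time : RExpr → ℕ
  | const _ => 1
  | var _ => 1
  | read _ i => i.time + 1
  | add e f => e.time + f.time + 1
  | sub e f => e.time + f.time + 1
  | mul e f => e.time + f.time + 1
  | div e f => e.time + f.time + 1
  | mod e f => e.time + f.time + 1

end RExpr

/-- Tests: comparisons of words, the comparison of a word with the threshold `Δ`, and Boolean
combinations. -/
inductive Test where
  | le (e f : RExpr)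
  | eq (e f : RExpr)
  | leThreshold (e : RExpr)
  | not (b : Test)
  | and (b c : Test)

namespace Test

/-- The truth value of a test. -/
def Holds (Δ : ℝ) (s : State) : Test → Prop
  | le e f => e.eval s ≤ f.eval s
  | eq e f => e.eval s = f.eval s
  | leThreshold e => (e.eval s : ℝ) ≤ Δ
  | not b => ¬ b.Holds Δ s
  | and b c => b.Holds Δ s ∧ c.Holds Δ s

/-- All values that occur in the test fit into words. -/
def Fits (W : ℕ) (s : State) : Test → Prop
  | le e f => e.Fits W s ∧ f.Fits W s
  | eq e f => e.Fits W s ∧ f.Fits W s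
  | leThreshold e => e.Fits W s
  | not b => b.Fits W s
  | and b c => b.Fits W s ∧ c.Fits W s

/-- The time to evaluate a test. -/
def time : Test → ℕ
  | le e f => e.time + f.time + 1
  | eq e f => e.time + f.time + 1
  | leThreshold e => e.time + 1
  | not b => b.time + 1
  | and b c => b.time + c.time + 1

end Test

/-- Programs. -/
inductive Program where
  | skip
  | assign (x : ℕ) (e : RExpr)
  | write (a : ℕ) (i e : RExpr)
  | seq (p q : Program)
  | cond (b : Test) (p q : Program)
  | loop (b : Test) (p : Program)

/-- `Exec Δ W p s s' t`: on words of absolute value at most `W` and with threshold `Δ`, the program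
`p` started in the state `s` halts in the state `s'` after exactly `t` time units. -/
inductive Exec (Δ : ℝ) (W : ℕ) : Program → State → State → ℕ → Prop where
  | skip (s : State) : Exec Δ W .skip s s 1
  | assign (s : State) (x : ℕ) (e : RExpr) (he : e.Fits W s) :
      Exec Δ W (.assign x e) s (s.setVar x (e.eval s)) (e.time + 1)
  | write (s : State) (a : ℕ) (i e : RExpr) (hi : i.Fits W s) (he : e.Fits W s) :
      Exec Δ W (.write a i e) s
        (s.setArr a (i.eval s) (e.eval s)) (i.time + e.time + 1)
  | seq {p q : Program} {s s' s'' : State} {t t' : ℕ}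
      (hp : Exec Δ W p s s' t) (hq : Exec Δ W q s' s'' t') :
      Exec Δ W (.seq p q) s s'' (t + t')
  | condTrue {b : Test} {p q : Program} {s s' : State} {t : ℕ}
      (hf : b.Fits W s) (hb : b.Holds Δ s) (hp : Exec Δ W p s s' t) :
      Exec Δ W (.cond b p q) s s' (b.time + 1 + t)
  | condFalse {b : Test} {p q : Program} {s s' : State} {t : ℕ}
      (hf : b.Fits W s) (hb : ¬ b.Holds Δ s) (hq : Exec Δ W q s s' t) :
      Exec Δ W (.cond b p q) s s' (b.time + 1 + t)
  | loopStop {b : Test} {p : Program} {s : State}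
      (hf : b.Fits W s) (hb : ¬ b.Holds Δ s) :
      Exec Δ W (.loop b p) s s (b.time + 1)
  | loopStep {b : Test} {p : Program} {s s' s'' : State} {t t' : ℕ}
      (hf : b.Fits W s) (hb : b.Holds Δ s) (hp : Exec Δ W p s s' t)
      (hl : Exec Δ W (.loop b p) s' s'' t') :
      Exec Δ W (.loop b p) s s'' (b.time + 1 + t + t')

/-! ## The encoding of the input -/

/-- The array that holds the entries of the list `l` at the addresses `0, 1, …`, and `0` elsewhere. -/
def listArray (l : List ℤ) (i : ℤ) : ℤ :=
  if 0 ≤ i then l.getD i.toNat 0 else 0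

/-- The memory at the start: variables `0` and `1` hold the numbers of vertices of `P` and `Q`,
arrays `0` and `1` the lattice coordinates of the vertices of `P` in order, arrays `2` and `3` those
of `Q`, and everything else is `0`. -/
noncomputable def inputState {T : RegularTiling} {u v u' v' : T.Vertex}
    (P : T.graph.Walk u v) (Q : T.graph.Walk u' v') : State where
  var
    | 0 => P.support.length
    | 1 => Q.support.length
    | _ => 0
  arr
    | 0 => listArray (P.support.map fun w => w.1.1)
    | 1 => listArray (P.support.map fun w => w.1.2)
    | 2 => listArray (Q.support.map fun w => w.1.1)
    | 3 => listArray (Q.support.map fun w => w.1.2)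
    | _ => fun _ => 0

end FrechetTiling

/-! In each tiling the graph distance is the largest difference of three integer forms
(`RegularTiling.dist_le_iff`). Each form changes by at most one along an edge, and any two of them
determine the vertex (`RegularTiling.form_injective`). The decision problem thus becomes
reachability in an `n × m` grid whose cell `(i, j)` is free when `|F k i - G k j| ≤ D` for `k < 3`.
Here `D` is `⌊Δ⌋`, capped at the distance of the first vertices plus `n + m`, a threshold at which
every cell is free.

The grid is searched as a quadtree. Inside a block of side `l` each difference stays within `2 (l -
1)` of its value at the lower left cell. If some form blocks the whole block, or at most one form is
undecided in it, then a single inequality `f i ≤ g j` describes the free cells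
(`Grid.Flat.free_iff`). Every other block meeting the grid is rough and is cut into four.

A flat block is solved in time linear in its side. The free columns of the rows are nested sets, so
among several rows the lowest one is the best. Hence reachability is equivalent to the absence of a
few simple barriers: a blocked row, a blocked column, or a blocked hook around the start or the end
(`conn_iff_noBarrier`). For targets in the last column these conditions split into one on the
source, one on the target, and comparisons of minima and maxima (`conn_left_iff`,
`conn_bottom_iff`). Running minima and maxima, stored in tables whose keys are heights, decide all
of them; since `f` and `g` change by at most one per step, the tables have no gaps. Exchanging rows
and columns gives the last row of the block as well. Thus reachability just before a block yields
reachability on its far boundary (`Leaf.leaf_runs`), which is all that the neighbouring blocks need.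

The running time follows from counting rough blocks. In a rough block two forms lie within `O(l)` of
`±D`, so the vertices of `Q` in its columns lie, for a fixed row of blocks, in a set of `O(l ^ 2)`
points. As `Q` visits no vertex twice, a row of blocks contains `O(l)` rough ones
(`Tree.rough_row_le`). With `l = 2 ^ j` inside a square of side `2 ^ K`, the work is at most of
order `2 ^ K * ∑ j, min (2 ^ (K - j)) (2 ^ j)`, which is `O(2 ^ K * 2 ^ (K / 2))`
(`Tree.cost_le_pow`), and `2 ^ K ≤ 2 (n + m)`.

For the machine, all stored numbers are kept below a fixed power of `n + m + U`. Intermediate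
results then fit into words by a syntactic degree bound. -/

namespace FrechetTiling

/-! ## Reasoning about programs -/

/-- All words in memory lie in `[-V, V]`. -/
def Bdd (V : ℤ) (s : State) : Prop :=
  (∀ x, -V ≤ s.var x ∧ s.var x ≤ V) ∧ ∀ a i, -V ≤ s.arr a i ∧ s.arr a i ≤ V

/-- A syntactic degree: in a memory bounded by `V ≥ 2` the expression has size at most `V ^ deg`. -/
def RExpr.deg : RExpr → ℕ
  | const k => k.natAbs
  | var _ => 1
  | read _ _ => 1
  | add e f => max e.deg f.deg + 1
  | sub e f => max e.deg f.deg + 1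
  | mul e f => e.deg + f.deg
  | div e _ => e.deg
  | mod e f => max e.deg f.deg

/-- The largest degree of a subexpression. -/
def RExpr.maxDeg : RExpr → ℕ
  | const k => k.natAbs
  | var _ => 1
  | read _ i => max 1 i.maxDeg
  | add e f => max (max e.deg f.deg + 1) (max e.maxDeg f.maxDeg)
  | sub e f => max (max e.deg f.deg + 1) (max e.maxDeg f.maxDeg)
  | mul e f => max (e.deg + f.deg) (max e.maxDeg f.maxDeg)
  | div e f => max e.deg (max e.maxDeg f.maxDeg)
  | mod e f => max (max e.deg f.deg) (max e.maxDeg f.maxDeg)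

/-- The largest degree of an expression in a test. -/
def Test.maxDeg : Test → ℕ
  | le e f => max e.maxDeg f.maxDeg
  | eq e f => max e.maxDeg f.maxDeg
  | leThreshold e => e.maxDeg
  | not b => b.maxDeg
  | and b c => max b.maxDeg c.maxDeg

/-- The largest degree of an expression in a program. -/
def Program.maxDeg : Program → ℕ
  | skip => 0
  | assign _ e => e.maxDeg
  | write _ i e => max i.maxDeg e.maxDeg
  | seq p q => max p.maxDeg q.maxDeg
  | cond b p q => max b.maxDeg (max p.maxDeg q.maxDeg)
  | loop b p => max b.maxDeg p.maxDeg

/-- Constants are covered by `k < 2 ^ k ≤ V ^ k`. A sum or difference costs one extra degree because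
`2 * V ^ d ≤ V ^ (d + 1)` when `V ≥ 2`. Quotients and remainders do not exceed their arguments. -/
theorem RExpr.abs_eval_le {V : ℤ} (hV : 2 ≤ V) {s : State} (hs : Bdd V s) (e : RExpr) :
    |e.eval s| ≤ V ^ e.deg := by
  have h1 : (1 : ℤ) ≤ V := by omega
  have hmono : ∀ {a b : ℕ}, a ≤ b → V ^ a ≤ V ^ b := fun h => pow_le_pow_right₀ h1 h
  have hadd : ∀ (x y : ℤ) (a b : ℕ), |x| ≤ V ^ a → |y| ≤ V ^ b →
      |x| + |y| ≤ V ^ (max a b + 1) := by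
    intro x y a b hx hy
    have h2 := hmono (le_max_left a b)
    have h3 := hmono (le_max_right a b)
    have h4 : (0 : ℤ) ≤ V ^ max a b := by positivity
    rw [pow_succ]
    nlinarith
  induction e with
  | const k =>
    simp only [eval, deg]
    have : k.natAbs < 2 ^ k.natAbs := Nat.lt_two_pow_self
    have h2 : ((k.natAbs : ℕ) : ℤ) ≤ 2 ^ k.natAbs := by exact_mod_cast this.le
    rw [Int.abs_eq_natAbs]
    exact h2.trans (pow_le_pow_left₀ (by norm_num) hV _)
  | var x => simpa [eval, deg, abs_le] using hs.1 x
  | read a i _ => simpa [eval, deg, abs_le] using hs.2 a _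
  | add e f he hf => exact (abs_add_le _ _).trans (hadd _ _ _ _ he hf)
  | sub e f he hf => exact (abs_sub _ _).trans (hadd _ _ _ _ he hf)
  | mul e f he hf =>
    simp only [eval, deg, abs_mul, pow_add]
    exact mul_le_mul he hf (abs_nonneg _) (by positivity)
  | div e f he _ =>
    refine le_trans ?_ he
    simp only [eval]
    rw [Int.abs_eq_natAbs, Int.abs_eq_natAbs]
    exact_mod_cast Int.natAbs_ediv_le_natAbs _ _
  | mod e f he hf =>
    simp only [eval, deg]
    by_cases h0 : f.eval s = 0
    · rw [h0, Int.emod_zero]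
      exact he.trans (hmono (le_max_left _ _))
    · rw [abs_of_nonneg (Int.emod_nonneg _ h0)]
      exact (Int.emod_lt_abs _ h0).le.trans (hf.trans (hmono (le_max_right _ _)))

/-- This turns every word-size side condition into a comparison of numerals, settled by `decide` for
a concrete expression. -/
theorem RExpr.fits_of_maxDeg {V : ℤ} (hV : 2 ≤ V) {s : State} (hs : Bdd V s) {W d : ℕ}
    (hW : V ^ d ≤ W) (e : RExpr) (he : e.maxDeg ≤ d) : e.Fits W s := by
  have h1 : (1 : ℤ) ≤ V := by omega
  have key : ∀ e : RExpr, e.deg ≤ d → |e.eval s| ≤ (W : ℤ) := fun e h =>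
    (e.abs_eval_le hV hs).trans ((pow_le_pow_right₀ h1 h).trans hW)
  induction e with
  | const k => exact ⟨key _ he, trivial⟩
  | var x => exact ⟨key _ he, trivial⟩
  | read a i hi =>
    simp only [maxDeg, max_le_iff] at he
    exact ⟨key _ he.1, hi he.2⟩
  | add e f ihe ihf | sub e f ihe ihf | mul e f ihe ihf | div e f ihe ihf | mod e f ihe ihf =>
    simp only [maxDeg, max_le_iff] at he
    exact ⟨key _ (by simp only [deg, max_le_iff]; omega), ihe he.2.1, ihf he.2.2⟩

theorem Test.fits_of_maxDeg {V : ℤ} (hV : 2 ≤ V) {s : State} (hs : Bdd V s) {W d : ℕ}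
    (hW : V ^ d ≤ W) (b : Test) (hb : b.maxDeg ≤ d) : b.Fits W s := by
  induction b with
  | le e f | eq e f =>
    simp only [maxDeg, max_le_iff] at hb
    exact ⟨e.fits_of_maxDeg hV hs hW hb.1, f.fits_of_maxDeg hV hs hW hb.2⟩
  | leThreshold e => exact e.fits_of_maxDeg hV hs hW hb
  | not b ih => exact ih hb
  | and b c ihb ihc =>
    simp only [maxDeg, max_le_iff] at hb
    exact ⟨ihb hb.1, ihc hb.2⟩

/-! ### Frames, running times and weakest preconditions. -/

namespace Program

/-- The variables a program may write. -/
def wvars : Program → List ℕ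
  | skip => []
  | assign x _ => [x]
  | write _ _ _ => []
  | seq p q => p.wvars ++ q.wvars
  | cond _ p q => p.wvars ++ q.wvars
  | loop _ p => p.wvars

/-- The arrays a program may write. -/
def warrs : Program → List ℕ
  | skip => []
  | assign _ _ => []
  | write a _ _ => [a]
  | seq p q => p.warrs ++ q.warrs
  | cond _ p q => p.warrs ++ q.warrs
  | loop _ p => p.warrs

/-- An upper bound for the running time of a loop-free program. -/
def wtime : Program → ℕ
  | skip => 1
  | assign _ e => e.time + 1
  | write _ i e => i.time + e.time + 1
  | seq p q => p.wtime + q.wtime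
  | cond b p q => b.time + 1 + max p.wtime q.wtime
  | loop _ _ => 0

/-- The weakest precondition of a loop-free program, with the demand that all words written lie in
`[-V, V]`. -/
def wp (Δ : ℝ) (V : ℤ) : Program → (State → Prop) → State → Prop
  | skip, Q, s => Q s
  | assign x e, Q, s => (-V ≤ e.eval s ∧ e.eval s ≤ V) ∧ Q (s.setVar x (e.eval s))
  | write a i e, Q, s => (-V ≤ e.eval s ∧ e.eval s ≤ V) ∧ Q (s.setArr a (i.eval s) (e.eval s))
  | seq p q, Q, s => wp Δ V p (wp Δ V q Q) s
  | cond b p q, Q, s => (b.Holds Δ s → wp Δ V p Q s) ∧ (¬ b.Holds Δ s → wp Δ V q Q s)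
  | loop _ _, _, _ => False

end Program

/-- The states `s` and `s'` agree on everything that `p` does not write. -/
def Agree (p : Program) (s s' : State) : Prop :=
  (∀ x, x ∉ p.wvars → s'.var x = s.var x) ∧ ∀ a, a ∉ p.warrs → s'.arr a = s.arr a

theorem Agree.refl (p : Program) (s : State) : Agree p s s := ⟨fun _ _ => rfl, fun _ _ => rfl⟩

theorem Agree.trans {p : Program} {s s' s'' : State} (h : Agree p s s') (h' : Agree p s' s'') :
    Agree p s s'' :=
  ⟨fun x hx => (h'.1 x hx).trans (h.1 x hx), fun a ha => (h'.2 a ha).trans (h.2 a ha)⟩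

/-- The frame rule: whatever a program does not mention as a target survives it. Membership in the
two lists is decidable, so facts about the memory are carried across subprograms by `decide`. -/
theorem Exec.agree {Δ : ℝ} {W : ℕ} {p : Program} {s s' : State} {t : ℕ} (h : Exec Δ W p s s' t) :
    Agree p s s' := by
  induction h with
  | skip s => exact Agree.refl _ _
  | assign s x e he =>
    exact ⟨fun y hy => Function.update_of_ne (by simpa [Program.wvars] using hy) _ _,
      fun _ _ => rfl⟩
  | write s a i e hi he =>
    exact ⟨fun _ _ => rfl,
      fun b hb => Function.update_of_ne (by simpa [Program.warrs] using hb) _ _⟩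
  | seq _ _ ihp ihq =>
    simp only [Agree, Program.wvars, Program.warrs, List.mem_append, not_or] at *
    exact ⟨fun x hx => (ihq.1 x hx.2).trans (ihp.1 x hx.1),
      fun x hx => (ihq.2 x hx.2).trans (ihp.2 x hx.1)⟩
  | condTrue _ _ _ ih =>
    simp only [Agree, Program.wvars, Program.warrs, List.mem_append, not_or] at *
    exact ⟨fun x hx => ih.1 x hx.1, fun x hx => ih.2 x hx.1⟩
  | condFalse _ _ _ ih =>
    simp only [Agree, Program.wvars, Program.warrs, List.mem_append, not_or] at *
    exact ⟨fun x hx => ih.1 x hx.2, fun x hx => ih.2 x hx.2⟩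
  | loopStop _ _ => exact Agree.refl _ _
  | loopStep _ _ _ _ ihp ihl => exact Agree.trans (p := .loop _ _) ⟨ihp.1, ihp.2⟩ ihl

/-- A word RAM with threshold `thr` and words up to `word`, on which every expression of degree at
most `12` over a memory bounded by `bd` can be evaluated. -/
structure Machine where
  thr : ℝ
  word : ℕ
  bd : ℤ
  two_le : 2 ≤ bd
  pow_le : bd ^ 12 ≤ word

/-- Started in `s`, the program `p` halts after at most `T` time units in a bounded state with the
property `Q`. -/
def Runs (M : Machine) (p : Program) (s : State) (T : ℕ) (Q : State → Prop) : Prop :=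
  ∃ s' t, Exec M.thr M.word p s s' t ∧ t ≤ T ∧ Bdd M.bd s' ∧ Q s'

/-! ### Rules for executions with a time bound. -/

section Rules

variable {M : Machine} {p q : Program} {s : State} {T T' : ℕ} {Q R : State → Prop}

theorem Runs.mono (h : Runs M p s T Q) (hT : T ≤ T') (hQ : ∀ s', Q s' → R s') :
    Runs M p s T' R := by
  obtain ⟨s', t, he, ht, hb, hq⟩ := h
  exact ⟨s', t, he, ht.trans hT, hb, hQ _ hq⟩

theorem Runs.agree (h : Runs M p s T Q) :
    Runs M p s T (fun s' => Q s' ∧ Bdd M.bd s' ∧ Agree p s s') := by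
  obtain ⟨s', t, he, ht, hb, hq⟩ := h
  exact ⟨s', t, he, ht, hb, hq, hb, he.agree⟩

theorem Runs.seq (hp : Runs M p s T R)
    (hq : ∀ s', R s' → Bdd M.bd s' → Agree p s s' → Runs M q s' T' Q) :
    Runs M (.seq p q) s (T + T') Q := by
  obtain ⟨s', t, he, ht, hb, hr⟩ := hp
  obtain ⟨s'', t', he', ht', hb', hq'⟩ := hq s' hr hb he.agree
  exact ⟨s'', t + t', .seq he he', by omega, hb', hq'⟩

theorem Runs.cond {b : Test} (hs : Bdd M.bd s) (hd : b.maxDeg ≤ 12)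
    (hp : b.Holds M.thr s → Runs M p s T Q) (hq : ¬ b.Holds M.thr s → Runs M q s T Q) :
    Runs M (.cond b p q) s (b.time + 1 + T) Q := by
  have hf := b.fits_of_maxDeg M.two_le hs M.pow_le hd
  by_cases h : b.Holds M.thr s
  · obtain ⟨s', t, he, ht, hb, hr⟩ := hp h
    exact ⟨s', _, .condTrue hf h he, by omega, hb, hr⟩
  · obtain ⟨s', t, he, ht, hb, hr⟩ := hq h
    exact ⟨s', _, .condFalse hf h he, by omega, hb, hr⟩

theorem Bdd.setVar {V : ℤ} {s : State} (hs : Bdd V s) {x : ℕ} {k : ℤ} (hk : -V ≤ k ∧ k ≤ V) :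
    Bdd V (s.setVar x k) := by
  refine ⟨fun y => ?_, hs.2⟩
  by_cases h : y = x
  · subst h; simpa [State.setVar] using hk
  · simpa [State.setVar, h] using hs.1 y

theorem Bdd.setArr {V : ℤ} {s : State} (hs : Bdd V s) {a : ℕ} {i k : ℤ} (hk : -V ≤ k ∧ k ≤ V) :
    Bdd V (s.setArr a i k) := by
  refine ⟨hs.1, fun b j => ?_⟩
  by_cases h : b = a
  · subst h
    by_cases h' : j = i
    · subst h'; simpa [State.setArr] using hk
    · simpa [State.setArr, h'] using hs.2 b j
  · simpa [State.setArr, h] using hs.2 b j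

/-- Only stored values have to be bounded by hand, inside `wp`; the intermediate ones are bounded by
their degree. -/
theorem Runs.of_wp (hs : Bdd M.bd s) (hd : p.maxDeg ≤ 12) (h : p.wp M.thr M.bd Q s) :
    Runs M p s p.wtime Q := by
  have hexp := fun (e : RExpr) s hs he => e.fits_of_maxDeg (s := s) M.two_le hs M.pow_le he
  induction p generalizing s Q with
  | skip => exact ⟨s, 1, .skip s, le_rfl, hs, h⟩
  | assign x e => exact ⟨_, _, .assign s x e (hexp _ _ hs hd), le_rfl, hs.setVar h.1, h.2⟩
  | write a i e =>
    simp only [Program.maxDeg, max_le_iff] at hd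
    exact ⟨_, _, .write s a i e (hexp _ _ hs hd.1) (hexp _ _ hs hd.2), le_rfl, hs.setArr h.1, h.2⟩
  | seq p q ihp ihq =>
    simp only [Program.maxDeg, max_le_iff] at hd
    exact (ihp hs hd.1 h).seq fun s' h' hs' _ => ihq hs' hd.2 h'
  | cond b p q ihp ihq =>
    simp only [Program.maxDeg, max_le_iff] at hd
    exact Runs.cond hs hd.1
      (fun hb => (ihp hs hd.2.1 (h.1 hb)).mono (le_max_left _ _) fun _ => id)
      (fun hb => (ihq hs hd.2.2 (h.2 hb)).mono (le_max_right _ _) fun _ => id)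
  | loop b p => exact h.elim

/-- A loop whose body is run exactly `N` times. -/
theorem Runs.loop {b : Test} (Inv : ℕ → State → Prop) (N c : ℕ) (hs : Bdd M.bd s)
    (hd : b.maxDeg ≤ 12) (h0 : Inv 0 s)
    (hstep : ∀ k s', k < N → Inv k s' → Bdd M.bd s' → Agree p s s' →
      b.Holds M.thr s' ∧ Runs M p s' c (Inv (k + 1)))
    (hend : ∀ s', Inv N s' → Agree p s s' → ¬ b.Holds M.thr s') :
    Runs M (.loop b p) s (N * (c + b.time + 1) + (b.time + 1)) (Inv N) := by
  have hfit := fun s hs => b.fits_of_maxDeg (s := s) M.two_le hs M.pow_le hd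
  suffices H : ∀ j k s', k + j = N → Inv k s' → Bdd M.bd s' → Agree p s s' →
      Runs M (.loop b p) s' (j * (c + b.time + 1) + (b.time + 1)) (Inv N) from
    H N 0 s (by simp) h0 hs (Agree.refl _ _)
  intro j
  induction j with
  | zero =>
    intro k s' hk hi hb ha
    obtain rfl : k = N := by omega
    exact ⟨s', _, .loopStop (hfit _ hb) (hend _ hi ha), by omega, hb, hi⟩
  | succ j ih =>
    intro k s' hk hi hb ha
    obtain ⟨hh, s₁, t₁, he₁, ht₁, hb₁, hi₁⟩ := hstep k s' (by omega) hi hb ha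
    obtain ⟨s₂, t₂, he₂, ht₂, hb₂, hi₂⟩ := ih (k + 1) s₁ (by omega) hi₁ hb₁ (ha.trans he₁.agree)
    refine ⟨s₂, _, .loopStep (hfit _ hb) hh he₁ he₂, ?_, hb₂, hi₂⟩
    rw [Nat.succ_mul]
    omega

end Rules

@[simp] theorem State.setVar_var (s : State) (x y : ℕ) (k : ℤ) :
    (s.setVar x k).var y = if y = x then k else s.var y := Function.update_apply _ _ _ _

@[simp] theorem State.setVar_arr (s : State) (x : ℕ) (k : ℤ) : (s.setVar x k).arr = s.arr := rfl

@[simp] theorem State.setArr_var (s : State) (a : ℕ) (i k : ℤ) : (s.setArr a i k).var = s.var := rfl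

/-! ## Reachability in a grid -/

/-- `Conn free i j i' j'`: a monotone walk through free cells leads from `(i, j)` to `(i', j')`. -/
inductive Conn (free : ℕ → ℕ → Prop) (i j : ℕ) : ℕ → ℕ → Prop
  | refl : free i j → Conn free i j i j
  | up {x y : ℕ} : Conn free i j x y → free (x + 1) y → Conn free i j (x + 1) y
  | right {x y : ℕ} : Conn free i j x y → free x (y + 1) → Conn free i j x (y + 1)
  | diag {x y : ℕ} : Conn free i j x y → free (x + 1) (y + 1) → Conn free i j (x + 1) (y + 1)

namespace Conn

variable {free : ℕ → ℕ → Prop} {i j i' j' i'' j'' : ℕ}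

theorem le (h : Conn free i j i' j') : i ≤ i' ∧ j ≤ j' := by
  induction h with
  | refl => simp
  | up _ _ ih | right _ _ ih | diag _ _ ih => omega

theorem free_right (h : Conn free i j i' j') : free i' j' := by
  cases h <;> assumption

theorem free_left (h : Conn free i j i' j') : free i j := by
  induction h <;> assumption

theorem trans (h : Conn free i j i' j') (h' : Conn free i' j' i'' j'') :
    Conn free i j i'' j'' := by
  induction h' with
  | refl => exact h
  | up _ hf ih => exact ih.up hf
  | right _ hf ih => exact ih.right hf
  | diag _ hf ih => exact ih.diag hf

theorem of_row (hij : j ≤ j') (h : ∀ c, j ≤ c → c ≤ j' → free i c) : Conn free i j i j' := by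
  induction j', hij using Nat.le_induction with
  | base => exact .refl (h j le_rfl le_rfl)
  | succ n hn ih =>
    exact (ih fun c h1 h2 => h c h1 (by omega)).right (h _ (by omega) le_rfl)

theorem of_col (hij : i ≤ i') (h : ∀ r, i ≤ r → r ≤ i' → free r j) : Conn free i j i' j := by
  induction i', hij using Nat.le_induction with
  | base => exact .refl (h i le_rfl le_rfl)
  | succ n hn ih =>
    exact (ih fun c h1 h2 => h c h1 (by omega)).up (h _ (by omega) le_rfl)

theorem transpose (h : Conn free i j i' j') : Conn (fun x y => free y x) j i j' i' := by
  induction h with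
  | refl h => exact .refl h
  | up _ hf ih => exact ih.right hf
  | right _ hf ih => exact ih.up hf
  | diag _ hf ih => exact ih.diag hf

end Conn

/-! ## Grids whose free cells are given by one inequality -/

theorem exists_argmin_Icc (f : ℕ → ℤ) {i i' : ℕ} (h : i ≤ i') :
    ∃ s, i ≤ s ∧ s ≤ i' ∧ ∀ r, i ≤ r → r ≤ i' → f s ≤ f r := by
  obtain ⟨s, hs, hm⟩ := Finset.exists_min_image (Finset.Icc i i') f ⟨i, by simp [h]⟩
  simp only [Finset.mem_Icc] at hs hm
  exact ⟨s, hs.1, hs.2, fun r h1 h2 => hm r ⟨h1, h2⟩⟩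

theorem exists_argmax_Icc (f : ℕ → ℤ) {i i' : ℕ} (h : i ≤ i') :
    ∃ s, i ≤ s ∧ s ≤ i' ∧ ∀ r, i ≤ r → r ≤ i' → f r ≤ f s := by
  obtain ⟨s, h1, h2, h3⟩ := exists_argmin_Icc (fun r => -f r) h
  exact ⟨s, h1, h2, fun r h4 h5 => by have := h3 r h4 h5; omega⟩

theorem exists_last_le {p : ℕ → Prop} {j j' : ℕ} (h : ∃ c, j ≤ c ∧ c ≤ j' ∧ p c) :
    ∃ c, j ≤ c ∧ c ≤ j' ∧ p c ∧ ∀ c', c < c' → c' ≤ j' → ¬ p c' := by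
  obtain ⟨c, h1, h2, h3⟩ := h
  induction hd : j' - c using Nat.strong_induction_on generalizing c with
  | _ d ih =>
    by_cases hc : ∃ c', c < c' ∧ c' ≤ j' ∧ p c'
    · obtain ⟨c', h4, h5, h6⟩ := hc
      exact ih (j' - c') (by omega) c' (by omega) h5 h6 rfl
    · push Not at hc
      exact ⟨c, h1, h2, h3, hc⟩

theorem exists_first_ge {p : ℕ → Prop} {j j' : ℕ} (h : ∃ c, j ≤ c ∧ c ≤ j' ∧ p c) :
    ∃ c, j ≤ c ∧ c ≤ j' ∧ p c ∧ ∀ c', j ≤ c' → c' < c → ¬ p c' := by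
  obtain ⟨c, h1, h2, h3⟩ := h
  induction c using Nat.strong_induction_on with
  | _ c ih =>
    by_cases hc : ∃ c', j ≤ c' ∧ c' < c ∧ p c'
    · obtain ⟨c', h4, h5, h6⟩ := hc
      exact ih c' h5 h4 (by omega) h6
    · push Not at hc
      exact ⟨c, h1, h2, h3, hc⟩

/-- No barrier separates `(i, j)` from `(i', j')` in the grid with free cells `f r ≤ g c`: no
blocked row or column, and no blocked hook around one of the two cells. -/
structure NoBarrier (f g : ℕ → ℤ) (i j i' j' : ℕ) : Prop where
  start : f i ≤ g j
  finish : f i' ≤ g j'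
  row : ∀ r, i ≤ r → r ≤ i' → ∃ c, j ≤ c ∧ c ≤ j' ∧ f r ≤ g c
  col : ∀ c, j ≤ c → c ≤ j' → ∃ r, i ≤ r ∧ r ≤ i' ∧ f r ≤ g c
  forth : ∀ r c, i < r → r ≤ i' → j < c → c ≤ j' →
    (∃ c', j ≤ c' ∧ c' < c ∧ f r ≤ g c') ∨ ∃ r', i ≤ r' ∧ r' < r ∧ f r' ≤ g c
  back : ∀ r c, i ≤ r → r < i' → j ≤ c → c < j' →
    (∃ c', c < c' ∧ c' ≤ j' ∧ f r ≤ g c') ∨ ∃ r', r < r' ∧ r' ≤ i' ∧ f r' ≤ g c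

section Barrier

variable {f g : ℕ → ℤ} {i j i' j' : ℕ}

/-- A walk meets every row and every column between its ends, and it cannot leave the rectangle
inside a hook. Diagonal steps are the only danger at the corner of a hook, and the form `f r ≤ g c`
of the free cells excludes them. -/
theorem NoBarrier.of_conn (h : Conn (fun x y => f x ≤ g y) i j i' j') :
    NoBarrier f g i j i' j' := by
  have hle := h.le
  have hst : f i ≤ g j := h.free_left
  have hfi : f i' ≤ g j' := h.free_right
  refine ⟨hst, hfi, ?_, ?_, ?_, ?_⟩
  · clear hfi hle
    induction h with
    | refl => intro r h1 h2; obtain rfl : r = i := by omega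
              exact ⟨j, le_rfl, le_rfl, hst⟩
    | @up x y h hf ih =>
      intro r h1 h2
      have := h.le
      by_cases hr : r = x + 1
      · subst hr; exact ⟨y, by omega, le_rfl, hf⟩
      · exact ih r h1 (by omega)
    | @right x y h hf ih =>
      intro r h1 h2
      obtain ⟨c, h3, h4, h5⟩ := ih r h1 h2
      exact ⟨c, h3, by omega, h5⟩
    | @diag x y h hf ih =>
      intro r h1 h2
      have := h.le
      by_cases hr : r = x + 1
      · subst hr; exact ⟨y + 1, by omega, le_rfl, hf⟩
      · obtain ⟨c, h3, h4, h5⟩ := ih r h1 (by omega)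
        exact ⟨c, h3, by omega, h5⟩
  · clear hfi hle
    induction h with
    | refl => intro r h1 h2; obtain rfl : r = j := by omega
              exact ⟨i, le_rfl, le_rfl, hst⟩
    | @right x y h hf ih =>
      intro r h1 h2
      have := h.le
      by_cases hr : r = y + 1
      · subst hr; exact ⟨x, by omega, le_rfl, hf⟩
      · exact ih r h1 (by omega)
    | @up x y h hf ih =>
      intro r h1 h2
      obtain ⟨c, h3, h4, h5⟩ := ih r h1 h2
      exact ⟨c, h3, by omega, h5⟩
    | @diag x y h hf ih =>
      intro r h1 h2
      have := h.le
      by_cases hr : r = y + 1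
      · subst hr; exact ⟨x + 1, by omega, le_rfl, hf⟩
      · obtain ⟨c, h3, h4, h5⟩ := ih r h1 (by omega)
        exact ⟨c, h3, by omega, h5⟩
  · intro r c h1 h2 h3 h4
    by_contra hcon
    push Not at hcon
    obtain ⟨hr, hc⟩ := hcon
    have key : ∀ x y, Conn (fun x y => f x ≤ g y) i j x y → x < r ∧ y < c := by
      intro x y hxy
      induction hxy with
      | refl => exact ⟨h1, h3⟩
      | @up x y h hf ih =>
        have := h.le
        have := hr y (by omega) ih.2
        have : x + 1 ≠ r := by rintro rfl; omega
        omega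
      | @right x y h hf ih =>
        have := h.le
        have := hc x (by omega) ih.1
        have : y + 1 ≠ c := by rintro rfl; omega
        omega
      | @diag x y h hf ih =>
        have := h.le
        refine ⟨?_, ?_⟩
        · by_contra hx
          obtain rfl : r = x + 1 := by omega
          -- Slipping diagonally through the corner would give `f i ≤ g j < f r ≤ g c < f i`.
          by_cases hy : y + 1 = c
          · subst hy
            have h5 := hr j le_rfl (by omega)
            have h6 := hc i le_rfl (by omega)
            omega
          · have := hr (y + 1) (by omega) (by omega)
            omega
        · by_contra hy
          obtain rfl : c = y + 1 := by omega
          by_cases hx : x + 1 = r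
          · subst hx
            have h5 := hr j le_rfl (by omega)
            have h6 := hc i le_rfl (by omega)
            omega
          · have := hc (x + 1) (by omega) (by omega)
            omega
    have := key _ _ h
    omega
  · intro r c h1 h2 h3 h4
    by_contra hcon
    push Not at hcon
    obtain ⟨hr, hc⟩ := hcon
    have hA := hr j' (by omega) le_rfl
    have hB := hc i' (by omega) le_rfl
    -- The walk never gets strictly beyond both arms of the hook. At the corner the contradiction is
    -- `f r ≤ g c < f i' ≤ g j' < f r`.
    have key : ∀ x y, Conn (fun x y => f x ≤ g y) i j x y → x ≤ i' → y ≤ j' →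
        ¬ (r < x ∧ c < y) := by
      intro x y hxy
      induction hxy with
      | refl => intro _ _ h; omega
      | @up x y h hf ih =>
        intro hx hy hxy
        have hfr : f x ≤ g y := h.free_right
        by_cases hxr : r < x
        · exact ih (by omega) hy ⟨hxr, hxy.2⟩
        · obtain rfl : r = x := by omega
          have := hr y hxy.2 hy
          omega
      | @right x y h hf ih =>
        intro hx hy hxy
        have hfr : f x ≤ g y := h.free_right
        by_cases hxr : c < y
        · exact ih hx (by omega) ⟨hxy.1, hxr⟩
        · obtain rfl : c = y := by omega
          have := hc x hxy.1 hx
          omega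
      | @diag x y h hf ih =>
        intro hx hy hxy
        have hfr : f x ≤ g y := h.free_right
        by_cases hxr : r < x
        · by_cases hyc : c < y
          · exact ih (by omega) (by omega) ⟨hxr, hyc⟩
          · obtain rfl : c = y := by omega
            have := hc x hxr (by omega)
            omega
        · obtain rfl : r = x := by omega
          by_cases hyc : c < y
          · have := hr y hyc (by omega)
            omega
          · obtain rfl : c = y := by omega
            omega
    exact key _ _ h le_rfl le_rfl ⟨h2, h4⟩

/-- A cell from which no improving vertical or horizontal move exists lies strictly lowest. -/
theorem lt_of_stuck (hi : i < i') (hst : f i ≤ g j)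
    (hrow : ∀ r, i ≤ r → r ≤ i' → ∃ c, j ≤ c ∧ c ≤ j' ∧ f r ≤ g c)
    (hcol : ∀ c, j ≤ c → c ≤ j' → ∃ r, i ≤ r ∧ r ≤ i' ∧ f r ≤ g c)
    (hforth : ∀ r c, i < r → r ≤ i' → j < c → c ≤ j' →
      (∃ c', j ≤ c' ∧ c' < c ∧ f r ≤ g c') ∨ ∃ r', i ≤ r' ∧ r' < r ∧ f r' ≤ g c)
    (hA : ¬ ∃ r, i < r ∧ r ≤ i' ∧ ∀ r', i ≤ r' → r' ≤ r → f r ≤ f r' ∧ f r' ≤ g j)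
    (hB : ¬ ∃ c, j < c ∧ c ≤ j' ∧ ∀ c', j ≤ c' → c' ≤ c → g c' ≤ g c ∧ f i ≤ g c') :
    f i < f i' := by
  push Not at hA hB
  suffices H : ∀ r, i < r → r ≤ i' → f i < f r from H i' hi le_rfl
  by_contra hcon
  push Not at hcon
  obtain ⟨r₀, h1, h2, h3⟩ := hcon
  -- Take the first row `r` above `i` that is no higher than row `i`. As the vertical move to it is
  -- impossible, column `j` is blocked on the way.
  obtain ⟨r, hr1, hr2, hr3, hr4⟩ := exists_first_ge (p := fun r => f r ≤ f i)
    (j := i + 1) (j' := i') ⟨r₀, h1, h2, h3⟩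
  obtain ⟨s, hs1, hs2, hs3⟩ := hA r (by omega) hr2
  have hs4 : g j < f s := hs3 (by
    by_cases hsi : s = i
    · subst hsi; exact hr3
    · by_cases hsr : s = r
      · rw [hsr]
      · have := hr4 s (by omega) (by omega); omega)
  -- Row `r1` is the first one blocked in column `j`. Its free cell lies in a column higher than
  -- column `j`, so some column after `j` is at least as high as `j`.
  obtain ⟨r1, h4, h5, h6, h7⟩ := exists_first_ge (p := fun r => g j < f r)
    (j := i) (j' := r) ⟨s, hs1, hs2, hs4⟩
  have h8 : r1 ≠ i := by rintro rfl; omega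
  have h9 : r1 ≠ r := by rintro rfl; omega
  obtain ⟨c₀, h10, h11, h12⟩ := hrow r1 h4 (by omega)
  have h13 : c₀ ≠ j := by rintro rfl; omega
  -- Column `c` is the first such column. As the horizontal move to it is impossible, row `i` is
  -- blocked before it, first in column `c1`.
  obtain ⟨c, hc1, hc2, hc3, hc4⟩ := exists_first_ge (p := fun c => g j ≤ g c)
    (j := j + 1) (j' := j') ⟨c₀, by omega, h11, by omega⟩
  obtain ⟨d, hd1, hd2, hd3⟩ := hB c (by omega) hc2
  have hd4 : g d < f i := hd3 (by
    by_cases hdj : d = j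
    · subst hdj; exact hc3
    · by_cases hdc : d = c
      · rw [hdc]
      · have := hc4 d (by omega) (by omega); omega)
  obtain ⟨c1, h14, h15, h16, h17⟩ := exists_first_ge (p := fun c => g c < f i)
    (j := j) (j' := c) ⟨d, hd1, hd2, hd4⟩
  have h18 : c1 ≠ j := by rintro rfl; omega
  have h19 : c1 ≠ c := by rintro rfl; omega
  -- Row `r1` and column `c1` form a blocked hook around `(i, j)`: the columns before `c1` are at
  -- most `g j`, which is below `f r1`, and the rows before `r1` are at least `f i`, which is above
  -- `g c1`.
  rcases hforth r1 c1 (by omega) (by omega) (by omega) (by omega) with ⟨c', a1, a2, a3⟩ | ⟨r', a1, a2, a3⟩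
  · by_cases hcj : c' = j
    · subst hcj; omega
    · have := hc4 c' (by omega) (by omega); omega
  · by_cases hri : r' = i
    · subst hri; omega
    · have := hr4 r' (by omega) (by omega); omega

/-- Greedy moves from both ends. A straight free move to a row that is lowest, or a column that is
highest, among those passed loses nothing, and the rectangle shrinks. If no such move exists at
either end, then `lt_of_stuck` and its mirror image give `f i < f i'` and `f i' < f i`. -/
theorem NoBarrier.conn (h : NoBarrier f g i j i' j') (hi : i ≤ i') (hj : j ≤ j') :
    Conn (fun x y => f x ≤ g y) i j i' j' := by
  induction hd : (i' - i) + (j' - j) using Nat.strong_induction_on generalizing i j i' j' with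
  | _ d ih =>
  rcases hi.eq_or_lt with rfl | hi'
  · refine Conn.of_row hj fun c h1 h2 => ?_
    obtain ⟨r, h3, h4, h5⟩ := h.col c h1 h2
    obtain rfl : r = i := by omega
    exact h5
  rcases hj.eq_or_lt with rfl | hj'
  · refine Conn.of_col hi fun r h1 h2 => ?_
    obtain ⟨c, h3, h4, h5⟩ := h.row r h1 h2
    obtain rfl : c = j := by omega
    exact h5
  by_cases hA : ∃ r, i < r ∧ r ≤ i' ∧ ∀ r', i ≤ r' → r' ≤ r → f r ≤ f r' ∧ f r' ≤ g j
  · obtain ⟨r, h1, h2, h3⟩ := hA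
    refine (Conn.of_col h1.le fun r' h4 h5 => (h3 r' h4 h5).2).trans
      (ih ((i' - r) + (j' - j)) (by omega) ?_ h2 hj rfl)
    -- The conditions survive the move: wherever a skipped row served as a witness, row `r` serves
    -- too, since it is no higher.
    refine ⟨(h3 r h1.le le_rfl).2, h.finish, fun r' h4 h5 => h.row r' (by omega) h5,
      fun c h4 h5 => ?_, fun r' c h4 h5 h6 h7 => ?_,
      fun r' c h4 h5 h6 h7 => h.back r' c (by omega) h5 h6 h7⟩
    · obtain ⟨s, h6, h7, h8⟩ := h.col c h4 h5
      by_cases hs : r ≤ s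
      · exact ⟨s, hs, h7, h8⟩
      · exact ⟨r, le_rfl, h2, ((h3 s h6 (by omega)).1).trans h8⟩
    · rcases h.forth r' c (by omega) h5 h6 h7 with h8 | ⟨s, h8, h9, h10⟩
      · exact .inl h8
      · right
        by_cases hs : r ≤ s
        · exact ⟨s, hs, h9, h10⟩
        · exact ⟨r, le_rfl, h4, ((h3 s h8 (by omega)).1).trans h10⟩
  by_cases hB : ∃ c, j < c ∧ c ≤ j' ∧ ∀ c', j ≤ c' → c' ≤ c → g c' ≤ g c ∧ f i ≤ g c'
  · obtain ⟨c, h1, h2, h3⟩ := hB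
    refine (Conn.of_row h1.le fun r' h4 h5 => (h3 r' h4 h5).2).trans
      (ih ((i' - i) + (j' - c)) (by omega) ?_ hi h2 rfl)
    refine ⟨(h3 c h1.le le_rfl).2, h.finish, fun r h4 h5 => ?_, fun c' h4 h5 => h.col c' (by omega) h5,
      fun r c' h4 h5 h6 h7 => ?_,
      fun r' c h4 h5 h6 h7 => h.back r' c h4 h5 (by omega) h7⟩
    · obtain ⟨s, h6, h7, h8⟩ := h.row r h4 h5
      by_cases hs : c ≤ s
      · exact ⟨s, hs, h7, h8⟩
      · exact ⟨c, le_rfl, h2, h8.trans ((h3 s h6 (by omega)).1)⟩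
    · rcases h.forth r c' h4 h5 (by omega) h7 with ⟨s, h8, h9, h10⟩ | h8
      · left
        by_cases hs : c ≤ s
        · exact ⟨s, hs, h9, h10⟩
        · exact ⟨c, le_rfl, h6, h10.trans ((h3 s h8 (by omega)).1)⟩
      · exact .inr h8
  by_cases hA' : ∃ r, i ≤ r ∧ r < i' ∧ ∀ r', r ≤ r' → r' ≤ i' → f r ≤ f r' ∧ f r' ≤ g j'
  · obtain ⟨r, h1, h2, h3⟩ := hA'
    refine Conn.trans (ih ((r - i) + (j' - j)) (by omega) ?_ h1 hj rfl)
      (Conn.of_col h2.le fun r' h4 h5 => (h3 r' h4 h5).2)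
    refine ⟨h.start, (h3 r le_rfl h2.le).2, fun r' h4 h5 => h.row r' h4 (by omega),
      fun c h4 h5 => ?_, fun r' c h4 h5 h6 h7 => h.forth r' c h4 (by omega) h6 h7,
      fun r' c h4 h5 h6 h7 => ?_⟩
    · obtain ⟨s, h6, h7, h8⟩ := h.col c h4 h5
      by_cases hs : s ≤ r
      · exact ⟨s, h6, hs, h8⟩
      · exact ⟨r, h1, le_rfl, ((h3 s (by omega) h7).1).trans h8⟩
    · rcases h.back r' c h4 (by omega) h6 h7 with h8 | ⟨s, h8, h9, h10⟩
      · exact .inl h8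
      · right
        by_cases hs : s ≤ r
        · exact ⟨s, h8, hs, h10⟩
        · exact ⟨r, h5, le_rfl, ((h3 s (by omega) h9).1).trans h10⟩
  by_cases hB' : ∃ c, j ≤ c ∧ c < j' ∧ ∀ c', c ≤ c' → c' ≤ j' → g c' ≤ g c ∧ f i' ≤ g c'
  · obtain ⟨c, h1, h2, h3⟩ := hB'
    refine Conn.trans (ih ((i' - i) + (c - j)) (by omega) ?_ hi h1 rfl)
      (Conn.of_row h2.le fun r' h4 h5 => (h3 r' h4 h5).2)
    refine ⟨h.start, (h3 c le_rfl h2.le).2, fun r h4 h5 => ?_,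
      fun c' h4 h5 => h.col c' h4 (by omega),
      fun r' c h4 h5 h6 h7 => h.forth r' c h4 h5 h6 (by omega),
      fun r c' h4 h5 h6 h7 => ?_⟩
    · obtain ⟨s, h6, h7, h8⟩ := h.row r h4 h5
      by_cases hs : s ≤ c
      · exact ⟨s, h6, hs, h8⟩
      · exact ⟨c, h1, le_rfl, h8.trans ((h3 s (by omega) h7).1)⟩
    · rcases h.back r c' h4 h5 h6 (by omega) with ⟨s, h8, h9, h10⟩ | h8
      · left
        by_cases hs : s ≤ c
        · exact ⟨s, h8, hs, h10⟩
        · exact ⟨c, h7, le_rfl, h10.trans ((h3 s (by omega) h9).1)⟩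
      · exact .inr h8
  exfalso
  have h1 := lt_of_stuck hi' h.start h.row h.col h.forth hA hB
  -- the mirror image of the same argument
  have hsub : ∀ {x y z : ℕ}, x ≤ y → y ≤ z → x + z - (x + z - y) = y := fun _ _ => by omega
  have h2 := lt_of_stuck (f := fun r => f (i + i' - r)) (g := fun c => g (j + j' - c))
    (i := i) (j := j) (i' := i') (j' := j') hi' (by simpa using h.finish)
    (fun r h1 h2 => by
      obtain ⟨c, h3, h4, h5⟩ := h.row (i + i' - r) (by omega) (by omega)
      exact ⟨j + j' - c, by omega, by omega, by simpa [hsub h3 h4] using h5⟩)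
    (fun c h1 h2 => by
      obtain ⟨r, h3, h4, h5⟩ := h.col (j + j' - c) (by omega) (by omega)
      exact ⟨i + i' - r, by omega, by omega, by simpa [hsub h3 h4] using h5⟩)
    (fun r c h1 h2 h3 h4 => by
      rcases h.back (i + i' - r) (j + j' - c) (by omega) (by omega) (by omega) (by omega) with
        ⟨c', h5, h6, h7⟩ | ⟨r', h5, h6, h7⟩
      · exact .inl ⟨j + j' - c', by omega, by omega, by simpa [hsub (by omega : j ≤ c') h6] using h7⟩
      · exact .inr ⟨i + i' - r', by omega, by omega, by simpa [hsub (by omega : i ≤ r') h6] using h7⟩)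
    (fun ⟨r, h1, h2, h3⟩ => hA' ⟨i + i' - r, by omega, by omega, fun r' h4 h5 => by
      have := h3 (i + i' - r') (by omega) (by omega)
      simpa [hsub (by omega : i ≤ r') h5] using this⟩)
    (fun ⟨c, h1, h2, h3⟩ => hB' ⟨j + j' - c, by omega, by omega, fun c' h4 h5 => by
      have := h3 (j + j' - c') (by omega) (by omega)
      simpa [hsub (by omega : j ≤ c') h5] using this⟩)
  simp at h2
  omega

theorem conn_iff_noBarrier (hi : i ≤ i') (hj : j ≤ j') :
    Conn (fun x y => f x ≤ g y) i j i' j' ↔ NoBarrier f g i j i' j' :=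
  ⟨NoBarrier.of_conn, fun h => h.conn hi hj⟩

end Barrier

/-! ### Barrier conditions for targets in the last column, split between source and target. -/

section Targets

variable (f g : ℕ → ℤ) (a b : ℕ)

/-- A column of height `w` is met, from the left, before any column lower than `u`. -/
def PrefixMeets (u w : ℤ) : Prop := ∃ c < b, w ≤ g c ∧ ∀ c' ≤ c, u ≤ g c'

/-- A column of height `w` is met, from the right, before any column lower than `u`. -/
def SuffixMeets (u w : ℤ) : Prop := ∃ c < b, w ≤ g c ∧ ∀ c', c ≤ c' → c' < b → u ≤ g c'

/-- A row of height at most `w` is met, from below, before any row higher than `h`. -/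
def RowMeets (h w : ℤ) : Prop := ∃ r < a, f r ≤ w ∧ ∀ r' ≤ r, f r' ≤ h

/-- No hook below row `i` blocks a cell of height `v` of row `i` in the last column, at least above
the topmost blocked row. -/
def BackOpen (i : ℕ) (v : ℤ) : Prop :=
  ∀ r < i, (∃ s, r ≤ s ∧ s < i ∧ ∀ c < b, g c < f s) ∨ SuffixMeets g b v (f r) ∨
    ∃ s, r < s ∧ s < i ∧ SuffixMeets g b (f s) (f r)

/-- No hook blocks the way from the first column of row `i` up to row `i'`. -/
def LeftAlive (i i' : ℕ) : Prop :=
  ∀ r, i < r → r ≤ i' → ∃ s, i ≤ s ∧ s < r ∧ PrefixMeets g b (f s) (f r)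

/-- No hook blocks the way from the first row of column `j` to the last column, at least before the
first blocked column. -/
def BottomAlive (j : ℕ) : Prop :=
  ∀ c, j < c → c < b → (∀ r < a, g c < f r) ∨ ∃ s, j ≤ s ∧ s < c ∧ RowMeets f a (g s) (g c)

variable {f g a b} {i i' j : ℕ}

theorem SuffixMeets.mono {u v w : ℤ} (h : SuffixMeets g b u w) (hv : v ≤ u) :
    SuffixMeets g b v w := by
  obtain ⟨c, h1, h2, h3⟩ := h
  exact ⟨c, h1, h2, fun c' h4 h5 => hv.trans (h3 c' h4 h5)⟩

/-- The hook condition at the end of a walk to the last column. -/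
theorem back_of_backOpen {j : ℕ} (hb : 0 < b) (ho : BackOpen f g b i' (f i'))
    (hrow : ∀ r, i ≤ r → r ≤ i' → ∃ c, j ≤ c ∧ c ≤ b - 1 ∧ f r ≤ g c) :
    ∀ r c, i ≤ r → r < i' → j ≤ c → c < b - 1 →
      (∃ c', c < c' ∧ c' ≤ b - 1 ∧ f r ≤ g c') ∨ ∃ r', r < r' ∧ r' ≤ i' ∧ f r' ≤ g c := by
  intro r c h1 h2 h3 h4
  have hs : ∀ s, r < s → s ≤ i' → SuffixMeets g b (f s) (f r) →
      (∃ c', c < c' ∧ c' ≤ b - 1 ∧ f r ≤ g c') ∨ ∃ r', r < r' ∧ r' ≤ i' ∧ f r' ≤ g c := by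
    rintro s h5 h6 ⟨c1, h7, h8, h9⟩
    by_cases hc : c < c1
    · exact .inl ⟨c1, hc, by omega, h8⟩
    · exact .inr ⟨s, h5, h6, h9 c (by omega) (by omega)⟩
  rcases ho r h2 with ⟨s, h5, h6, h7⟩ | h5 | ⟨s, h5, h6, h7⟩
  · obtain ⟨c', h8, h9, h10⟩ := hrow s (by omega) (by omega)
    have := h7 c' (by omega)
    omega
  · exact hs i' h2 le_rfl h5
  · exact hs s h5 (by omega) h7

/-- Let `c1` be the last free column of row `r`. All later columns are free in some row above `r`,
so they are at least the minimum of `f` over those rows; a row `s` attaining it is the witness. Rows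
below the source occur only for a source in the first column. There the walk crosses all columns, so
each column is at least the minimum of `f` between source and target, and otherwise the row is
blocked completely. -/
theorem backOpen_of_noBarrier {j : ℕ} (hi : i ≤ i') (hj : j < b)
    (h : NoBarrier f g i j i' (b - 1))
    (hbelow : i = 0 ∨ j = 0) : BackOpen f g b i' (f i') := by
  intro r hr
  by_cases hir : i ≤ r
  · right
    obtain ⟨c1, h1, h2, h3, h4⟩ := exists_last_le (p := fun c => f r ≤ g c) (h.row r hir hr.le)
    obtain ⟨s, h5, h6, h7⟩ := exists_argmin_Icc f (show r + 1 ≤ i' by omega)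
    have hm : SuffixMeets g b (f s) (f r) := by
      refine ⟨c1, by omega, h3, fun c' h8 h9 => ?_⟩
      by_cases hc' : c' = b - 1
      · subst hc'
        exact (h7 i' hr le_rfl).trans h.finish
      · rcases h.back r c' hir hr (by omega) (by omega) with ⟨d, h10, h11, h12⟩ | ⟨t, h10, h11, h12⟩
        · exact absurd h12 (h4 d (by omega) h11)
        · exact (h7 t h10 h11).trans h12
    by_cases hs : s = i'
    · subst hs; exact .inl hm
    · exact .inr ⟨s, by omega, by omega, hm⟩
  · obtain rfl : j = 0 := by omega
    obtain ⟨s, h5, h6, h7⟩ := exists_argmin_Icc f hi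
    by_cases hblk : ∃ c < b, f r ≤ g c
    · right
      obtain ⟨c, h8, h9⟩ := hblk
      have hm : SuffixMeets g b (f s) (f r) := by
        refine ⟨c, h8, h9, fun c' h10 h11 => ?_⟩
        obtain ⟨t, h12, h13, h14⟩ := h.col c' (by omega) (by omega)
        exact (h7 t h12 h13).trans h14
      by_cases hs : s = i'
      · subst hs; exact .inl hm
      · exact .inr ⟨s, by omega, by omega, hm⟩
    · push Not at hblk
      exact .inl ⟨r, le_rfl, hr, hblk⟩

/-- All columns are crossed, so the column condition says that the lowest row between source and
target is free everywhere. For the hooks at the start, row `r` needs its first free column to come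
before any column lower than all rows from `i` up to `r`; a lowest one among these rows is the
witness in `LeftAlive`. -/
theorem conn_left_iff (hi : i ≤ i') (hb : 0 < b) :
    Conn (fun x y => f x ≤ g y) i 0 i' (b - 1) ↔
      f i' ≤ g (b - 1) ∧ BackOpen f g b i' (f i') ∧ f i ≤ g 0 ∧ LeftAlive f g b i i' ∧
        ∃ r, i ≤ r ∧ r ≤ i' ∧ ∀ c < b, f r ≤ g c := by
  rw [conn_iff_noBarrier hi (by omega)]
  constructor
  · intro h
    refine ⟨h.finish, backOpen_of_noBarrier hi hb h (.inr rfl), h.start, fun r h1 h2 => ?_, ?_⟩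
    · obtain ⟨c1, h3, h4, h5, h6⟩ := exists_first_ge (p := fun c => f r ≤ g c)
        (h.row r h1.le h2)
      obtain ⟨s, h7, h8, h9⟩ := exists_argmin_Icc f (show i ≤ r - 1 by omega)
      refine ⟨s, h7, by omega, c1, by omega, h5, fun c' h10 => ?_⟩
      by_cases hc : c' = 0
      · subst hc
        exact (h9 i le_rfl (by omega)).trans h.start
      · rcases h.forth r c' h1 h2 (by omega) (by omega) with ⟨d, h11, h12, h13⟩ | ⟨t, h11, h12, h13⟩
        · exact absurd h13 (h6 d h11 (by omega))
        · exact (h9 t h11 (by omega)).trans h13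
    · obtain ⟨s, h7, h8, h9⟩ := exists_argmin_Icc f hi
      refine ⟨s, h7, h8, fun c hc => ?_⟩
      obtain ⟨t, h10, h11, h12⟩ := h.col c (by omega) (by omega)
      exact (h9 t h10 h11).trans h12
  · rintro ⟨h1, h2, h3, h4, r, h5, h6, h7⟩
    have hrow : ∀ r, i ≤ r → r ≤ i' → ∃ c, 0 ≤ c ∧ c ≤ b - 1 ∧ f r ≤ g c := by
      intro r hr hr'
      by_cases hri : r = i
      · subst hri; exact ⟨0, le_rfl, by omega, h3⟩
      · obtain ⟨s, _, _, c, hc, hc', _⟩ := h4 r (by omega) hr'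
        exact ⟨c, by omega, by omega, hc'⟩
    refine ⟨h3, h1, hrow, fun c hc hc' => ⟨r, h5, h6, h7 c (by omega)⟩, fun r c h8 h9 h10 h11 => ?_,
      back_of_backOpen hb h2 hrow⟩
    obtain ⟨s, hs, hs', c1, hc, hc', hc''⟩ := h4 r h8 h9
    by_cases hcc : c1 < c
    · exact .inl ⟨c1, by omega, hcc, hc'⟩
    · exact .inr ⟨s, hs, hs', hc'' c (by omega)⟩

/-- The analogue for sources in the first row. `BottomAlive` ranges over all `a` rows and does not
mention the target; this is harmless, because the free row that it finds may lie beyond the target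
only if all rows up to the target are free in the column `s`. -/
theorem conn_bottom_iff (hi : i' < a) (hj : j < b) :
    Conn (fun x y => f x ≤ g y) 0 j i' (b - 1) ↔
      f i' ≤ g (b - 1) ∧ BackOpen f g b i' (f i') ∧ f 0 ≤ g j ∧ BottomAlive f g a b j ∧
        (∃ r ≤ i', ∀ c, j ≤ c → c < b → f r ≤ g c) ∧ ∃ c, j ≤ c ∧ c < b ∧ ∀ r ≤ i', f r ≤ g c := by
  rw [conn_iff_noBarrier (by omega) (by omega)]
  constructor
  · intro h
    refine ⟨h.finish, backOpen_of_noBarrier (by omega) hj h (.inl rfl), h.start,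
      fun c h1 h2 => .inr ?_, ?_, ?_⟩
    · obtain ⟨r1, h3, h4, h5, h6⟩ := exists_first_ge (p := fun r => f r ≤ g c)
        (h.col c h1.le (by omega))
      obtain ⟨s, h7, h8, h9⟩ := exists_argmax_Icc g (show j ≤ c - 1 by omega)
      refine ⟨s, h7, by omega, r1, by omega, h5, fun r' h10 => ?_⟩
      by_cases hr : r' = 0
      · subst hr
        exact h.start.trans (h9 j le_rfl (by omega))
      · rcases h.forth r' c (by omega) (by omega) h1 (by omega) with
          ⟨d, h11, h12, h13⟩ | ⟨t, h11, h12, h13⟩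
        · exact h13.trans (h9 d h11 (by omega))
        · exact absurd h13 (h6 t h11 (by omega))
    · obtain ⟨s, h7, h8, h9⟩ := exists_argmin_Icc f (Nat.zero_le i')
      refine ⟨s, h8, fun c hc hc' => ?_⟩
      obtain ⟨t, h10, h11, h12⟩ := h.col c hc (by omega)
      exact (h9 t h10 h11).trans h12
    · obtain ⟨s, h7, h8, h9⟩ := exists_argmax_Icc g (show j ≤ b - 1 by omega)
      refine ⟨s, h7, by omega, fun r hr => ?_⟩
      obtain ⟨t, h10, h11, h12⟩ := h.row r (by omega) hr
      exact h12.trans (h9 t h10 h11)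
  · rintro ⟨h1, h2, h3, h4, ⟨r, h5, h6⟩, c, h7, h8, h9⟩
    have hrow : ∀ r, 0 ≤ r → r ≤ i' → ∃ c, j ≤ c ∧ c ≤ b - 1 ∧ f r ≤ g c := fun r _ hr =>
      ⟨c, h7, by omega, h9 r hr⟩
    refine ⟨h3, h1, hrow, fun c hc hc' => ⟨r, by omega, h5, h6 c hc (by omega)⟩,
      fun r' c h10 h11 h12 h13 => ?_, back_of_backOpen (by omega) h2 hrow⟩
    rcases h4 c h12 (by omega) with h14 | ⟨s, hs, hs', r1, hr, hr', hr''⟩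
    · have := h14 r (by omega)
      have := h6 c (by omega) (by omega)
      omega
    · by_cases hrr : r1 < r'
      · exact .inr ⟨r1, by omega, hrr, hr'⟩
      · exact .inl ⟨s, hs, hs', hr'' r' (by omega)⟩

end Targets

/-! ## The scans of the half-plane solver -/

section Scans

variable {f g : ℕ → ℤ} {a b : ℕ} {SL SB : ℕ → Prop}

/-- Consecutive values differ by at most one. -/
def SlowOn (f : ℕ → ℤ) (a : ℕ) : Prop := ∀ i, i + 1 < a → f (i + 1) ≤ f i + 1 ∧ f i ≤ f (i + 1) + 1

/-- The state of the scan of the rows after `i` rows. -/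
structure RowScan (f : ℕ → ℤ) (i : ℕ) (lo hi : ℤ) (PF : ℤ → ℤ) : Prop where
  lo_le : ∀ v, lo ≤ v ↔ ∃ r < i, f r ≤ v
  hi_le : ∀ h, hi ≤ h ↔ ∀ r < i, f r ≤ h
  table : ∀ v, lo ≤ v → v < f 0 → ∀ h, PF v ≤ h ↔ RowMeets f i h v

theorem RowScan.init (f : ℕ → ℤ) (PF : ℤ → ℤ) : RowScan f 1 (f 0) (f 0) PF := by
  refine ⟨fun v => by simp, fun h => by simp, fun v h1 h2 => by omega⟩

/-- The first row of height at most `v` occurs among the first `i` rows, so a further row does not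
matter. -/
theorem rowMeets_succ {i : ℕ} {h v : ℤ} (hex : ∃ r < i, f r ≤ v) :
    RowMeets f (i + 1) h v ↔ RowMeets f i h v := by
  constructor
  · rintro ⟨r, h1, h2, h3⟩
    by_cases hr : r < i
    · exact ⟨r, hr, h2, h3⟩
    · obtain ⟨r', h4, h5⟩ := hex
      exact ⟨r', h4, h5, fun s hs => h3 s (by omega)⟩
  · rintro ⟨r, h1, h2, h3⟩
    exact ⟨r, by omega, h2, h3⟩

theorem RowScan.step_ge {i : ℕ} {lo hi : ℤ} {PF : ℤ → ℤ} (h : RowScan f i lo hi PF)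
    (hv : lo ≤ f i) : RowScan f (i + 1) lo (max hi (f i)) PF := by
  refine ⟨fun v => ?_, fun k => ?_, fun v h1 h2 k => ?_⟩
  · rw [h.lo_le]
    constructor
    · rintro ⟨r, h1, h2⟩; exact ⟨r, by omega, h2⟩
    · rintro ⟨r, h1, h2⟩
      by_cases hr : r < i
      · exact ⟨r, hr, h2⟩
      · obtain rfl : r = i := by omega
        exact (h.lo_le v).1 (hv.trans h2)
  · rw [max_le_iff, h.hi_le]
    exact ⟨fun h' r hr => (Nat.lt_succ_iff_lt_or_eq.1 hr).elim (h'.1 r) fun e => e ▸ h'.2,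
      fun h' => ⟨fun r hr => h' r (by omega), h' i (by omega)⟩⟩
  · rw [h.table v h1 h2, rowMeets_succ ((h.lo_le v).1 h1)]

/-- The hypotheses force `f i = lo - 1`: a new minimum extends the range of keys by exactly one. Its
table entry is the maximum of all rows so far, since row `i` is the first one this low. -/
theorem RowScan.step_lt {i : ℕ} {lo hi : ℤ} {PF : ℤ → ℤ} (h : RowScan f i lo hi PF)
    (hv : f i < lo) (hslow : lo ≤ f i + 1) :
    RowScan f (i + 1) (f i) (max hi (f i)) (Function.update PF (f i) (max hi (f i))) := by
  have hi_le : ∀ k, max hi (f i) ≤ k ↔ ∀ r < i + 1, f r ≤ k := fun k => by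
    rw [max_le_iff, h.hi_le]
    exact ⟨fun h' r hr => (Nat.lt_succ_iff_lt_or_eq.1 hr).elim (h'.1 r) fun e => e ▸ h'.2,
      fun h' => ⟨fun r hr => h' r (by omega), h' i (by omega)⟩⟩
  have hno : ∀ r < i, f i < f r := fun r hr => by
    by_contra hc
    have := (h.lo_le (f i)).2 ⟨r, hr, by omega⟩
    omega
  refine ⟨fun v => ?_, hi_le, fun v h1 h2 k => ?_⟩
  · constructor
    · intro h1; exact ⟨i, by omega, h1⟩
    · rintro ⟨r, h1, h2⟩
      by_cases hr : r < i
      · have := hno r hr; omega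
      · obtain rfl : r = i := by omega
        exact h2
  · by_cases hvi : v = f i
    · subst hvi
      rw [Function.update_self, hi_le]
      constructor
      · intro h3; exact ⟨i, by omega, le_rfl, fun r hr => h3 r (by omega)⟩
      · rintro ⟨r, h3, h4, h5⟩
        by_cases hr : r < i
        · have := hno r hr; omega
        · obtain rfl : r = i := by omega
          exact fun s hs => h5 s (by omega)
    · rw [Function.update_of_ne hvi, h.table v (by omega) h2,
        rowMeets_succ ((h.lo_le v).1 (by omega))]

/-- The state of the forward scan of the columns after `j` columns. -/
structure ColScan (g : ℕ → ℤ) (j : ℕ) (lo hi : ℤ) (PM : ℤ → ℤ) : Prop where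
  le_lo : ∀ v, v ≤ lo ↔ ∀ c < j, v ≤ g c
  le_hi : ∀ w, w ≤ hi ↔ ∃ c < j, w ≤ g c
  table : ∀ w, g 0 < w → w ≤ hi → ∀ u, u ≤ PM w ↔ PrefixMeets g j u w

theorem ColScan.init (g : ℕ → ℤ) (PM : ℤ → ℤ) : ColScan g 1 (g 0) (g 0) PM := by
  refine ⟨fun v => by simp, fun h => by simp, fun v h1 h2 => by omega⟩

theorem prefixMeets_neg {j : ℕ} {u w : ℤ} :
    PrefixMeets g j u w ↔ RowMeets (fun c => -g c) j (-u) (-w) := by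
  simp only [PrefixMeets, RowMeets, neg_le_neg_iff]

/-- Negation exchanges minima and maxima, so the scan of the columns inherits its steps from the
scan of the rows. -/
theorem ColScan.iff_neg {j : ℕ} {lo hi : ℤ} {PM : ℤ → ℤ} :
    ColScan g j lo hi PM ↔ RowScan (fun c => -g c) j (-hi) (-lo) (fun v => -PM (-v)) := by
  constructor
  · intro h
    refine ⟨fun v => ?_, fun k => ?_, fun v h1 h2 k => ?_⟩
    · simp only [neg_le (a := hi), neg_le (b := v), h.le_hi]
    · simp only [neg_le (a := lo), neg_le (b := k), h.le_lo]
    · rw [neg_le, h.table (-v) (by omega) (by omega), prefixMeets_neg, neg_neg, neg_neg]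
  · intro h
    refine ⟨fun v => ?_, fun k => ?_, fun v h1 h2 k => ?_⟩
    · have := h.hi_le (-v)
      simpa only [neg_le_neg_iff] using this
    · have := h.lo_le (-k)
      simpa only [neg_le_neg_iff] using this
    · have := h.table (-v) (by omega) (by omega) (-k)
      rwa [neg_neg, neg_le_neg_iff, ← prefixMeets_neg] at this

theorem ColScan.step_le {j : ℕ} {lo hi : ℤ} {PM : ℤ → ℤ} (h : ColScan g j lo hi PM)
    (hv : g j ≤ hi) : ColScan g (j + 1) (min lo (g j)) hi PM := by
  rw [ColScan.iff_neg] at *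
  have := h.step_ge (by omega)
  rwa [max_neg_neg] at this

theorem ColScan.step_gt {j : ℕ} {lo hi : ℤ} {PM : ℤ → ℤ} (h : ColScan g j lo hi PM)
    (hv : hi < g j) (hslow : g j ≤ hi + 1) :
    ColScan g (j + 1) (min lo (g j)) (g j) (Function.update PM (g j) (min lo (g j))) := by
  rw [ColScan.iff_neg] at *
  have := h.step_lt (by omega) (by omega)
  rw [max_neg_neg] at this
  convert this using 2 with v
  by_cases hvj : v = -g j
  · simp [hvj]
  · rw [Function.update_of_ne hvj, Function.update_of_ne (by omega)]

/-- The state of the backward scan of the columns when the columns from `j` on are done. -/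
structure BackScan (f g : ℕ → ℤ) (a b : ℕ) (SB : ℕ → Prop) (j : ℕ) (lo hi kt : ℤ) (SM XB : ℤ → ℤ) :
    Prop where
  le_lo : ∀ v, v ≤ lo ↔ v ≤ g (b - 1) ∧ ∀ c, j ≤ c → c < b → v ≤ g c
  le_hi : ∀ w, w ≤ hi ↔ w ≤ g (b - 1) ∨ ∃ c, j ≤ c ∧ c < b ∧ w ≤ g c
  tableS : ∀ w, g (b - 1) < w → w ≤ hi → ∀ u, u ≤ SM w ↔
    ∃ c, j ≤ c ∧ c < b ∧ w ≤ g c ∧ ∀ c', c ≤ c' → c' < b → u ≤ g c'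
  tableX : ∀ v, lo ≤ v → v ≤ g (b - 1) → ∀ h, f 0 ≤ h → (h ≤ XB v ↔
    ∃ j', j ≤ j' ∧ j' < b ∧ SB j' ∧ f 0 ≤ g j' ∧ BottomAlive f g a b j' ∧
      (∀ c, j' ≤ c → c < b → v ≤ g c) ∧ ∃ c, j' ≤ c ∧ c < b ∧ h ≤ g c)
  le_kt : f 0 ≤ kt
  kt_le : ∀ h, f 0 ≤ h → (kt ≤ h ↔ ∀ c, j ≤ c → c < b → (∀ r < a, g c < f r) ∨
    RowMeets f a h (g c) ∨ ∃ s, j ≤ s ∧ s < c ∧ RowMeets f a (g s) (g c))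

/-- The entry `f 0 - 1` means that there is no source: the table is only asked about heights `h ≥ f
0`. -/
theorem BackScan.init (SM XB : ℤ → ℤ) :
    BackScan f g a b SB b (g (b - 1)) (g (b - 1)) (f 0) SM
      (Function.update XB (g (b - 1)) (f 0 - 1)) where
  le_lo v := ⟨fun h => ⟨h, fun c _ _ => by omega⟩, fun h => h.1⟩
  le_hi w := ⟨.inl, fun h => h.elim id fun ⟨c, _, _, _⟩ => by omega⟩
  tableS w _ _ := by omega
  tableX v h1 h2 h h3 := by
    obtain rfl : v = g (b - 1) := by omega
    rw [Function.update_self]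
    exact ⟨fun _ => by omega, fun ⟨j', _, _, _⟩ => by omega⟩
  le_kt := le_rfl
  kt_le h h1 := ⟨fun _ c _ _ => by omega, fun _ => h1⟩

/-- The new lower bound and the table of the sources, copied down if the bound decreases. -/
theorem BackScan.step_lo {j : ℕ} {lo hi kt : ℤ} {SM XB : ℤ → ℤ}
    (h : BackScan f g a b SB (j + 1) lo hi kt SM XB) (hslow : lo ≤ g j + 1) :
    ∀ v, min lo (g j) ≤ v → v ≤ g (b - 1) → ∀ k, f 0 ≤ k →
      (k ≤ (if g j < lo then Function.update XB (g j) (XB lo) else XB) v ↔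
      ∃ j', j + 1 ≤ j' ∧ j' < b ∧ SB j' ∧ f 0 ≤ g j' ∧ BottomAlive f g a b j' ∧
      (∀ c, j' ≤ c → c < b → v ≤ g c) ∧ ∃ c, j' ≤ c ∧ c < b ∧ k ≤ g c) := by
  intro v h1 h2 k hk
  split_ifs with hlt
  · by_cases hv : v = g j
    · subst hv
      have hlo := (h.le_lo lo).1 le_rfl
      rw [Function.update_self, h.tableX lo le_rfl hlo.1 k hk]
      refine exists_congr fun j' => ⟨fun ⟨h3, h4, h5, h6, h7, h8, h9⟩ =>
        ⟨h3, h4, h5, h6, h7, fun c hc hc' => hlt.le.trans (h8 c hc hc'), h9⟩,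
        fun ⟨h3, h4, h5, h6, h7, h8, h9⟩ =>
        ⟨h3, h4, h5, h6, h7, fun c hc hc' => hlo.2 c (by omega) hc', h9⟩⟩
    · rw [Function.update_of_ne hv]
      exact h.tableX v (by omega) h2 k hk
  · exact h.tableX v (by omega) h2 k hk

/-- Separates the contribution of the source column itself, so that the rest depends only on the
columns already scanned; this is the shape of `kt_le`. -/
theorem bottomAlive_iff {j : ℕ} :
    BottomAlive f g a b j ↔ ∀ c, j + 1 ≤ c → c < b → (∀ r < a, g c < f r) ∨
      RowMeets f a (g j) (g c) ∨ ∃ s, j + 1 ≤ s ∧ s < c ∧ RowMeets f a (g s) (g c) := by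
  constructor
  · intro h c h1 h2
    rcases h c h1 h2 with h3 | ⟨s, h4, h5, h6⟩
    · exact .inl h3
    · right
      by_cases hs : s = j
      · subst hs; exact .inl h6
      · exact .inr ⟨s, by omega, h5, h6⟩
  · intro h c h1 h2
    rcases h c h1 h2 with h3 | h3 | ⟨s, h4, h5, h6⟩
    · exact .inl h3
    · exact .inr ⟨j, le_rfl, h1, h3⟩
    · exact .inr ⟨s, by omega, h5, h6⟩

/-- Here `kt` is the least height, at least `f 0`, with which a source just before the scanned
columns stays alive through them. If `g j` reaches `kt`, column `j` protects itself and every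
earlier source, and the requirement drops to `f 0`. Otherwise column `j` may only add the demand `PF
(g j)`, namely when it is neither blocked completely nor at least `f 0`. In `XB` only the key `lo'`
changes. A source in column `j` counts for keys up to the suffix minimum `lo'`, which is the least
key in use, and its suffix, being the longest, has the largest maximum `hi'`. -/
theorem BackScan.step [DecidablePred SB] {j : ℕ} {lo hi kt : ℤ} {SM XB : ℤ → ℤ}
    (h : BackScan f g a b SB (j + 1) lo hi kt SM XB) (hj : j < b) (hg : SlowOn g b)
    {flo : ℤ} {PF : ℤ → ℤ} {fhi : ℤ} (hF : RowScan f a flo fhi PF) (ha : 0 < a)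
    {lo' hi' kt' : ℤ} {SM' XB₁ XB' : ℤ → ℤ}
    (hlo' : lo' = min lo (g j)) (hhi' : hi' = max hi (g j))
    (hXB₁ : XB₁ = if g j < lo then Function.update XB (g j) (XB lo) else XB)
    (hSM' : SM' = if hi < g j then Function.update SM (g j) lo' else SM)
    (hXB' : XB' = if kt ≤ g j ∧ SB j then Function.update XB₁ lo' hi' else XB₁)
    (hkt' : kt' = if kt ≤ g j then f 0 else if flo ≤ g j ∧ g j < f 0 then max kt (PF (g j)) else kt) :
    BackScan f g a b SB j lo' hi' kt' SM' XB' := by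
  have hslow : lo ≤ g j + 1 ∧ g j ≤ hi + 1 := by
    by_cases hjb : j + 1 < b
    · have h1 := ((h.le_lo lo).1 le_rfl).2 (j + 1) le_rfl hjb
      have h2 := (h.le_hi (g (j + 1))).2 (.inr ⟨j + 1, le_rfl, hjb, le_rfl⟩)
      have := hg j hjb
      omega
    · obtain rfl : j = b - 1 := by omega
      have h1 := ((h.le_lo lo).1 le_rfl).1
      have h2 := (h.le_hi (g (b - 1))).2 (.inl le_rfl)
      omega
  have hle_lo : ∀ v, v ≤ lo' ↔ v ≤ g (b - 1) ∧ ∀ c, j ≤ c → c < b → v ≤ g c := by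
    intro v
    rw [hlo', le_min_iff, h.le_lo]
    refine ⟨fun ⟨⟨h1, h2⟩, h3⟩ => ⟨h1, fun c hc hc' => ?_⟩,
      fun ⟨h1, h2⟩ => ⟨⟨h1, fun c hc => h2 c (by omega)⟩, h2 j le_rfl hj⟩⟩
    by_cases hcj : c = j
    · subst hcj; exact h3
    · exact h2 c (by omega) hc'
  have hle_hi : ∀ w, w ≤ hi' ↔ w ≤ g (b - 1) ∨ ∃ c, j ≤ c ∧ c < b ∧ w ≤ g c := by
    intro w
    rw [hhi', le_max_iff, h.le_hi]
    constructor
    · rintro ((h1 | ⟨c, h1, h2, h3⟩) | h1)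
      · exact .inl h1
      · exact .inr ⟨c, by omega, h2, h3⟩
      · exact .inr ⟨j, le_rfl, hj, h1⟩
    · rintro (h1 | ⟨c, h1, h2, h3⟩)
      · exact .inl (.inl h1)
      · by_cases hcj : c = j
        · subst hcj; exact .inr h3
        · exact .inl (.inr ⟨c, by omega, h2, h3⟩)
  have hlast : g (b - 1) ≤ hi := (h.le_hi _).2 (.inl le_rfl)
  refine ⟨hle_lo, hle_hi, ?_, ?_, ?_, ?_⟩
  · intro w h1 h2 u
    by_cases hwhi : w ≤ hi
    · have hw : SM' w = SM w := by
        rw [hSM']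
        split_ifs with hlt
        · exact Function.update_of_ne (by omega) _ _
        · rfl
      rw [hw, h.tableS w h1 hwhi u]
      constructor
      · rintro ⟨c, h3, h4⟩; exact ⟨c, by omega, h4⟩
      · rintro ⟨c, h3, h4, h5, h6⟩
        -- Since `w ≤ hi`, a later column also reaches `w`, and its shorter suffix inherits the
        -- bound.
        by_cases hcj : c = j
        · subst hcj
          rcases (h.le_hi w).1 hwhi with h7 | ⟨c', h7, h8, h9⟩
          · omega
          · exact ⟨c', h7, h8, h9, fun d hd hd' => h6 d (by omega) hd'⟩
        · exact ⟨c, by omega, h4, h5, h6⟩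
    · have hwj : w = g j ∧ hi < g j := by omega
      obtain ⟨rfl, hlt⟩ := hwj
      rw [hSM', if_pos hlt, Function.update_self, hle_lo]
      constructor
      · rintro ⟨h3, h4⟩
        exact ⟨j, le_rfl, hj, le_rfl, h4⟩
      · rintro ⟨c, h3, h4, h5, h6⟩
        have hcj : c = j := by
          by_contra hne
          exact hwhi ((h.le_hi _).2 (.inr ⟨c, by omega, h4, h5⟩))
        subst hcj
        exact ⟨h6 _ (by omega) (by omega), h6⟩
  · intro v h1 h2 k hk
    have hold := h.step_lo hslow.1 v (hlo' ▸ h1) h2 k hk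
    rw [← hXB₁] at hold
    have hsplit : (∃ j', j ≤ j' ∧ j' < b ∧ SB j' ∧ f 0 ≤ g j' ∧ BottomAlive f g a b j' ∧
        (∀ c, j' ≤ c → c < b → v ≤ g c) ∧ ∃ c, j' ≤ c ∧ c < b ∧ k ≤ g c) ↔
        (SB j ∧ kt ≤ g j ∧ v ≤ lo' ∧ k ≤ hi') ∨ k ≤ XB₁ v := by
      have hkt : f 0 ≤ g j → (BottomAlive f g a b j ↔ kt ≤ g j) := fun h0 => by
        rw [bottomAlive_iff, h.kt_le _ h0]
      have hkt0 := h.le_kt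
      rw [hold]
      constructor
      · rintro ⟨j', h3, h4, h5, h6, h7, h8, c, h9, h10, h11⟩
        by_cases hjj : j' = j
        · subst hjj
          exact .inl ⟨h5, (hkt h6).1 h7, (hle_lo v).2 ⟨h2, h8⟩, (hle_hi k).2 (.inr ⟨c, h9, h10, h11⟩)⟩
        · exact .inr ⟨j', by omega, h4, h5, h6, h7, h8, c, h9, h10, h11⟩
      · rintro (⟨h3, h4, h5, h6⟩ | ⟨j', h3, h4⟩)
        · have h7 : ∃ c, j ≤ c ∧ c < b ∧ k ≤ g c := by
            rcases (hle_hi k).1 h6 with h7 | h7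
            · exact ⟨b - 1, by omega, by omega, h7⟩
            · exact h7
          exact ⟨j, le_rfl, hj, h3, by omega, (hkt (by omega)).2 h4, ((hle_lo v).1 h5).2, h7⟩
        · exact ⟨j', by omega, h4⟩
    rw [hsplit, hXB']
    split_ifs with hc
    · by_cases hv : v = lo'
      · subst hv
        rw [Function.update_self]
        refine ⟨fun h3 => .inl ⟨hc.2, hc.1, le_rfl, h3⟩, ?_⟩
        rintro (h3 | h3)
        · exact h3.2.2.2
        · obtain ⟨j', h4, h5, -, -, -, -, c, h6, h7, h8⟩ := hold.1 h3
          exact (hle_hi k).2 (.inr ⟨c, by omega, h7, h8⟩)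
      · rw [Function.update_of_ne hv]
        exact ⟨.inr, fun h3 => h3.elim (fun h4 => by omega) id⟩
    · exact ⟨.inr, fun h3 => h3.elim (fun h4 => absurd ⟨h4.2.1, h4.1⟩ hc) id⟩
  · rw [hkt']
    have := h.le_kt
    split_ifs
    · exact le_rfl
    · exact this.trans (le_max_left _ _)
    · exact this
  · intro k hk
    have hR : ∀ {u w : ℤ}, f 0 ≤ u → f 0 ≤ w → RowMeets f a u w := fun h1 h2 =>
      ⟨0, ha, h2, fun r hr => by obtain rfl : r = 0 := by omega
                                 exact h1⟩
    have hRmono : ∀ {u u' w : ℤ}, u ≤ u' → RowMeets f a u w → RowMeets f a u' w :=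
      fun h1 ⟨r, h2, h3, h4⟩ => ⟨r, h2, h3, fun s hs => (h4 s hs).trans h1⟩
    -- For the later columns, a source of height `k` together with column `j` acts like a single
    -- column of height `max k (g j)`.
    have hsplit : (∀ c, j ≤ c → c < b → (∀ r < a, g c < f r) ∨
        RowMeets f a k (g c) ∨ ∃ s, j ≤ s ∧ s < c ∧ RowMeets f a (g s) (g c)) ↔
        ((∀ r < a, g j < f r) ∨ RowMeets f a k (g j)) ∧ kt ≤ max k (g j) := by
      rw [h.kt_le _ (hk.trans (le_max_left _ _))]
      have hmax : ∀ w, RowMeets f a (max k (g j)) w ↔ RowMeets f a k w ∨ RowMeets f a (g j) w := by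
        intro w
        constructor
        · intro h1
          rcases le_total k (g j) with h2 | h2
          · rw [max_eq_right h2] at h1; exact .inr h1
          · rw [max_eq_left h2] at h1; exact .inl h1
        · rintro (h1 | h1)
          · exact hRmono (le_max_left _ _) h1
          · exact hRmono (le_max_right _ _) h1
      constructor
      · intro h1
        refine ⟨?_, fun c h2 h3 => ?_⟩
        · rcases h1 j le_rfl hj with h2 | h2 | ⟨s, h2, h3, h4⟩
          · exact .inl h2
          · exact .inr h2
          · omega
        · rw [hmax]
          rcases h1 c (by omega) h3 with h4 | h4 | ⟨s, h4, h5, h6⟩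
          · exact .inl h4
          · exact .inr (.inl (.inl h4))
          · by_cases hs : s = j
            · subst hs; exact .inr (.inl (.inr h6))
            · exact .inr (.inr ⟨s, by omega, h5, h6⟩)
      · rintro ⟨h1, h2⟩ c h3 h4
        by_cases hcj : c = j
        · subst hcj
          exact h1.imp id .inl
        · rcases h2 c (by omega) h4 with h5 | h5 | ⟨s, h5, h6, h7⟩
          · exact .inl h5
          · rcases (hmax _).1 h5 with h6 | h6
            · exact .inr (.inl h6)
            · exact .inr (.inr ⟨j, le_rfl, by omega, h6⟩)
          · exact .inr (.inr ⟨s, by omega, h6, h7⟩)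
    rw [hsplit, hkt']
    have hkt0 := h.le_kt
    split_ifs with h1 h2
    · exact ⟨fun _ => ⟨.inr (hR hk (hkt0.trans h1)), h1.trans (le_max_right _ _)⟩, fun _ => hk⟩
    · rw [max_le_iff, hF.table _ h2.1 h2.2]
      have hnb : ¬ ∀ r < a, g j < f r := by
        obtain ⟨r, hr, hr'⟩ := (hF.lo_le _).1 h2.1
        intro h3
        have := h3 r hr
        omega
      constructor
      · rintro ⟨h3, h4⟩
        exact ⟨.inr h4, h3.trans (le_max_left _ _)⟩
      · rintro ⟨h3, h4⟩
        exact ⟨by rcases le_max_iff.1 h4 with h5 | h5 <;> omega, h3.resolve_left hnb⟩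
    · constructor
      · intro h3
        refine ⟨?_, h3.trans (le_max_left _ _)⟩
        by_cases h0 : f 0 ≤ g j
        · exact .inr (hR hk h0)
        · left
          intro r hr
          by_contra hc
          exact h2 ⟨(hF.lo_le _).2 ⟨r, hr, by omega⟩, by omega⟩
      · rintro ⟨-, h4⟩
        rcases le_max_iff.1 h4 with h5 | h5
        · exact h5
        · exact absurd h5 h1

/-- The state of the output scan after `i` rows. -/
structure OutScan (f g : ℕ → ℤ) (b : ℕ) (SL : ℕ → Prop) (i : ℕ) (mu ka top bot : ℤ) : Prop where
  mu_le : ∀ v, v ≤ g 0 → (mu ≤ v ↔ ∃ i' < i, SL i' ∧ f i' ≤ g 0 ∧ LeftAlive f g b i' (i - 1) ∧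
    ∃ r, i' ≤ r ∧ r < i ∧ f r ≤ v)
  ka_le : ka ≤ g (b - 1)
  le_ka : ∀ v, v ≤ g (b - 1) → (v ≤ ka ↔ BackOpen f g b i v)
  top_le : ∀ h, top ≤ h ↔ f 0 ≤ h ∧ ∀ r < i, f r ≤ h
  le_bot : ∀ v, v ≤ bot ↔ v ≤ f 0 ∧ ∀ r < i, v ≤ f r

/-- The value `g 0 + 1` means that no left source is alive: `mu` is only compared with heights `v ≤
g 0`. -/
theorem OutScan.init (SL : ℕ → Prop) : OutScan f g b SL 0 (g 0 + 1) (g (b - 1)) (f 0) (f 0) where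
  mu_le v hv := ⟨fun _ => by omega, fun ⟨i', h, _⟩ => by omega⟩
  ka_le := le_rfl
  le_ka v hv := ⟨fun _ r hr => by omega, fun _ => hv⟩
  top_le h := by simp
  le_bot v := by simp

/-- `mu` is the least value of `f` above a left source that is still alive. Such a source survives
row `i` exactly if the minimum of `f` since the source is at most `pm`, the minimum of the columns
up to the first of height `f i`. So the best source survives or none does, and one number suffices.
`ka` is the largest height up to `g (b - 1)` not cut off by a hook at the end. A blocked row makes
everything below it irrelevant, so `ka` is reset. The same holds for a row with `f i ≤ ka`, which
protects all rows below it and is free in the last column. -/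
theorem OutScan.step [DecidablePred SL] {i : ℕ} {mu ka top bot : ℤ} (h : OutScan f g b SL i mu ka top bot)
    (hb : 0 < b) {glo ghi : ℤ} {PM SM : ℤ → ℤ} (hG : ColScan g b glo ghi PM)
    (hSM : ∀ w, g (b - 1) < w → w ≤ ghi → ∀ u, u ≤ SM w ↔ SuffixMeets g b u w)
    {mu₁ mu' ka' : ℤ}
    (hmu₁ : mu₁ = if ghi < f i then g 0 + 1 else
      if mu ≤ (if f i ≤ g 0 then g 0 else PM (f i)) then min mu (f i) else g 0 + 1)
    (hmu' : mu' = if SL i ∧ f i ≤ g 0 then min mu₁ (f i) else mu₁)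
    (hka' : ka' = if ghi < f i then g (b - 1) else if f i ≤ ka then g (b - 1) else
      min ka (if f i ≤ g (b - 1) then g (b - 1) else SM (f i))) :
    OutScan f g b SL (i + 1) mu' ka' (max top (f i)) (min bot (f i)) := by
  have h0hi : g 0 ≤ ghi := (hG.le_hi _).2 ⟨0, hb, le_rfl⟩
  have hJhi : g (b - 1) ≤ ghi := (hG.le_hi _).2 ⟨b - 1, by omega, le_rfl⟩
  have hPM : f i ≤ ghi → ∀ u, u ≤ g 0 →
      (u ≤ (if f i ≤ g 0 then g 0 else PM (f i)) ↔ PrefixMeets g b u (f i)) := by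
    intro h1 u hu
    split_ifs with h2
    · refine ⟨fun _ => ⟨0, hb, h2, fun c hc => ?_⟩, fun _ => hu⟩
      obtain rfl : c = 0 := by omega
      exact hu
    · exact hG.table _ (by omega) h1 u
  have hpm0 : f i ≤ ghi → (if f i ≤ g 0 then g 0 else PM (f i)) ≤ g 0 := by
    intro h1
    split_ifs with h2
    · exact le_rfl
    · obtain ⟨c, h3, h4, h5⟩ := (hG.table _ (by omega) h1 _).1 le_rfl
      exact h5 0 (by omega)
  refine ⟨fun v hv => ?_, ?_, fun v hv => ?_, fun k => ?_, fun v => ?_⟩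
  · -- sources strictly below row `i`
    have hold : (∃ i' < i, SL i' ∧ f i' ≤ g 0 ∧ LeftAlive f g b i' i ∧
        ∃ r, i' ≤ r ∧ r < i + 1 ∧ f r ≤ v) ↔ mu₁ ≤ v := by
      have halive : ∀ i' < i, LeftAlive f g b i' i ↔ LeftAlive f g b i' (i - 1) ∧
          ∃ s, i' ≤ s ∧ s < i ∧ PrefixMeets g b (f s) (f i) := by
        intro i' hi'
        constructor
        · intro h1
          exact ⟨fun r hr hr' => h1 r hr (by omega), h1 i hi' le_rfl⟩
        · rintro ⟨h1, h2⟩ r hr hr'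
          by_cases hri : r = i
          · subst hri; exact h2
          · exact h1 r hr (by omega)
      rw [hmu₁]
      set pm := (if f i ≤ g 0 then g 0 else PM (f i)) with hpm
      split_ifs with h1 h2
      · refine ⟨fun ⟨i', h2, h3, h4, h5, _⟩ => ?_, fun h2 => by omega⟩
        obtain ⟨s, -, -, c, h6, h7, -⟩ := ((halive i' h2).1 h5).2
        have := (hG.le_hi (f i)).2 ⟨c, h6, h7⟩
        omega
      · have hpm0' := hpm0 (by omega)
        have hPM' := hPM (by omega)
        constructor
        · rintro ⟨i', h3, h4, h5, h6, r, h7, h8, h9⟩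
          rw [min_le_iff]
          by_cases hr : r = i
          · subst hr; exact .inr h9
          · exact .inl ((h.mu_le v hv).2 ⟨i', h3, h4, h5, ((halive i' h3).1 h6).1, r, h7, by omega, h9⟩)
        · intro h3
          -- a source realizing the minimum
          have hmu : ∀ x, mu ≤ x → x ≤ pm → ∃ i' < i, SL i' ∧ f i' ≤ g 0 ∧ LeftAlive f g b i' i ∧
              ∃ r, i' ≤ r ∧ r < i ∧ f r ≤ x := by
            intro x hx hx'
            obtain ⟨i', h4, h5, h6, h7, r, h8, h9, h10⟩ := (h.mu_le x (by omega)).1 hx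
            exact ⟨i', h4, h5, h6, (halive i' h4).2 ⟨h7, r, h8, h9,
              (hPM' _ (by omega)).1 (by omega)⟩, r, h8, h9, h10⟩
          rcases min_le_iff.1 h3 with h4 | h4
          -- Asking at `min v pm` gives one source that both survives row `i` and has its minimum at
          -- most `v`.
          · obtain ⟨i', h5, h6, h7, h8, r, h9, h10, h11⟩ := hmu (min v pm) (by omega) (by omega)
            exact ⟨i', h5, h6, h7, h8, r, h9, by omega, by omega⟩
          · obtain ⟨i', h5, h6, h7, h8, r, h9, h10, h11⟩ := hmu pm h2 le_rfl
            exact ⟨i', h5, h6, h7, h8, i, by omega, by omega, h4⟩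
      · have hpm0' := hpm0 (by omega)
        have hPM' := hPM (by omega)
        refine ⟨fun ⟨i', h3, h4, h5, h6, _⟩ => ?_, fun h2 => by omega⟩
        obtain ⟨h7, s, h8, h9, h10⟩ := (halive i' h3).1 h6
        have hs0 : f s ≤ g 0 := by
          obtain ⟨c, -, -, h11⟩ := h10
          exact h11 0 (by omega)
        have h11 := (hPM' _ hs0).2 h10
        have := (h.mu_le (f s) hs0).2 ⟨i', h3, h4, h5, h7, s, h8, h9, le_rfl⟩
        omega
    have hnew : (∃ i' < i + 1, SL i' ∧ f i' ≤ g 0 ∧ LeftAlive f g b i' (i + 1 - 1) ∧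
        ∃ r, i' ≤ r ∧ r < i + 1 ∧ f r ≤ v) ↔ mu₁ ≤ v ∨ (SL i ∧ f i ≤ g 0 ∧ f i ≤ v) := by
      rw [← hold, Nat.add_sub_cancel]
      constructor
      · rintro ⟨i', h1, h2, h3, h4, r, h5, h6, h7⟩
        by_cases hi : i' = i
        · subst hi
          obtain rfl : r = i' := by omega
          exact .inr ⟨h2, h3, h7⟩
        · exact .inl ⟨i', by omega, h2, h3, h4, r, h5, h6, h7⟩
      · rintro (⟨i', h1, h2⟩ | ⟨h1, h2, h3⟩)
        · exact ⟨i', by omega, h2⟩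
        · exact ⟨i, by omega, h1, h2, fun r hr hr' => by omega, i, le_rfl, by omega, h3⟩
    rw [hnew, hmu']
    split_ifs with h1
    · rw [min_le_iff]
      simp only [h1.1, h1.2, true_and]
    · exact ⟨.inl, fun h2 => h2.elim id fun h3 => absurd ⟨h3.1, h3.2.1⟩ h1⟩
  · rw [hka']
    have := h.ka_le
    split_ifs <;> omega
  · have hSM' : f i ≤ ghi → (v ≤ (if f i ≤ g (b - 1) then g (b - 1) else SM (f i)) ↔
        SuffixMeets g b v (f i)) := by
      intro h1
      split_ifs with h2
      · refine ⟨fun _ => ⟨b - 1, by omega, h2, fun c hc hc' => ?_⟩, fun _ => hv⟩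
        obtain rfl : c = b - 1 := by omega
        exact hv
      · exact hSM _ (by omega) h1 v
    -- A witness of height `v` or `f i` amounts to one of height `min v (f i)`, so the old `ka` can
    -- be compared with this minimum.
    have hmin : ∀ w, SuffixMeets g b (min v (f i)) w ↔
        SuffixMeets g b v w ∨ SuffixMeets g b (f i) w := by
      intro w
      constructor
      · intro h1
        rcases le_total v (f i) with h2 | h2
        · rw [min_eq_left h2] at h1; exact .inl h1
        · rw [min_eq_right h2] at h1; exact .inr h1
      · rintro (h1 | h1)
        · exact h1.mono (min_le_left _ _)
        · exact h1.mono (min_le_right _ _)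
    have hblk : (∀ c < b, g c < f i) ↔ ghi < f i := by
      constructor
      · intro h1
        by_contra hc
        obtain ⟨c, h2, h3⟩ := (hG.le_hi (f i)).1 (by omega)
        have := h1 c h2
        omega
      · intro h1 c hc
        by_contra hcon
        have := (hG.le_hi (f i)).2 ⟨c, hc, by omega⟩
        omega
    have hrec : BackOpen f g b (i + 1) v ↔
        ghi < f i ∨ (SuffixMeets g b v (f i) ∧ min v (f i) ≤ ka) := by
      rw [h.le_ka _ (by omega)]
      constructor
      · intro h1
        by_cases hg : ghi < f i
        · exact .inl hg
        · refine .inr ⟨?_, fun r hr => ?_⟩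
          · rcases h1 i (by omega) with ⟨s, h2, h3, h4⟩ | h2 | ⟨s, h2, h3, h4⟩
            · obtain rfl : s = i := by omega
              exact absurd (hblk.1 h4) hg
            · exact h2
            · omega
          · rw [hmin]
            rcases h1 r (by omega) with ⟨s, h2, h3, h4⟩ | h2 | ⟨s, h2, h3, h4⟩
            · by_cases hs : s = i
              · subst hs; exact absurd (hblk.1 h4) hg
              · exact .inl ⟨s, h2, by omega, h4⟩
            · exact .inr (.inl (.inl h2))
            · by_cases hs : s = i
              · subst hs; exact .inr (.inl (.inr h4))
              · exact .inr (.inr ⟨s, h2, by omega, h4⟩)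
      · rintro (h1 | ⟨h1, h2⟩) r hr
        · exact .inl ⟨i, by omega, by omega, hblk.2 h1⟩
        · by_cases hri : r = i
          · subst hri; exact .inr (.inl h1)
          · rcases h2 r (by omega) with ⟨s, h3, h4, h5⟩ | h3 | ⟨s, h3, h4, h5⟩
            · exact .inl ⟨s, h3, by omega, h5⟩
            · rcases (hmin _).1 h3 with h4 | h4
              · exact .inr (.inl h4)
              · exact .inr (.inr ⟨i, by omega, by omega, h4⟩)
            · exact .inr (.inr ⟨s, h3, by omega, h5⟩)
    rw [hrec, hka']
    have hka := h.ka_le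
    split_ifs with h1 h2 h3
    · exact ⟨fun _ => .inl h1, fun _ => hv⟩
    · refine ⟨fun _ => .inr ⟨?_, by omega⟩, fun _ => hv⟩
      rw [← hSM' (by omega), if_pos (by omega)]
      exact hv
    · rw [le_min_iff, ← hSM' (by omega), if_pos h3]
      constructor
      · rintro ⟨h4, h5⟩; exact .inr ⟨h5, by omega⟩
      · rintro (h4 | ⟨h4, h5⟩)
        · omega
        · exact ⟨by omega, h4⟩
    · rw [le_min_iff, ← hSM' (by omega), if_neg h3]
      constructor
      · rintro ⟨h4, h5⟩; exact .inr ⟨h5, by omega⟩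
      · rintro (h4 | ⟨h4, h5⟩)
        · omega
        · exact ⟨by omega, h4⟩
  · rw [max_le_iff, h.top_le]
    exact ⟨fun ⟨⟨h1, h2⟩, h3⟩ => ⟨h1, fun r hr => (Nat.lt_succ_iff_lt_or_eq.1 hr).elim (h2 r)
      fun e => e ▸ h3⟩, fun ⟨h1, h2⟩ => ⟨⟨h1, fun r hr => h2 r (by omega)⟩, h2 i (by omega)⟩⟩
  · rw [le_min_iff, h.le_bot]
    exact ⟨fun ⟨⟨h1, h2⟩, h3⟩ => ⟨h1, fun r hr => (Nat.lt_succ_iff_lt_or_eq.1 hr).elim (h2 r)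
      fun e => e ▸ h3⟩, fun ⟨h1, h2⟩ => ⟨⟨h1, fun r hr => h2 r (by omega)⟩, h2 i (by omega)⟩⟩

/-- A cell `(i, b - 1)` of the last column is reachable from a source in the first column or in the
first row. -/
def RightReached (f g : ℕ → ℤ) (b : ℕ) (SL SB : ℕ → Prop) (i : ℕ) : Prop :=
  (∃ i' ≤ i, SL i' ∧ Conn (fun x y => f x ≤ g y) i' 0 i (b - 1)) ∨
    ∃ j < b, SB j ∧ Conn (fun x y => f x ≤ g y) 0 j i (b - 1)

/-- The output of the solver, from the states of the scans. -/
theorem rightReached_iff {i : ℕ} {mu ka top bot mu' top' bot' ka' glo ghi lo kt up : ℤ}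
    {PM SM XB : ℤ → ℤ} (hi : i < a) (hb : 0 < b)
    (h : OutScan f g b SL i mu ka top bot) (h' : OutScan f g b SL (i + 1) mu' ka' top' bot')
    (hG : ColScan g b glo ghi PM) (hB : BackScan f g a b SB 0 lo up kt SM XB) :
    RightReached f g b SL SB i ↔
      f i ≤ ghi ∧ f i ≤ ka ∧ (mu' ≤ glo ∨ top' ≤ XB (max bot' glo)) := by
  have hJhi : g (b - 1) ≤ ghi := (hG.le_hi _).2 ⟨b - 1, by omega, le_rfl⟩
  have hJlo : glo ≤ g (b - 1) := (hG.le_lo _).1 le_rfl _ (by omega)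
  have h0lo : glo ≤ g 0 := (hG.le_lo _).1 le_rfl _ hb
  have hka := h.ka_le
  -- The condition on the target alone, common to both kinds of sources.
  have hfin : (f i ≤ g (b - 1) ∧ BackOpen f g b i (f i)) ↔ f i ≤ ka := by
    constructor
    · rintro ⟨h1, h2⟩; exact (h.le_ka _ h1).2 h2
    · intro h1; exact ⟨by omega, (h.le_ka _ (by omega)).1 h1⟩
  have hleft : (∃ i' ≤ i, SL i' ∧ Conn (fun x y => f x ≤ g y) i' 0 i (b - 1)) ↔
      f i ≤ ka ∧ mu' ≤ glo := by
    rw [h'.mu_le _ h0lo, ← hfin]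
    constructor
    · rintro ⟨i', h1, h2, h3⟩
      obtain ⟨h4, h5, h6, h7, r, h8, h9, h10⟩ := (conn_left_iff h1 hb).1 h3
      exact ⟨⟨h4, h5⟩, i', by omega, h2, h6, h7, r, h8, by omega, (hG.le_lo _).2 h10⟩
    · rintro ⟨⟨h4, h5⟩, i', h1, h2, h6, h7, r, h8, h9, h10⟩
      exact ⟨i', by omega, h2, (conn_left_iff (by omega) hb).2
        ⟨h4, h5, h6, h7, r, h8, by omega, (hG.le_lo _).1 h10⟩⟩
  have hbotle : bot' ≤ f i := ((h'.le_bot _).1 le_rfl).2 i (by omega)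
  have hbotmem : ∃ r ≤ i, f r ≤ bot' := by
    by_contra hc
    push Not at hc
    have := (h'.le_bot (bot' + 1)).2 ⟨hc 0 (by omega), fun r hr => hc r (by omega)⟩
    omega
  have hlo : lo = glo := by
    apply le_antisymm
    · exact (hG.le_lo _).2 fun c hc => ((hB.le_lo _).1 le_rfl).2 c (by omega) hc
    · exact (hB.le_lo _).2 ⟨hJlo, fun c _ hc => (hG.le_lo _).1 le_rfl c hc⟩
  -- The keys of `XB` start at the overall minimum `glo` of the columns. No column is lower, so the
  -- key `max bot' glo` imposes the same condition as `bot'`. It is at most `g (b - 1)` because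
  -- `bot' ≤ f i ≤ ka`.
  have hbottom : (∃ j < b, SB j ∧ Conn (fun x y => f x ≤ g y) 0 j i (b - 1)) ↔
      f i ≤ ka ∧ top' ≤ XB (max bot' glo) := by
    constructor
    · rintro ⟨j, h1, h2, h3⟩
      obtain ⟨h4, h5, h6, h7, ⟨r, h8, h9⟩, c, h10, h11, h12⟩ := (conn_bottom_iff hi h1).1 h3
      refine ⟨hfin.1 ⟨h4, h5⟩, ?_⟩
      have htop0 := ((h'.top_le _).1 le_rfl).1
      rw [hB.tableX _ (by omega) (by omega) _ htop0]
      refine ⟨j, by omega, h1, h2, h6, h7, fun d hd hd' => ?_, c, h10, h11,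
        (h'.top_le _).2 ⟨h12 0 (by omega), fun s hs => h12 s (by omega)⟩⟩
      have h13 := h9 d hd hd'
      have h14 := ((h'.le_bot _).1 le_rfl).2 r (by omega)
      have h15 := (hG.le_lo _).1 le_rfl d hd'
      omega
    · rintro ⟨h1, h2⟩
      have htop0 := ((h'.top_le _).1 le_rfl).1
      rw [hB.tableX _ (by omega) (by omega) _ htop0] at h2
      obtain ⟨j, -, h3, h4, h5, h6, h7, c, h8, h9, h10⟩ := h2
      obtain ⟨h11, h12⟩ := hfin.2 h1
      obtain ⟨r, h13, h14⟩ := hbotmem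
      exact ⟨j, h3, h4, (conn_bottom_iff hi h3).2 ⟨h11, h12, h5, h6,
        ⟨r, h13, fun d hd hd' => by have := h7 d hd hd'; omega⟩, c, h8, h9,
        fun s hs => (((h'.top_le _).1 le_rfl).2 s (by omega)).trans h10⟩⟩
  rw [RightReached, hleft, hbottom]
  constructor
  · rintro (⟨h1, h2⟩ | ⟨h1, h2⟩)
    · exact ⟨by omega, h1, .inl h2⟩
    · exact ⟨by omega, h1, .inr h2⟩
  · rintro ⟨-, h1, h2 | h2⟩
    · exact .inl ⟨h1, h2⟩
    · exact .inr ⟨h1, h2⟩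

end Scans

/-! ## Notation for programs -/

instance (n : ℕ) : OfNat RExpr n := ⟨.const n⟩
instance : Add RExpr := ⟨.add⟩
instance : Sub RExpr := ⟨.sub⟩
instance : Mul RExpr := ⟨.mul⟩
instance : Div RExpr := ⟨.div⟩

infixr:60 " ⨟ " => Program.seq
infix:62 " ⟵ " => Program.assign

/-- The test `e < f`. -/
def Test.lt (e f : RExpr) : Test := .not (.le f e)

/-- The test `b` or `c`. -/
def Test.or (b c : Test) : Test := .not (.and (.not b) (.not c))

/-- Replace the variable `x` by the maximum of it and `e`. -/
def setMax (x : ℕ) (e : RExpr) : Program := .cond (.le (.var x) e) (x ⟵ e) .skip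

/-- Replace the variable `x` by the minimum of it and `e`. -/
def setMin (x : ℕ) (e : RExpr) : Program := .cond (.le e (.var x)) (x ⟵ e) .skip

section Simp

variable (s : State) (e f : RExpr) (Δ : ℝ) (V : ℤ) (Q : State → Prop) (x : ℕ)

@[simp] theorem RExpr.eval_two : (2 : RExpr).eval s = 2 := rfl
@[simp] theorem RExpr.eval_three : (3 : RExpr).eval s = 3 := rfl
@[simp] theorem RExpr.eval_zero : (0 : RExpr).eval s = 0 := rfl
@[simp] theorem RExpr.eval_one : (1 : RExpr).eval s = 1 := rfl
@[simp] theorem RExpr.eval_add : (e + f).eval s = e.eval s + f.eval s := rfl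
@[simp] theorem RExpr.eval_sub : (e - f).eval s = e.eval s - f.eval s := rfl
@[simp] theorem RExpr.eval_mul : (e * f).eval s = e.eval s * f.eval s := rfl
@[simp] theorem RExpr.eval_div : (e / f).eval s = e.eval s / f.eval s := rfl
@[simp] theorem RExpr.eval_var (x : ℕ) : (RExpr.var x).eval s = s.var x := rfl
@[simp] theorem RExpr.eval_read (a : ℕ) : (RExpr.read a e).eval s = s.arr a (e.eval s) := rfl

@[simp] theorem Test.holds_le : (Test.le e f).Holds Δ s ↔ e.eval s ≤ f.eval s := Iff.rfl
@[simp] theorem Test.holds_eq : (Test.eq e f).Holds Δ s ↔ e.eval s = f.eval s := Iff.rfl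
@[simp] theorem Test.holds_leThreshold : (Test.leThreshold e).Holds Δ s ↔ (e.eval s : ℝ) ≤ Δ :=
  Iff.rfl
@[simp] theorem Test.holds_not (b : Test) : (Test.not b).Holds Δ s ↔ ¬ b.Holds Δ s := Iff.rfl
@[simp] theorem Test.holds_and (b c : Test) :
    (Test.and b c).Holds Δ s ↔ b.Holds Δ s ∧ c.Holds Δ s := Iff.rfl
@[simp] theorem Test.holds_lt : (Test.lt e f).Holds Δ s ↔ e.eval s < f.eval s := not_le
@[simp] theorem Test.holds_or (b c : Test) :
    (Test.or b c).Holds Δ s ↔ b.Holds Δ s ∨ c.Holds Δ s := by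
  simp only [Test.or, Test.Holds]
  tauto

open Program

@[simp] theorem wp_skip : wp Δ V .skip Q s = Q s := rfl
@[simp] theorem wp_assign : wp Δ V (x ⟵ e) Q s =
    ((-V ≤ e.eval s ∧ e.eval s ≤ V) ∧ Q (s.setVar x (e.eval s))) := rfl
@[simp] theorem wp_write (a : ℕ) : wp Δ V (.write a f e) Q s =
    ((-V ≤ e.eval s ∧ e.eval s ≤ V) ∧ Q (s.setArr a (f.eval s) (e.eval s))) := rfl
@[simp] theorem wp_seq (p q : Program) : wp Δ V (p ⨟ q) Q s = wp Δ V p (wp Δ V q Q) s := rfl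
@[simp] theorem wp_cond (b : Test) (p q : Program) : wp Δ V (.cond b p q) Q s =
    ((b.Holds Δ s → wp Δ V p Q s) ∧ (¬ b.Holds Δ s → wp Δ V q Q s)) := rfl

theorem State.setVar_self : s.setVar x (s.var x) = s := by
  simp [State.setVar]

@[simp] theorem wp_setMax : wp Δ V (setMax x e) Q s ↔
    (s.var x ≤ e.eval s → -V ≤ e.eval s ∧ e.eval s ≤ V) ∧
      Q (s.setVar x (max (s.var x) (e.eval s))) := by
  by_cases h : s.var x ≤ e.eval s
  · simp [setMax, h]
  · simp [setMax, h, max_eq_left (not_le.1 h).le, State.setVar_self]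

@[simp] theorem wp_setMin : wp Δ V (setMin x e) Q s ↔
    (e.eval s ≤ s.var x → -V ≤ e.eval s ∧ e.eval s ≤ V) ∧
      Q (s.setVar x (min (s.var x) (e.eval s))) := by
  by_cases h : e.eval s ≤ s.var x
  · simp [setMin, h]
  · simp [setMin, h, min_eq_left (not_le.1 h).le, State.setVar_self]

@[simp] theorem State.setArr_arr_apply (a b : ℕ) (i k : ℤ) :
    (s.setArr a i k).arr b = if b = a then Function.update (s.arr a) i k else s.arr b := by
  simp only [State.setArr, Function.update_apply]

end Simp

theorem Runs.of_wp_le {M : Machine} {p : Program} {s : State} {Q : State → Prop} {T : ℕ}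
    (hs : Bdd M.bd s) (hd : p.maxDeg ≤ 12) (hT : p.wtime ≤ T) (h : p.wp M.thr M.bd Q s) :
    Runs M p s T Q :=
  (Runs.of_wp hs hd h).mono hT fun _ => id

/-- `Runs.loop` with a simpler time bound. -/
theorem Runs.loop_le {M : Machine} {p : Program} {s : State} {b : Test} (Inv : ℕ → State → Prop)
    (N c K : ℕ) (hK : c + b.time + 1 ≤ K) (hs : Bdd M.bd s) (hd : b.maxDeg ≤ 12) (h0 : Inv 0 s)
    (hstep : ∀ k s', k < N → Inv k s' → Bdd M.bd s' → Agree p s s' →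
      b.Holds M.thr s' ∧ Runs M p s' c (Inv (k + 1)))
    (hend : ∀ s', Inv N s' → Agree p s s' → ¬ b.Holds M.thr s') :
    Runs M (.loop b p) s (K * (N + 1)) (Inv N) := by
  refine (Runs.loop Inv N c hs hd h0 hstep hend).mono ?_ fun _ => id
  have := Nat.mul_le_mul_left N hK
  have h : K * (N + 1) = N * K + K := by ring
  omega

/-! ## The half-plane solver as a program -/

namespace Solver

/-- One step of the scan of the rows. -/
def rowBody : Program :=
  16 ⟵ .read 10 (.var 15) ⨟ setMax 18 (.var 16) ⨟
  .cond (.lt (.var 16) (.var 17)) (17 ⟵ .var 16 ⨟ .write 15 (.var 16) (.var 18)) .skip ⨟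
  15 ⟵ .var 15 + 1

/-- The scan of the rows. -/
def rowPass : Program :=
  (17 ⟵ .read 10 0 ⨟ 18 ⟵ .read 10 0 ⨟ 15 ⟵ 1) ⨟ .loop (.lt (.var 15) (.var 13)) rowBody

/-- One step of the scan of the columns. -/
def colBody : Program :=
  16 ⟵ .read 11 (.var 15) ⨟ setMin 19 (.var 16) ⨟
  .cond (.lt (.var 20) (.var 16)) (20 ⟵ .var 16 ⨟ .write 16 (.var 16) (.var 19)) .skip ⨟
  15 ⟵ .var 15 + 1

/-- The scan of the columns. -/
def colPass : Program :=
  (19 ⟵ .read 11 0 ⨟ 20 ⟵ .read 11 0 ⨟ 15 ⟵ 1) ⨟ .loop (.lt (.var 15) (.var 14)) colBody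

variable {M : Machine} {s : State} {a b : ℕ}

/-- A record is written at the address given by its own height, so later lookups by height take unit
time. Addresses may be negative. -/
theorem rowPass_runs (hs : Bdd M.bd s) (ha : s.var 13 = a) (ha0 : 0 < a)
    (hf : SlowOn (fun i => s.arr 10 i) a) :
    Runs M rowPass s (60 * (a + 1)) (fun s' =>
      RowScan (fun i => s.arr 10 i) a (s'.var 17) (s'.var 18) (s'.arr 15)) := by
  have hV := M.two_le
  have haV : (a : ℤ) ≤ M.bd := ha ▸ (hs.1 13).2
  refine Runs.mono (T := 20 + 50 * (a - 1 + 1)) (Runs.seq (R := fun s' =>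
    s'.var 17 = s.arr 10 0 ∧ s'.var 18 = s.arr 10 0 ∧ s'.var 15 = 1)
    (Runs.of_wp_le hs (by decide) (by decide) ?_) ?_) (by omega) fun _ => id
  · have := hs.2 10 0
    simp
    omega
  · rintro s₁ ⟨h17, h18, h15⟩ hs₁ hag₁
    have e13 : s₁.var 13 = a := (hag₁.1 13 (by decide)).trans ha
    have e10 : s₁.arr 10 = s.arr 10 := hag₁.2 10 (by decide)
    refine (Runs.loop_le (fun k s' => s'.var 15 = ((k + 1 : ℕ) : ℤ) ∧
      RowScan (fun i => s.arr 10 i) (k + 1) (s'.var 17) (s'.var 18) (s'.arr 15)) (a - 1)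
      rowBody.wtime 50 (by decide) hs₁ (by decide) ?_ ?_ ?_).mono le_rfl ?_
    · refine ⟨by simpa using h15, ?_⟩
      rw [h17, h18]
      exact RowScan.init (fun i => s.arr 10 i) _
    · rintro k s₂ hk ⟨h15, hR⟩ hs₂ hag₂
      have e13' : s₂.var 13 = a := (hag₂.1 13 (by decide)).trans e13
      have e10' : s₂.arr 10 = s.arr 10 := (hag₂.2 10 (by decide)).trans e10
      refine ⟨by simp [h15, e13']; omega, Runs.of_wp hs₂ (by decide) ?_⟩
      have h1 := hs₂.2 10 (s₂.var 15)
      have h2 := hs₂.1 18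
      have hlo := (hR.lo_le (s.arr 10 k)).2 ⟨k, by omega, le_rfl⟩
      have hsl := hf k (by omega)
      rw [h15, e10'] at h1
      simp only [rowBody, wp_seq, wp_assign, wp_setMax, wp_cond, wp_write, wp_skip, RExpr.eval_read,
        RExpr.eval_var, State.setVar_var, State.setVar_arr, Test.holds_lt, RExpr.eval_add,
        RExpr.eval_one, State.setArr_arr_apply, State.setArr_var, h15, e10']
      simp
      push_cast at *
      refine ⟨h1, by omega, fun hlt => ⟨by omega, by omega, by omega, ?_⟩, fun hge => ⟨by omega, ?_⟩⟩
      · exact_mod_cast hR.step_lt (by push_cast; omega) (by push_cast; omega)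
      · exact_mod_cast hR.step_ge (by push_cast; omega)
    · rintro s₂ ⟨h15, hR⟩ hag₂
      have e13' : s₂.var 13 = a := (hag₂.1 13 (by decide)).trans e13
      simp [h15, e13']
      omega
    · rintro s₂ ⟨h15, hR⟩
      have : a - 1 + 1 = a := by omega
      rwa [this] at hR

theorem colPass_runs (hs : Bdd M.bd s) (hb : s.var 14 = b) (hb0 : 0 < b)
    (hg : SlowOn (fun j => s.arr 11 j) b) :
    Runs M colPass s (60 * (b + 1)) (fun s' =>
      ColScan (fun j => s.arr 11 j) b (s'.var 19) (s'.var 20) (s'.arr 16)) := by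
  have hV := M.two_le
  have hbV : (b : ℤ) ≤ M.bd := hb ▸ (hs.1 14).2
  refine Runs.mono (T := 20 + 50 * (b - 1 + 1)) (Runs.seq (R := fun s' =>
    s'.var 19 = s.arr 11 0 ∧ s'.var 20 = s.arr 11 0 ∧ s'.var 15 = 1)
    (Runs.of_wp_le hs (by decide) (by decide) ?_) ?_) (by omega) fun _ => id
  · have := hs.2 11 0
    simp
    omega
  · rintro s₁ ⟨h17, h18, h15⟩ hs₁ hag₁
    have e13 : s₁.var 14 = b := (hag₁.1 14 (by decide)).trans hb
    have e10 : s₁.arr 11 = s.arr 11 := hag₁.2 11 (by decide)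
    refine (Runs.loop_le (fun k s' => s'.var 15 = ((k + 1 : ℕ) : ℤ) ∧
      ColScan (fun i => s.arr 11 i) (k + 1) (s'.var 19) (s'.var 20) (s'.arr 16)) (b - 1)
      colBody.wtime 50 (by decide) hs₁ (by decide) ?_ ?_ ?_).mono le_rfl ?_
    · refine ⟨by simpa using h15, ?_⟩
      rw [h17, h18]
      exact ColScan.init (fun i => s.arr 11 i) _
    · rintro k s₂ hk ⟨h15, hR⟩ hs₂ hag₂
      have e13' : s₂.var 14 = b := (hag₂.1 14 (by decide)).trans e13
      have e10' : s₂.arr 11 = s.arr 11 := (hag₂.2 11 (by decide)).trans e10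
      refine ⟨by simp [h15, e13']; omega, Runs.of_wp hs₂ (by decide) ?_⟩
      have h1 := hs₂.2 11 (s₂.var 15)
      have h2 := hs₂.1 19
      have hlo := (hR.le_hi (s.arr 11 k)).2 ⟨k, by omega, le_rfl⟩
      have hsl := hg k (by omega)
      rw [h15, e10'] at h1
      simp only [colBody, wp_seq, wp_assign, wp_setMin, wp_cond, wp_write, wp_skip, RExpr.eval_read,
        RExpr.eval_var, State.setVar_var, State.setVar_arr, Test.holds_lt, RExpr.eval_add,
        RExpr.eval_one, State.setArr_arr_apply, State.setArr_var, h15, e10']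
      simp
      push_cast at *
      refine ⟨h1, by omega, fun hlt => ⟨by omega, by omega, by omega, ?_⟩, fun hge => ⟨by omega, ?_⟩⟩
      · exact_mod_cast hR.step_gt (by push_cast; omega) (by push_cast; omega)
      · exact_mod_cast hR.step_le (by push_cast; omega)
    · rintro s₂ ⟨h15, hR⟩ hag₂
      have e13' : s₂.var 14 = b := (hag₂.1 14 (by decide)).trans e13
      simp [h15, e13']
      omega
    · rintro s₂ ⟨h15, hR⟩
      have : b - 1 + 1 = b := by omega
      rwa [this] at hR

end Solver

/-! ### The backward scan of the columns as a program. -/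

namespace Solver

/-- One step of the backward scan of the columns. -/
def backBody : Program :=
  15 ⟵ .var 15 - 1 ⨟ 16 ⟵ .read 11 (.var 15) ⨟
  .cond (.lt (.var 16) (.var 21)) (.write 18 (.var 16) (.read 18 (.var 21)) ⨟ 21 ⟵ .var 16) .skip ⨟
  .cond (.lt (.var 22) (.var 16)) (22 ⟵ .var 16 ⨟ .write 17 (.var 16) (.var 21)) .skip ⨟
  .cond (.le (.var 23) (.var 16))
    (.cond (.le 1 (.read 13 (.var 15))) (.write 18 (.var 21) (.var 22)) .skip ⨟ 23 ⟵ .read 10 0)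
    (.cond (.and (.le (.var 17) (.var 16)) (.lt (.var 16) (.read 10 0)))
      (setMax 23 (.read 15 (.var 16))) .skip)

/-- The backward scan of the columns. -/
def backPass : Program :=
  (21 ⟵ .read 11 (.var 14 - 1) ⨟ 22 ⟵ .read 11 (.var 14 - 1) ⨟ 23 ⟵ .read 10 0 ⨟
    .write 18 (.var 21) (.var 23 - 1) ⨟ 15 ⟵ .var 14) ⨟ .loop (.le 1 (.var 15)) backBody

variable {M : Machine} {s : State} {a b : ℕ}

theorem backPass_runs (hs : Bdd M.bd s) (hb : s.var 14 = b) (hb0 : 0 < b) (ha0 : 0 < a)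
    (hg : SlowOn (fun j => s.arr 11 j) b) (hf0 : -M.bd < s.arr 10 0) {fhi : ℤ}
    (hF : RowScan (fun i => s.arr 10 i) a (s.var 17) fhi (s.arr 15)) :
    Runs M backPass s (120 * (b + 1)) (fun s' =>
      BackScan (fun i => s.arr 10 i) (fun j => s.arr 11 j) a b (fun j => 1 ≤ s.arr 13 j) 0
        (s'.var 21) (s'.var 22) (s'.var 23) (s'.arr 17) (s'.arr 18)) := by
  have hV := M.two_le
  have hbV : (b : ℤ) ≤ M.bd := hb ▸ (hs.1 14).2
  have hb1 : ((b - 1 : ℕ) : ℤ) = b - 1 := by omega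
  refine Runs.mono (T := 50 + 90 * (b + 1)) (Runs.seq (R := fun s' =>
    s'.var 21 = s.arr 11 (b - 1 : ℕ) ∧ s'.var 22 = s.arr 11 (b - 1 : ℕ) ∧ s'.var 23 = s.arr 10 0 ∧
      s'.arr 18 = Function.update (s.arr 18) (s.arr 11 (b - 1 : ℕ)) (s.arr 10 0 - 1) ∧
      s'.var 15 = b)
    (Runs.of_wp_le hs (by decide) (by decide) ?_) ?_) (by omega) fun _ => id
  · have := hs.2 11 (b - 1)
    have := hs.2 10 0
    simp [hb, hb1]
    omega
  · rintro s₁ ⟨h21, h22, h23, h18, h15⟩ hs₁ hag₁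
    have e17 : s₁.var 17 = s.var 17 := hag₁.1 17 (by decide)
    have e10 : s₁.arr 10 = s.arr 10 := hag₁.2 10 (by decide)
    have e11 : s₁.arr 11 = s.arr 11 := hag₁.2 11 (by decide)
    have e13 : s₁.arr 13 = s.arr 13 := hag₁.2 13 (by decide)
    have e15 : s₁.arr 15 = s.arr 15 := hag₁.2 15 (by decide)
    refine (Runs.loop_le (fun k s' => s'.var 15 = ((b - k : ℕ) : ℤ) ∧
      BackScan (fun i => s.arr 10 i) (fun j => s.arr 11 j) a b (fun j => 1 ≤ s.arr 13 j) (b - k)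
        (s'.var 21) (s'.var 22) (s'.var 23) (s'.arr 17) (s'.arr 18)) b
      backBody.wtime 90 (by decide) hs₁ (by decide) ?_ ?_ ?_).mono le_rfl ?_
    · refine ⟨by simpa using h15, ?_⟩
      rw [h21, h22, h23, h18]
      exact BackScan.init (f := fun i => s.arr 10 i) (g := fun j => s.arr 11 j) _ _
    · rintro k s₂ hk ⟨h15, hB⟩ hs₂ hag₂
      have e17' : s₂.var 17 = s.var 17 := (hag₂.1 17 (by decide)).trans e17
      have e10' : s₂.arr 10 = s.arr 10 := (hag₂.2 10 (by decide)).trans e10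
      have e11' : s₂.arr 11 = s.arr 11 := (hag₂.2 11 (by decide)).trans e11
      have e13' : s₂.arr 13 = s.arr 13 := (hag₂.2 13 (by decide)).trans e13
      have e15' : s₂.arr 15 = s.arr 15 := (hag₂.2 15 (by decide)).trans e15
      refine ⟨by simp [h15]; omega, Runs.of_wp hs₂ (by decide) ?_⟩
      obtain ⟨j, hj⟩ : ∃ j, b - k = j + 1 := ⟨b - k - 1, by omega⟩
      have hjk : b - (k + 1) = j := by omega
      have h1 := hs₂.2 11 j
      have h2 := hs₂.2 10 0
      have h3 := hs₂.1 21
      have h4 := hs₂.1 22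
      have h5 := hs₂.2 18 (s₂.var 21)
      have h6 := hs₂.2 15 (s.arr 11 j)
      rw [e11'] at h1
      rw [e10'] at h2
      rw [e15'] at h6
      rw [hj] at hB h15
      -- Each combination of branches taken by the program is an instance of `BackScan.step` with
      -- the conditionals resolved.
      have hstep := fun lo' hi' kt' SM' XB₁ XB' => hB.step (lo' := lo') (hi' := hi') (kt' := kt')
        (SM' := SM') (XB₁ := XB₁) (XB' := XB') (by omega) hg hF ha0
      have h15' : s₂.var 15 - 1 = j := by rw [h15]; push_cast; ring
      simp only [backBody, wp_seq, wp_assign, wp_setMax, wp_cond, wp_write, wp_skip, RExpr.eval_read,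
        RExpr.eval_var, State.setVar_var, State.setVar_arr, Test.holds_lt, Test.holds_le,
        Test.holds_and, RExpr.eval_sub, RExpr.eval_zero,
        RExpr.eval_one, State.setArr_arr_apply, State.setArr_var, h15', e10', e11', e13', e15', e17',
        hjk]
      simp only [reduceIte, Nat.reduceEqDiff]
      refine ⟨by omega, by omega, ?_⟩
      generalize hgj : s.arr 11 j = w at *
      by_cases c1 : w < s₂.var 21 <;> by_cases c2 : s₂.var 22 < w <;>
        by_cases c3 : s₂.var 23 ≤ w <;> by_cases c4 : 1 ≤ s.arr 13 j <;>
        by_cases c5 : s.var 17 ≤ w ∧ w < s.arr 10 0 <;>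
        simp only [c1, c2, c3, c4, c5, not_true, not_false_iff, true_imp_iff, false_imp_iff,
          true_and, and_true, and_self]
      all_goals try and_intros
      all_goals first
        | omega
        | (refine hstep _ _ _ _ _ _ ?_ ?_ rfl ?_ ?_ ?_ <;>
            (try simp only [c1, c2, c3, c4, c5, Nat.cast_zero, if_true, if_false, and_true, and_self,
              and_false]) <;> first | rfl | omega)
    · rintro s₂ ⟨h15, hB⟩ hag₂
      simp [h15]
    · rintro s₂ ⟨h15, hB⟩
      simpa using hB

end Solver

/-! ### The output scan and the complete half-plane solver. -/

namespace Solver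

/-- The update of the left sources in the output scan. -/
def outMu : Program :=
  16 ⟵ .read 10 (.var 15) ⨟ setMax 26 (.var 16) ⨟ setMin 27 (.var 16) ⨟
  .cond (.le (.var 16) (.read 11 0)) (28 ⟵ .read 11 0) (28 ⟵ .read 16 (.var 16)) ⨟
  .cond (.lt (.var 20) (.var 16)) (24 ⟵ .read 11 0 + 1)
    (.cond (.le (.var 24) (.var 28)) (setMin 24 (.var 16)) (24 ⟵ .read 11 0 + 1)) ⨟
  .cond (.and (.le 1 (.read 12 (.var 15))) (.le (.var 16) (.read 11 0))) (setMin 24 (.var 16)) .skip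

/-- The output of a row in the output scan. -/
def outWrite : Program :=
  28 ⟵ .var 27 ⨟ setMax 28 (.var 19) ⨟
  .cond (.and (.le (.var 16) (.var 20)) (.and (.le (.var 16) (.var 25))
      (.or (.le (.var 24) (.var 19)) (.le (.var 26) (.read 18 (.var 28))))))
    (.write 14 (.var 15) 1) (.write 14 (.var 15) 0)

/-- The update of the right barriers in the output scan. -/
def outKa : Program :=
  .cond (.lt (.var 20) (.var 16)) (25 ⟵ .read 11 (.var 14 - 1))
    (.cond (.le (.var 16) (.var 25)) (25 ⟵ .read 11 (.var 14 - 1))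
      (.cond (.le (.var 16) (.read 11 (.var 14 - 1))) (setMin 25 (.read 11 (.var 14 - 1)))
        (setMin 25 (.read 17 (.var 16))))) ⨟
  15 ⟵ .var 15 + 1

/-- The output scan of the rows. -/
def outPass : Program :=
  (24 ⟵ .read 11 0 + 1 ⨟ 25 ⟵ .read 11 (.var 14 - 1) ⨟ 26 ⟵ .read 10 0 ⨟ 27 ⟵ .read 10 0 ⨟
    15 ⟵ 0) ⨟ .loop (.lt (.var 15) (.var 13)) (outMu ⨟ outWrite ⨟ outKa)

variable {M : Machine} {s : State} {a b : ℕ}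

theorem one_le_ite_iff (p : Prop) [Decidable p] : 1 ≤ (if p then 1 else 0 : ℤ) ↔ p := by
  split_ifs with h <;> simp [h]

theorem outMu_runs (hs : Bdd M.bd s) (hg0 : s.arr 11 0 < M.bd) :
    Runs M outMu s 70 (fun s' => s'.var 16 = s.arr 10 (s.var 15) ∧
      s'.var 26 = max (s.var 26) (s.arr 10 (s.var 15)) ∧
      s'.var 27 = min (s.var 27) (s.arr 10 (s.var 15)) ∧
      s'.var 24 = if 1 ≤ s.arr 12 (s.var 15) ∧ s.arr 10 (s.var 15) ≤ s.arr 11 0 then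
        min (if s.var 20 < s.arr 10 (s.var 15) then s.arr 11 0 + 1 else
          if s.var 24 ≤ (if s.arr 10 (s.var 15) ≤ s.arr 11 0 then s.arr 11 0
              else s.arr 16 (s.arr 10 (s.var 15))) then
            min (s.var 24) (s.arr 10 (s.var 15)) else s.arr 11 0 + 1) (s.arr 10 (s.var 15))
        else (if s.var 20 < s.arr 10 (s.var 15) then s.arr 11 0 + 1 else
          if s.var 24 ≤ (if s.arr 10 (s.var 15) ≤ s.arr 11 0 then s.arr 11 0
              else s.arr 16 (s.arr 10 (s.var 15))) then
            min (s.var 24) (s.arr 10 (s.var 15)) else s.arr 11 0 + 1)) := by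
  refine Runs.of_wp_le hs (by decide) (by decide) ?_
  have hV := M.two_le
  have h1 := hs.2 10 (s.var 15)
  have h2 := hs.2 11 0
  have h3 := hs.2 16 (s.arr 10 (s.var 15))
  simp only [outMu, wp_seq, wp_assign, wp_setMax, wp_setMin, wp_cond, wp_skip, RExpr.eval_read,
    RExpr.eval_var, State.setVar_var, State.setVar_arr, Test.holds_lt, Test.holds_le,
    Test.holds_and, RExpr.eval_add, RExpr.eval_zero, RExpr.eval_one, reduceIte, Nat.reduceEqDiff]
  generalize s.arr 10 (s.var 15) = w at *
  generalize s.arr 16 w = p at *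
  refine ⟨by omega, by omega, by omega, ?_⟩
  by_cases c1 : w ≤ s.arr 11 0 <;> by_cases c2 : s.var 20 < w <;>
    by_cases c4 : 1 ≤ s.arr 12 (s.var 15) <;>
    simp only [c1, c2, c4, not_true, not_false_iff, true_imp_iff, false_imp_iff, if_true, if_false,
      true_and, and_true, and_self, and_false]
  all_goals
    try and_intros
  all_goals omega

theorem outWrite_runs (hs : Bdd M.bd s) :
    Runs M outWrite s 50 (fun s' => s'.arr 14 = Function.update (s.arr 14) (s.var 15)
      (if s.var 16 ≤ s.var 20 ∧ s.var 16 ≤ s.var 25 ∧ (s.var 24 ≤ s.var 19 ∨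
        s.var 26 ≤ s.arr 18 (max (s.var 27) (s.var 19))) then 1 else 0)) := by
  refine Runs.of_wp_le hs (by decide) (by decide) ?_
  have hV := M.two_le
  have h1 := hs.1 27
  have h2 := hs.1 19
  simp only [outWrite, wp_seq, wp_assign, wp_setMax, wp_write, wp_cond, RExpr.eval_read,
    RExpr.eval_var, State.setVar_var, State.setVar_arr, Test.holds_or, Test.holds_le,
    Test.holds_and, RExpr.eval_zero, RExpr.eval_one, reduceIte, Nat.reduceEqDiff,
    State.setArr_arr_apply]
  refine ⟨by omega, by omega, fun h => ⟨by omega, by rw [if_pos h]⟩,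
    fun h => ⟨by omega, by rw [if_neg h]⟩⟩

theorem outKa_runs (hs : Bdd M.bd s) (hb : s.var 14 = b) (hb0 : 0 < b)
    (h15 : -M.bd ≤ s.var 15 ∧ s.var 15 < M.bd) :
    Runs M outKa s 50 (fun s' => s'.var 15 = s.var 15 + 1 ∧
      s'.var 25 = if s.var 20 < s.var 16 then s.arr 11 ((b - 1 : ℕ) : ℤ) else
        if s.var 16 ≤ s.var 25 then s.arr 11 ((b - 1 : ℕ) : ℤ) else
        min (s.var 25) (if s.var 16 ≤ s.arr 11 ((b - 1 : ℕ) : ℤ) then s.arr 11 ((b - 1 : ℕ) : ℤ)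
          else s.arr 17 (s.var 16))) := by
  refine Runs.of_wp_le hs (by decide) (by decide) ?_
  have hV := M.two_le
  have hb1 : (b : ℤ) - 1 = ((b - 1 : ℕ) : ℤ) := by omega
  have h1 := hs.2 11 ((b - 1 : ℕ) : ℤ)
  have h2 := hs.2 17 (s.var 16)
  simp only [outKa, wp_seq, wp_assign, wp_setMin, wp_cond, RExpr.eval_read,
    RExpr.eval_var, State.setVar_var, Test.holds_lt, Test.holds_le,
    RExpr.eval_add, RExpr.eval_sub, RExpr.eval_one, reduceIte, Nat.reduceEqDiff, hb, hb1]
  by_cases c1 : s.var 20 < s.var 16 <;> by_cases c2 : s.var 16 ≤ s.var 25 <;>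
    by_cases c3 : s.var 16 ≤ s.arr 11 ((b - 1 : ℕ) : ℤ) <;>
    simp only [c1, c2, c3, not_true, not_false_iff, true_imp_iff, false_imp_iff, if_true, if_false,
      true_and, and_true]
  all_goals
    try and_intros
  all_goals omega

theorem outPass_runs (hs : Bdd M.bd s) (ha : s.var 13 = a) (hb : s.var 14 = b) (hb0 : 0 < b)
    (hg0 : s.arr 11 0 < M.bd) {lo up kt : ℤ}
    (hG : ColScan (fun j => s.arr 11 j) b (s.var 19) (s.var 20) (s.arr 16))
    (hB : BackScan (fun i => s.arr 10 i) (fun j => s.arr 11 j) a b (fun j => 1 ≤ s.arr 13 j) 0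
      lo up kt (s.arr 17) (s.arr 18)) :
    Runs M outPass s (250 * (a + 1)) (fun s' => ∀ i < a, (1 ≤ s'.arr 14 i ↔
      RightReached (fun i => s.arr 10 i) (fun j => s.arr 11 j) b (fun i => 1 ≤ s.arr 12 i)
        (fun j => 1 ≤ s.arr 13 j) i)) := by
  have hV := M.two_le
  have haV : (a : ℤ) ≤ M.bd := ha ▸ (hs.1 13).2
  have hb1 : (b : ℤ) - 1 = ((b - 1 : ℕ) : ℤ) := by omega
  refine Runs.mono (T := 50 + 200 * (a + 1)) (Runs.seq (R := fun s' =>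
    s'.var 24 = s.arr 11 0 + 1 ∧ s'.var 25 = s.arr 11 (b - 1 : ℕ) ∧ s'.var 26 = s.arr 10 0 ∧
      s'.var 27 = s.arr 10 0 ∧ s'.var 15 = 0)
    (Runs.of_wp_le hs (by decide) (by decide) ?_) ?_) (by omega) fun _ => id
  · have := hs.2 11 (b - 1 : ℕ)
    have := hs.2 10 0
    have := hs.2 11 0
    simp [hb, hb1]
    omega
  · rintro s₁ ⟨h24, h25, h26, h27, h15⟩ hs₁ hag₁
    have key : ∀ s₂, Agree (outMu ⨟ outWrite ⨟ outKa) s₁ s₂ → s₂.var 13 = a ∧ s₂.var 14 = b ∧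
        s₂.var 19 = s.var 19 ∧ s₂.var 20 = s.var 20 ∧ s₂.arr 10 = s.arr 10 ∧ s₂.arr 11 = s.arr 11 ∧
        s₂.arr 12 = s.arr 12 ∧ s₂.arr 16 = s.arr 16 ∧ s₂.arr 17 = s.arr 17 ∧ s₂.arr 18 = s.arr 18 :=
      fun s₂ h => ⟨(h.1 13 (by decide)).trans ((hag₁.1 13 (by decide)).trans ha),
        (h.1 14 (by decide)).trans ((hag₁.1 14 (by decide)).trans hb),
        (h.1 19 (by decide)).trans (hag₁.1 19 (by decide)),
        (h.1 20 (by decide)).trans (hag₁.1 20 (by decide)),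
        (h.2 10 (by decide)).trans (hag₁.2 10 (by decide)),
        (h.2 11 (by decide)).trans (hag₁.2 11 (by decide)),
        (h.2 12 (by decide)).trans (hag₁.2 12 (by decide)),
        (h.2 16 (by decide)).trans (hag₁.2 16 (by decide)),
        (h.2 17 (by decide)).trans (hag₁.2 17 (by decide)),
        (h.2 18 (by decide)).trans (hag₁.2 18 (by decide))⟩
    refine (Runs.loop_le (fun k s' => s'.var 15 = (k : ℤ) ∧
      OutScan (fun i => s.arr 10 i) (fun j => s.arr 11 j) b (fun i => 1 ≤ s.arr 12 i) k (s'.var 24)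
        (s'.var 25) (s'.var 26) (s'.var 27) ∧ ∀ i < k, (1 ≤ s'.arr 14 i ↔
      RightReached (fun i => s.arr 10 i) (fun j => s.arr 11 j) b (fun i => 1 ≤ s.arr 12 i)
        (fun j => 1 ≤ s.arr 13 j) i)) a
      170 200 (by decide) hs₁ (by decide) ?_ ?_ ?_).mono le_rfl fun _ h => h.2.2
    · refine ⟨by simpa using h15, ?_, by simp⟩
      rw [h24, h25, h26, h27]
      exact OutScan.init (f := fun i => s.arr 10 i) (g := fun j => s.arr 11 j) _
    · rintro k s₂ hk ⟨h15, hO, hR⟩ hs₂ hag₂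
      obtain ⟨e13, e14, e19, e20, e10, e11, e12, e16, e17, e18⟩ := key s₂ hag₂
      refine ⟨by simp [h15, e13]; omega, ?_⟩
      refine Runs.seq (T := 70) (T' := 100) (outMu_runs hs₂ (by rw [e11]; exact hg0)) ?_
      rintro s₃ ⟨k16, k26, k27, k24⟩ hs₃ hag₃
      refine Runs.seq (T := 50) (T' := 50) (outWrite_runs hs₃) ?_
      intro s₄ k14 hs₄ hag₄
      have j14 := hag₄.1 14 (by decide)
      have j15 := hag₄.1 15 (by decide)
      have j16 := hag₄.1 16 (by decide)
      have j20 := hag₄.1 20 (by decide)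
      have j24 := hag₄.1 24 (by decide)
      have j25 := hag₄.1 25 (by decide)
      have j26 := hag₄.1 26 (by decide)
      have j27 := hag₄.1 27 (by decide)
      have j11 := hag₄.2 11 (by decide)
      have j17 := hag₄.2 17 (by decide)
      have i14 := hag₃.1 14 (by decide)
      have i15 := hag₃.1 15 (by decide)
      have i19 := hag₃.1 19 (by decide)
      have i20 := hag₃.1 20 (by decide)
      have i25 := hag₃.1 25 (by decide)
      have i11 := hag₃.2 11 (by decide)
      have i17 := hag₃.2 17 (by decide)
      have i18 := hag₃.2 18 (by decide)
      have i14' := hag₃.2 14 (by decide)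
      refine (outKa_runs hs₄ (j14.trans (i14.trans e14)) hb0 (by rw [j15, i15, h15]; omega)).agree.mono
        le_rfl ?_
      rintro s₅ ⟨⟨l15, l25⟩, -, hag₅⟩
      rw [j20, j16, j25, j11, j17, k16, i20, i25, i11, i17, e20, e10, e11, e17, h15] at l25
      rw [k16, k24, k26, k27, i18, i14', i15, i19, i20, i25, e19, e20, e10, e11, e12, e16, e18, h15] at k14
      rw [e20, e10, e11, e12, e16, h15] at k24
      rw [e10, h15] at k26 k27
      have l24 := (hag₅.1 24 (by decide)).trans (j24.trans k24)
      have l26 := (hag₅.1 26 (by decide)).trans (j26.trans k26)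
      have l27 := (hag₅.1 27 (by decide)).trans (j27.trans k27)
      have l14 := (hag₅.2 14 (by decide)).trans k14
      -- After the backward scan has reached column `0`, its suffix table covers all columns and all
      -- heights up to the overall maximum.
      have hO' := hO.step hb0 hG (fun w h1 h2 u => by
        have := hB.tableS w h1 ((hB.le_hi w).2 ?_) u
        · simpa [SuffixMeets] using this
        · obtain ⟨c, h3, h4⟩ := (hG.le_hi w).1 h2
          exact .inr ⟨c, by omega, h3, h4⟩) rfl l24 l25
      have hRR := rightReached_iff hk hb0 hO (l26 ▸ l27 ▸ hO') hG hB
      refine ⟨by rw [l15, j15, i15, h15]; push_cast; ring, l26 ▸ l27 ▸ hO', fun i hi => ?_⟩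
      rw [l14]
      by_cases hik : i = k
      · subst hik
        rw [Function.update_self, hRR, l24, l26, l27]
        exact one_le_ite_iff _
      · rw [Function.update_of_ne (by omega)]
        exact hR i (by omega)
    · rintro s₂ ⟨h15, -, -⟩ hag₂
      obtain ⟨e13, -⟩ := key s₂ hag₂
      simp [h15, e13]

/-- The half-plane solver: the cells of the last column that are reached. -/
def solver : Program := rowPass ⨟ colPass ⨟ backPass ⨟ outPass

/-- The strict bounds on `f 0` and `g 0` leave room for the sentinels `f 0 - 1` and `g 0 + 1`. -/
theorem solver_runs (hs : Bdd M.bd s) (ha : s.var 13 = a) (hb : s.var 14 = b) (ha0 : 0 < a)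
    (hb0 : 0 < b) (hf : SlowOn (fun i => s.arr 10 i) a) (hg : SlowOn (fun j => s.arr 11 j) b)
    (hf0 : -M.bd < s.arr 10 0) (hg0 : s.arr 11 0 < M.bd) :
    Runs M solver s (310 * (a + b + 2)) (fun s' => ∀ i < a, (1 ≤ s'.arr 14 i ↔
      RightReached (fun i => s.arr 10 i) (fun j => s.arr 11 j) b (fun i => 1 ≤ s.arr 12 i)
        (fun j => 1 ≤ s.arr 13 j) i)) := by
  refine Runs.mono (T := 60 * (a + 1) + (60 * (b + 1) + (120 * (b + 1) + 250 * (a + 1))))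
    (Runs.seq (rowPass_runs hs ha ha0 hf) ?_) (by omega) fun _ => id
  intro s₁ hF hs₁ hag₁
  have e10 := hag₁.2 10 (by decide)
  have e11 := hag₁.2 11 (by decide)
  have e12 := hag₁.2 12 (by decide)
  have e13 := hag₁.2 13 (by decide)
  have v13 := hag₁.1 13 (by decide)
  have v14 := hag₁.1 14 (by decide)
  refine Runs.seq (colPass_runs hs₁ (v14.trans hb) hb0 (by rw [e11]; exact hg)) ?_
  intro s₂ hG hs₂ hag₂
  have e10' := (hag₂.2 10 (by decide)).trans e10
  have e11' := (hag₂.2 11 (by decide)).trans e11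
  have e12' := (hag₂.2 12 (by decide)).trans e12
  have e13' := (hag₂.2 13 (by decide)).trans e13
  have e15' := hag₂.2 15 (by decide)
  have v13' := (hag₂.1 13 (by decide)).trans v13
  have v14' := (hag₂.1 14 (by decide)).trans v14
  have v17' := hag₂.1 17 (by decide)
  refine Runs.seq (backPass_runs (a := a) (fhi := s₁.var 18) hs₂ (v14'.trans hb) hb0 ha0
    (by rw [e11']; exact hg) (by rw [e10']; exact hf0) (by rw [e10', e15', v17']; exact hF)) ?_
  intro s₃ hB hs₃ hag₃
  have e10'' := (hag₃.2 10 (by decide)).trans e10'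
  have e11'' := (hag₃.2 11 (by decide)).trans e11'
  have e12'' := (hag₃.2 12 (by decide)).trans e12'
  have e13'' := (hag₃.2 13 (by decide)).trans e13'
  have e16'' := hag₃.2 16 (by decide)
  have v13'' := (hag₃.1 13 (by decide)).trans v13'
  have v14'' := (hag₃.1 14 (by decide)).trans v14'
  have v19'' := hag₃.1 19 (by decide)
  have v20'' := hag₃.1 20 (by decide)
  rw [e11] at hG
  rw [e10', e11', e13'] at hB
  have := outPass_runs (a := a) (b := b) hs₃ (v13''.trans ha) (v14''.trans hb) hb0
    (by rw [e11'']; exact hg0) (by rw [e11'', e16'', v19'', v20'']; exact hG)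
    (by rw [e10'', e11'', e13'']; exact hB)
  rwa [e10'', e11'', e12'', e13''] at this

end Solver

/-! ## Reachable cells of a grid, block by block -/

/-- The cells reachable from `(0, 0)`, with both indices shifted by one; a virtual cell before the
first one is reachable, all others with an index zero are not. -/
def Good (free : ℕ → ℕ → Prop) : ℕ → ℕ → Prop
  | 0, 0 => True
  | 0, _ + 1 => False
  | _ + 1, 0 => False
  | p + 1, q + 1 => Conn free 0 0 p q

section Good

variable {free : ℕ → ℕ → Prop} {i j x y p q : ℕ}

/-- The shift by one pays off here: thanks to the virtual cell, the first cell, the first row and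
the first column obey the same recurrence as all other cells. -/
theorem good_succ : Good free (p + 1) (q + 1) ↔
    free p q ∧ (Good free p q ∨ Good free (p + 1) q ∨ Good free p (q + 1)) := by
  constructor
  · intro h
    refine ⟨Conn.free_right h, ?_⟩
    change Conn free 0 0 p q at h
    cases h with
    | refl h => exact .inl trivial
    | up h _ => exact .inr (.inr h)
    | right h _ => exact .inr (.inl h)
    | diag h _ => exact .inl h
  · rintro ⟨hf, h⟩
    change Conn free 0 0 p q
    rcases p with _ | p <;> rcases q with _ | q <;> rcases h with h | h | h
    all_goals first
      | exact .refl hf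
      | exact h.elim
      | exact Conn.right h hf
      | exact Conn.up h hf
      | exact Conn.diag h hf

theorem Good.transpose : ∀ {p q : ℕ}, Good free p q → Good (fun a b => free b a) q p
  | 0, 0, h => h
  | 0, _ + 1, h => h
  | _ + 1, 0, h => h
  | _ + 1, _ + 1, h => Conn.transpose h

theorem good_transpose_iff : Good (fun a b => free b a) q p ↔ Good free p q :=
  ⟨fun h => h.transpose, fun h => h.transpose⟩

theorem good_of_conn (h : Conn free p q i j) (hpq : Good free (p + 1) (q + 1)) :
    Good free (i + 1) (j + 1) := by
  induction h with
  | refl h => exact hpq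
  | up _ hf ih => exact good_succ.2 ⟨hf, .inr (.inr ih)⟩
  | right _ hf ih => exact good_succ.2 ⟨hf, .inr (.inl ih)⟩
  | diag _ hf ih => exact good_succ.2 ⟨hf, .inl ih⟩

/-- A walk to a cell of a block enters the block in its first column or in its first row. -/
theorem good_iff_entry (hx : x ≤ i) (hy : y ≤ j) : Good free (i + 1) (j + 1) ↔
    (∃ i', x ≤ i' ∧ i' ≤ i ∧ (Good free (i' + 1) y ∨ Good free i' y) ∧ Conn free i' y i j) ∨
    ∃ j', y ≤ j' ∧ j' ≤ j ∧ (Good free x (j' + 1) ∨ Good free x j') ∧ Conn free x j' i j := by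
  constructor
  · induction hn : i + j using Nat.strong_induction_on generalizing i j with
    | _ n ih =>
      intro h
      obtain ⟨hf, h⟩ := good_succ.1 h
      have hbot : i = x → Good free i j ∨ Good free i (j + 1) → ((∃ i', x ≤ i' ∧ i' ≤ i ∧ (Good free (i' + 1) y ∨ Good free i' y) ∧ Conn free i' y i j) ∨
          ∃ j', y ≤ j' ∧ j' ≤ j ∧ (Good free x (j' + 1) ∨ Good free x j') ∧ Conn free x j' i j) := by
        rintro rfl h'
        exact .inr ⟨j, hy, le_rfl, h'.symm, .refl hf⟩
      have hleft : j = y → Good free i j ∨ Good free (i + 1) j → ((∃ i', x ≤ i' ∧ i' ≤ i ∧ (Good free (i' + 1) y ∨ Good free i' y) ∧ Conn free i' y i j) ∨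
          ∃ j', y ≤ j' ∧ j' ≤ j ∧ (Good free x (j' + 1) ∨ Good free x j') ∧ Conn free x j' i j) := by
        rintro rfl h'
        exact .inl ⟨i, hx, le_rfl, h'.symm, .refl hf⟩
      have hext : ∀ i₁ j₁, x ≤ i₁ → y ≤ j₁ → i₁ ≤ i → j₁ ≤ j → i₁ + j₁ < n →
          Good free (i₁ + 1) (j₁ + 1) →
          (∀ p q, Conn free p q i₁ j₁ → Conn free p q i j) →
          (∃ i', x ≤ i' ∧ i' ≤ i ∧ (Good free (i' + 1) y ∨ Good free i' y) ∧ Conn free i' y i j) ∨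
          ∃ j', y ≤ j' ∧ j' ≤ j ∧ (Good free x (j' + 1) ∨ Good free x j') ∧ Conn free x j' i j := by
        intro i₁ j₁ h1 h2 h3 h4 h5 h6 h7
        rcases ih _ h5 h1 h2 rfl h6 with ⟨i', h8, h9, h10, h11⟩ | ⟨j', h8, h9, h10, h11⟩
        · exact .inl ⟨i', h8, by omega, h10, h7 _ _ h11⟩
        · exact .inr ⟨j', h8, by omega, h10, h7 _ _ h11⟩
      rcases h with h | h | h
      · by_cases h1 : i = x
        · exact hbot h1 (.inl h)
        by_cases h2 : j = y
        · exact hleft h2 (.inl h)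
        obtain ⟨i, rfl⟩ : ∃ i₁, i = i₁ + 1 := ⟨i - 1, by omega⟩
        obtain ⟨j, rfl⟩ : ∃ j₁, j = j₁ + 1 := ⟨j - 1, by omega⟩
        exact hext i j (by omega) (by omega) (by omega) (by omega) (by omega) h
          fun p q h' => h'.diag hf
      · by_cases h2 : j = y
        · exact hleft h2 (.inr h)
        obtain ⟨j, rfl⟩ : ∃ j₁, j = j₁ + 1 := ⟨j - 1, by omega⟩
        exact hext i j hx (by omega) le_rfl (by omega) (by omega) h fun p q h' => h'.right hf
      · by_cases h1 : i = x
        · exact hbot h1 (.inr h)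
        obtain ⟨i, rfl⟩ : ∃ i₁, i = i₁ + 1 := ⟨i - 1, by omega⟩
        exact hext i j (by omega) hy (by omega) le_rfl (by omega) h fun p q h' => h'.up hf
  · rintro (⟨i', -, -, h1, h2⟩ | ⟨j', -, -, h1, h2⟩)
    · exact good_of_conn h2 (good_succ.2 ⟨h2.free_left, h1.elim (fun h => .inr (.inl h)) .inl⟩)
    · exact good_of_conn h2 (good_succ.2 ⟨h2.free_left, h1.elim (fun h => .inr (.inr h)) .inl⟩)

/-- A monotone walk between cells of a block stays in the block, so only the free cells of the block
matter. -/
theorem conn_shift_iff {free' : ℕ → ℕ → Prop} {a b i₁ j₁ : ℕ}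
    (hf : ∀ i < a, ∀ j < b, free (x + i) (y + j) ↔ free' i j) (hi : i < a) (hj : j < b) :
    Conn free (x + i₁) (y + j₁) (x + i) (y + j) ↔ Conn free' i₁ j₁ i j := by
  constructor
  · have H : ∀ p q, Conn free (x + i₁) (y + j₁) p q → p < x + a → q < y + b →
        Conn free' i₁ j₁ (p - x) (q - y) := by
      intro p q h
      have cast : ∀ p q, x ≤ p → y ≤ q → p < x + a → q < y + b → free p q →
          free' (p - x) (q - y) := fun p q h1 h2 h3 h4 h5 =>
        (hf _ (by omega) _ (by omega)).1 (by rwa [Nat.add_sub_cancel' h1, Nat.add_sub_cancel' h2])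
      induction h with
      | refl h =>
        intro h1 h2
        have := cast _ _ (by omega) (by omega) h1 h2 h
        simp only [Nat.add_sub_cancel_left] at this ⊢
        exact .refl this
      | @up p q h h' ih =>
        intro h1 h2
        have hle := h.le
        have := cast _ _ (by omega) (by omega) h1 h2 h'
        rw [show p + 1 - x = (p - x) + 1 by omega] at this ⊢
        exact (ih (by omega) h2).up this
      | @right p q h h' ih =>
        intro h1 h2
        have hle := h.le
        have := cast _ _ (by omega) (by omega) h1 h2 h'
        rw [show q + 1 - y = (q - y) + 1 by omega] at this ⊢
        exact (ih h1 (by omega)).right this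
      | @diag p q h h' ih =>
        intro h1 h2
        have hle := h.le
        have := cast _ _ (by omega) (by omega) h1 h2 h'
        rw [show q + 1 - y = (q - y) + 1 by omega, show p + 1 - x = (p - x) + 1 by omega] at this ⊢
        exact (ih (by omega) (by omega)).diag this
    intro h
    simpa using H _ _ h (by omega) (by omega)
  · intro h
    have hle := h.le
    have H : ∀ p q, Conn free' i₁ j₁ p q → p < a → q < b →
        Conn free (x + i₁) (y + j₁) (x + p) (y + q) := by
      intro p q h
      induction h with
      | refl h => exact fun h1 h2 => .refl ((hf _ h1 _ h2).2 h)
      | up _ h' ih => exact fun h1 h2 => (ih (by omega) h2).up ((hf _ h1 _ h2).2 h')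
      | right _ h' ih => exact fun h1 h2 => (ih h1 (by omega)).right ((hf _ h1 _ h2).2 h')
      | diag _ h' ih =>
        exact fun h1 h2 => (ih (by omega) (by omega)).diag ((hf _ h1 _ h2).2 h')
    exact H _ _ h hi hj

/-- The sources of a block are the boundary cells that have a reachable neighbour outside the block,
to the side or diagonally; in shifted indices these neighbours have the coordinate `x` or `y`. -/
theorem rightReached_iff_good {a b : ℕ} {f g : ℕ → ℤ} {SL SB : ℕ → Prop}
    (hf : ∀ i < a, ∀ j < b, free (x + i) (y + j) ↔ f i ≤ g j)
    (hSL : ∀ i < a, SL i ↔ Good free (x + i + 1) y ∨ Good free (x + i) y)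
    (hSB : ∀ j < b, SB j ↔ Good free x (y + j + 1) ∨ Good free x (y + j)) (hi : i < a) (hb : 0 < b) :
    RightReached f g b SL SB i ↔ Good free (x + i + 1) (y + b) := by
  have hb' : y + b = y + (b - 1) + 1 := by omega
  rw [hb', good_iff_entry (x := x) (y := y) (by omega) (by omega)]
  refine or_congr ⟨?_, ?_⟩ ⟨?_, ?_⟩
  · rintro ⟨i', h1, h2, h3⟩
    exact ⟨x + i', by omega, by omega, (hSL i' (by omega)).1 h2,
      (conn_shift_iff (j₁ := 0) hf hi (by omega)).2 h3⟩
  · rintro ⟨i', h1, h2, h3, h4⟩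
    obtain ⟨i', rfl⟩ := Nat.exists_eq_add_of_le h1
    exact ⟨i', by omega, (hSL i' (by omega)).2 h3,
      (conn_shift_iff (j₁ := 0) hf hi (by omega)).1 h4⟩
  · rintro ⟨j', h1, h2, h3⟩
    exact ⟨y + j', by omega, by omega, (hSB j' (by omega)).1 h2,
      (conn_shift_iff (i₁ := 0) hf hi (by omega)).2 h3⟩
  · rintro ⟨j', h1, h2, h3, h4⟩
    obtain ⟨j', rfl⟩ := Nat.exists_eq_add_of_le h1
    exact ⟨j', by omega, (hSB j' (by omega)).2 h3,
      (conn_shift_iff (i₁ := 0) hf hi (by omega)).1 h4⟩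

end Good

/-! ## The cells of a block of half-plane type -/

/-- Two sequences of triples of integers and a bound on their differences. -/
structure Grid where
  F : ℕ → ℕ → ℤ
  G : ℕ → ℕ → ℤ
  n : ℕ
  m : ℕ
  D : ℤ

namespace Grid

/-- The cell `(i, j)` is free if the triples differ by at most `D`. -/
def free (I : Grid) (i j : ℕ) : Prop := ∀ k < 3, |I.F k i - I.G k j| ≤ I.D

/-- The sequences change by at most one in a step, and all values fit into `[-V, V]`. -/
structure Fine (I : Grid) (V : ℤ) : Prop where
  slowF : ∀ k < 3, SlowOn (I.F k) I.n
  slowG : ∀ k < 3, SlowOn (I.G k) I.m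
  bddF : ∀ k < 3, ∀ i < I.n, |I.F k i| + I.D < V
  bddG : ∀ k < 3, ∀ j < I.m, |I.G k j| + I.D < V
  bddDiff : ∀ k < 3, ∀ i < I.n, ∀ j < I.m, |I.F k i - I.G k j| < V
  nonneg : 0 ≤ I.D
  size : (I.n : ℤ) + I.m < V

/-- The grid is in memory. -/
structure Loaded (I : Grid) (s : State) : Prop where
  n : s.var 0 = I.n
  m : s.var 1 = I.m
  D : s.var 4 = I.D
  F : ∀ k : ℕ, k < 3 → ∀ i : ℕ, i < I.n → s.arr 4 (3 * i + k) = I.F k i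
  G : ∀ k : ℕ, k < 3 → ∀ j : ℕ, j < I.m → s.arr 5 (3 * j + k) = I.G k j

/-- The table of the reachable cells is correct at `(p, q)`. -/
def Ok (I : Grid) (s : State) (p q : ℕ) : Prop :=
  1 ≤ s.arr 6 ((p : ℤ) * (I.m + 1) + q) ↔ Good I.free p q

/-- Everything that is correct in `s` is correct in `s'`. -/
def Mono (I : Grid) (s s' : State) : Prop := ∀ p q, q ≤ I.m → I.Ok s p q → I.Ok s' p q

variable {I : Grid} {s s' s'' : State}

theorem Mono.trans (h : I.Mono s s') (h' : I.Mono s' s'') : I.Mono s s'' :=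
  fun p q hq hp => h' p q hq (h p q hq hp)

theorem Mono.of_eq (h : s'.arr 6 = s.arr 6) : I.Mono s s' := fun p q _ hp => by
  rw [Ok, h]; exact hp

theorem Loaded.of_eq (h : I.Loaded s) (h0 : s'.var 0 = s.var 0) (h1 : s'.var 1 = s.var 1)
    (h4 : s'.var 4 = s.var 4) (hF : s'.arr 4 = s.arr 4) (hG : s'.arr 5 = s.arr 5) : I.Loaded s' where
  n := h0.trans h.n
  m := h1.trans h.m
  D := h4.trans h.D
  F k hk i hi := by rw [hF]; exact h.F k hk i hi
  G k hk i hi := by rw [hG]; exact h.G k hk i hi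

theorem Loaded.agree {p : Program} (h : I.Loaded s) (ha : Agree p s s')
    (hv : (0 ∉ p.wvars ∧ 1 ∉ p.wvars ∧ 4 ∉ p.wvars) ∧ 4 ∉ p.warrs ∧ 5 ∉ p.warrs) : I.Loaded s' :=
  h.of_eq (ha.1 0 hv.1.1) (ha.1 1 hv.1.2.1) (ha.1 4 hv.1.2.2) (ha.2 4 hv.2.1) (ha.2 5 hv.2.2)

/-- The table has rows of length `m + 1`, so division by `m + 1` recovers the position from the
address. -/
theorem addr_inj {m p q p' q' : ℕ} (hq : q ≤ m) (hq' : q' ≤ m)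
    (h : (p : ℤ) * (m + 1) + q = p' * (m + 1) + q') : p = p' ∧ q = q' := by
  have h' : p * (m + 1) + q = p' * (m + 1) + q' := by exact_mod_cast h
  have h1 := congrArg (· / (m + 1)) h'
  simp only [mul_comm _ (m + 1), Nat.mul_add_div (Nat.succ_pos m),
    Nat.div_eq_of_lt (Nat.lt_succ_of_le hq), Nat.div_eq_of_lt (Nat.lt_succ_of_le hq')] at h1
  simp only [add_zero] at h1
  subst h1
  exact ⟨rfl, by omega⟩

/-- Writing a correct entry. -/
theorem Mono.setArr {p q : ℕ} {k : ℤ} (hq : q ≤ I.m) (hk : 1 ≤ k ↔ Good I.free p q)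
    (h6 : s'.arr 6 = Function.update (s.arr 6) ((p : ℤ) * (I.m + 1) + q) k) :
    I.Mono s s' ∧ I.Ok s' p q := by
  have hpq : I.Ok s' p q := by
    rw [Ok, h6, Function.update_self]
    exact hk
  refine ⟨fun p' q' hq' h => ?_, hpq⟩
  by_cases he : (p' : ℤ) * (I.m + 1) + q' = p * (I.m + 1) + q
  · obtain ⟨rfl, rfl⟩ := addr_inj hq' hq he
    exact hpq
  · rw [Ok, h6, Function.update_of_ne he]
    exact h

end Grid

/-- Run `p` for the values `0, …, e - 1` of the variable `15`. -/
def forTo (e : RExpr) (p : Program) : Program :=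
  15 ⟵ 0 ⨟ .loop (.lt (.var 15) e) (p ⨟ 15 ⟵ .var 15 + 1)

/-! ### Loops with a counter. -/

section CounterLoop

variable {M : Machine} {s : State}

theorem init_counter (hs : Bdd M.bd s) : Runs M (15 ⟵ 0) s 2 (fun s' => s' = s.setVar 15 0) :=
  Runs.of_wp hs (by decide) (by have := M.two_le; simp; omega)

/-- A loop with the counter `15`. -/
theorem counter_loop {p : Program} {e : RExpr} (Inv : ℕ → State → Prop) (N c K : ℕ)
    (hs : Bdd M.bd s) (hN : (N : ℤ) < M.bd) (hde : e.maxDeg ≤ 12) (hdp : p.maxDeg ≤ 12)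
    (hc : p.wtime ≤ c) (hK : c + 10 + e.time ≤ K) (h15 : 15 ∉ p.wvars)
    (he : ∀ s', Agree (p ⨟ 15 ⟵ .var 15 + 1) (s.setVar 15 0) s' → e.eval s' = N)
    (h0 : Inv 0 (s.setVar 15 0))
    (hstep : ∀ k s', k < N → s'.var 15 = (k : ℤ) → Inv k s' → Bdd M.bd s' →
      Agree (p ⨟ 15 ⟵ .var 15 + 1) (s.setVar 15 0) s' →
      p.wp M.thr M.bd (fun s'' => Inv (k + 1) (s''.setVar 15 (k + 1 : ℕ))) s') :
    Runs M (forTo e p) s (K * (N + 2))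
      (Inv N) := by
  have hV := M.two_le
  refine Runs.mono (T := 2 + K * (N + 1)) (Runs.seq (init_counter hs) ?_) ?_ fun _ => id
  · rintro s₁ rfl hs₁ -
    have ht : (Test.lt (RExpr.var 15) e).time = e.time + 3 := rfl
    refine (Runs.loop_le (fun k s' => s'.var 15 = k ∧ Inv k s') N (c + 4) K (by omega) hs₁ ?_ ?_ ?_
      ?_).mono le_rfl fun _ h => h.2
    · simp only [Test.lt, Test.maxDeg, RExpr.maxDeg, max_le_iff]
      exact ⟨hde, by norm_num⟩
    · exact ⟨by simp, h0⟩
    · rintro k s₂ hk ⟨h15', hI⟩ hs₂ hag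
      refine ⟨?_, ?_⟩
      · simp only [Test.holds_lt, RExpr.eval_var, h15', he s₂ hag]
        exact_mod_cast hk
      · refine (Runs.seq (Runs.of_wp_le hs₂ hdp hc (hstep k s₂ hk h15' hI hs₂ hag)) (T' := 4) ?_)
        intro s₃ hI₃ hs₃ hag₃
        refine Runs.of_wp_le hs₃ (by decide) (by decide) ?_
        have e15 := (hag₃.1 15 h15).trans h15'
        simp only [wp_assign, RExpr.eval_add, RExpr.eval_var, RExpr.eval_one, e15]
        refine ⟨by omega, by simp, by simpa using hI₃⟩
    · rintro s₂ ⟨h15', -⟩ hag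
      simp [h15', he s₂ hag]
  · have : K * (N + 2) = K * (N + 1) + K := by ring
    omega

end CounterLoop

/-! ### Blocks of half-plane type: loading, solving and storing. -/

namespace Leaf

/-- Load the rows of a block. -/
def fillRow : Program := forTo (.var 13) (
  .write 10 (.var 15) (.var 12 * .read 4 (3 * (.var 5 + .var 15) + .var 8)) ⨟
  .cond (.or (.le 1 (.read 6 ((.var 5 + .var 15 + 1) * (.var 1 + 1) + .var 6)))
      (.le 1 (.read 6 ((.var 5 + .var 15) * (.var 1 + 1) + .var 6))))
    (.write 12 (.var 15) 1) (.write 12 (.var 15) 0))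

/-- Load the columns of a block. -/
def fillCol : Program := forTo (.var 14) (
  .write 11 (.var 15) (.var 12 * .read 5 (3 * (.var 6 + .var 15) + .var 8) + .var 4) ⨟
  .cond (.or (.le 1 (.read 6 (.var 5 * (.var 1 + 1) + (.var 6 + .var 15 + 1))))
      (.le 1 (.read 6 (.var 5 * (.var 1 + 1) + (.var 6 + .var 15)))))
    (.write 13 (.var 15) 1) (.write 13 (.var 15) 0))

/-- Store the last column of a block. -/
def storeRight : Program := forTo (.var 13)
  (.write 6 ((.var 5 + .var 15 + 1) * (.var 1 + 1) + (.var 6 + .var 14)) (.read 14 (.var 15)))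

/-- Store the last row of a block; rows and columns have been exchanged. -/
def storeTop : Program := forTo (.var 13)
  (.write 6 ((.var 5 + .var 14) * (.var 1 + 1) + (.var 6 + .var 15 + 1)) (.read 14 (.var 15)))

/-- Exchange the entries of rows and columns. -/
def swapArr : Program := forTo (.var 13 + .var 14) (
  11 ⟵ .read 10 (.var 15) ⨟ .write 10 (.var 15) (0 - .read 11 (.var 15)) ⨟
  .write 11 (.var 15) (0 - .var 11) ⨟
  11 ⟵ .read 12 (.var 15) ⨟ .write 12 (.var 15) (.read 13 (.var 15)) ⨟
  .write 13 (.var 15) (.var 11))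

/-- Exchange rows and columns. -/
def swap : Program := swapArr ⨟ 11 ⟵ .var 13 ⨟ 13 ⟵ .var 14 ⨟ 14 ⟵ .var 11

/-- Treat a block of half-plane type. -/
def leaf : Program := fillRow ⨟ fillCol ⨟ Solver.solver ⨟ storeRight ⨟ swap ⨟ Solver.solver ⨟ storeTop

variable {M : Machine} {s : State} {I : Grid} {x y a b kk : ℕ} {σ : ℤ}

theorem abs_sign_mul (hσ : σ = 1 ∨ σ = -1) (v : ℤ) : |σ * v| = |v| := by
  rcases hσ with rfl | rfl <;> simp

theorem fillRow_runs (hI : I.Fine M.bd) (hs : Bdd M.bd s) (hL : I.Loaded s) (h5 : s.var 5 = x)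
    (h6 : s.var 6 = y) (h8 : s.var 8 = kk) (hkk : kk < 3) (h12 : s.var 12 = σ)
    (hσ : σ = 1 ∨ σ = -1) (h13 : s.var 13 = a) (hxa : x + a ≤ I.n)
    (hok : ∀ i ≤ a, I.Ok s (x + i) y) :
    Runs M fillRow s (100 * (a + 2)) (fun s' => ∀ i < a, s'.arr 10 i = σ * I.F kk (x + i) ∧
      (1 ≤ s'.arr 12 i ↔ Good I.free (x + i + 1) y ∨ Good I.free (x + i) y)) := by
  have hsz := hI.size
  refine (counter_loop (fun k s' => ∀ i < k, s'.arr 10 i = σ * I.F kk (x + i) ∧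
      (1 ≤ s'.arr 12 i ↔ Good I.free (x + i + 1) y ∨ Good I.free (x + i) y)) a 60 100 hs
    (by omega) (by decide) (by decide) (by decide) (by decide) (by decide) ?_ ?_ ?_)
  · intro s' hag
    exact (hag.1 13 (by decide)).trans h13
  · intro i hi
    omega
  · intro k s₁ hk k15 hInv hs₁ hag
    have e5 : s₁.var 5 = x := (hag.1 5 (by decide)).trans h5
    have e6 : s₁.var 6 = y := (hag.1 6 (by decide)).trans h6
    have e8 : s₁.var 8 = kk := (hag.1 8 (by decide)).trans h8
    have e12 : s₁.var 12 = σ := (hag.1 12 (by decide)).trans h12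
    have e1 : s₁.var 1 = I.m := (hag.1 1 (by decide)).trans hL.m
    have a4 : s₁.arr 4 (3 * (x + k) + kk) = I.F kk (x + k) := by
      rw [show s₁.arr 4 = s.arr 4 from hag.2 4 (by decide)]
      exact_mod_cast hL.F kk hkk (x + k) (by omega)
    have a6 : s₁.arr 6 = s.arr 6 := hag.2 6 (by decide)
    have hb := hI.bddF kk hkk (x + k) (by omega)
    have hD := hI.nonneg
    have hab : |σ * I.F kk (x + k)| ≤ M.bd := by rw [abs_sign_mul hσ]; omega
    have hok1 := hok k (by omega)
    have hok2 := hok (k + 1) (by omega)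
    simp only [Grid.Ok] at hok1 hok2
    push_cast at hok1 hok2
    simp only [wp_seq, wp_write, wp_cond, RExpr.eval_read, RExpr.eval_var, RExpr.eval_mul,
      RExpr.eval_add, RExpr.eval_one, RExpr.eval_zero, RExpr.eval_three, Test.holds_or, Test.holds_le,
      State.setArr_var, State.setArr_arr_apply, State.setVar_arr, k15, e5, e6, e8, e12, e1, a4, a6,
      reduceIte, Nat.reduceEqDiff]
    have hV := M.two_le
    have step : ∀ v : ℤ, (1 ≤ v ↔ Good I.free (x + k + 1) y ∨ Good I.free (x + k) y) →
        ∀ i < k + 1, Function.update (s₁.arr 10) (k : ℤ) (σ * I.F kk (x + k)) i =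
          σ * I.F kk (x + i) ∧ (1 ≤ Function.update (s₁.arr 12) (k : ℤ) v i ↔
            Good I.free (x + i + 1) y ∨ Good I.free (x + i) y) := by
      intro v hv i hi
      by_cases hik : i = k
      · subst hik
        simpa using hv
      · rw [Function.update_of_ne (by omega), Function.update_of_ne (by omega)]
        exact hInv i (by omega)
    simp only [← add_assoc] at hok2
    rw [← hok1, ← hok2] at step
    refine ⟨abs_le.1 hab, fun h => ⟨by omega, ?_⟩, fun h => ⟨by omega, ?_⟩⟩
    · exact step 1 (iff_of_true le_rfl h)
    · exact step 0 (iff_of_false (by norm_num) h)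

theorem fillCol_runs (hI : I.Fine M.bd) (hs : Bdd M.bd s) (hL : I.Loaded s) (h5 : s.var 5 = x)
    (h6 : s.var 6 = y) (h8 : s.var 8 = kk) (hkk : kk < 3) (h12 : s.var 12 = σ)
    (hσ : σ = 1 ∨ σ = -1) (h14 : s.var 14 = b) (hyb : y + b ≤ I.m)
    (hok : ∀ j ≤ b, I.Ok s x (y + j)) :
    Runs M fillCol s (100 * (b + 2)) (fun s' => ∀ j < b, s'.arr 11 j = σ * I.G kk (y + j) + I.D ∧
      (1 ≤ s'.arr 13 j ↔ Good I.free x (y + j + 1) ∨ Good I.free x (y + j))) := by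
  have hsz := hI.size
  refine (counter_loop (fun k s' => ∀ j < k, s'.arr 11 j = σ * I.G kk (y + j) + I.D ∧
      (1 ≤ s'.arr 13 j ↔ Good I.free x (y + j + 1) ∨ Good I.free x (y + j))) b 60 100 hs
    (by omega) (by decide) (by decide) (by decide) (by decide) (by decide) ?_ ?_ ?_)
  · intro s' hag
    exact (hag.1 14 (by decide)).trans h14
  · intro i hi
    omega
  · intro k s₁ hk k15 hInv hs₁ hag
    have e5 : s₁.var 5 = x := (hag.1 5 (by decide)).trans h5
    have e6 : s₁.var 6 = y := (hag.1 6 (by decide)).trans h6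
    have e8 : s₁.var 8 = kk := (hag.1 8 (by decide)).trans h8
    have e12 : s₁.var 12 = σ := (hag.1 12 (by decide)).trans h12
    have e1 : s₁.var 1 = I.m := (hag.1 1 (by decide)).trans hL.m
    have e4 : s₁.var 4 = I.D := (hag.1 4 (by decide)).trans hL.D
    have a5 : s₁.arr 5 (3 * (y + k) + kk) = I.G kk (y + k) := by
      rw [show s₁.arr 5 = s.arr 5 from hag.2 5 (by decide)]
      exact_mod_cast hL.G kk hkk (y + k) (by omega)
    have a6 : s₁.arr 6 = s.arr 6 := hag.2 6 (by decide)
    have hb := hI.bddG kk hkk (y + k) (by omega)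
    have hD := hI.nonneg
    have hab : |σ * I.G kk (y + k)| = |I.G kk (y + k)| := abs_sign_mul hσ _
    have hab1 := neg_abs_le (σ * I.G kk (y + k))
    have hab2 := le_abs_self (σ * I.G kk (y + k))
    have hok1 := hok k (by omega)
    have hok2 := hok (k + 1) (by omega)
    simp only [Grid.Ok] at hok1 hok2
    push_cast at hok1 hok2
    simp only [wp_seq, wp_write, wp_cond, RExpr.eval_read, RExpr.eval_var, RExpr.eval_mul,
      RExpr.eval_add, RExpr.eval_one, RExpr.eval_zero, RExpr.eval_three, Test.holds_or, Test.holds_le,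
      State.setArr_var, State.setArr_arr_apply, State.setVar_arr, k15, e5, e6, e8, e12, e1, e4, a5,
      a6, reduceIte, Nat.reduceEqDiff]
    have hV := M.two_le
    have step : ∀ v : ℤ, (1 ≤ v ↔ Good I.free x (y + k + 1) ∨ Good I.free x (y + k)) →
        ∀ j < k + 1, Function.update (s₁.arr 11) (k : ℤ) (σ * I.G kk (y + k) + I.D) j =
          σ * I.G kk (y + j) + I.D ∧ (1 ≤ Function.update (s₁.arr 13) (k : ℤ) v j ↔
            Good I.free x (y + j + 1) ∨ Good I.free x (y + j)) := by
      intro v hv i hi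
      by_cases hik : i = k
      · subst hik
        simpa using hv
      · rw [Function.update_of_ne (by omega), Function.update_of_ne (by omega)]
        exact hInv i (by omega)
    rw [← add_assoc y, ← add_assoc (y : ℤ)] at hok2
    rw [← hok1, ← hok2] at step
    refine ⟨by omega, fun h => ⟨by omega, ?_⟩, fun h => ⟨by omega, ?_⟩⟩
    · exact step 1 (iff_of_true le_rfl h)
    · exact step 0 (iff_of_false (by norm_num) h)

theorem storeRight_runs (hI : I.Fine M.bd) (hs : Bdd M.bd s) (hL : I.Loaded s) (h5 : s.var 5 = x)
    (h6 : s.var 6 = y) (h13 : s.var 13 = a) (h14 : s.var 14 = b) (hxa : x + a ≤ I.n)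
    (hyb : y + b ≤ I.m) (hout : ∀ i < a, (1 ≤ s.arr 14 i ↔ Good I.free (x + i + 1) (y + b))) :
    Runs M storeRight s (100 * (a + 2)) (fun s' => I.Mono s s' ∧
      ∀ i < a, I.Ok s' (x + i + 1) (y + b)) := by
  have hsz := hI.size
  refine (counter_loop (fun k s' => I.Mono s s' ∧
      ∀ i < k, I.Ok s' (x + i + 1) (y + b)) a 60 100 hs
    (by omega) (by decide) (by decide) (by decide) (by decide) (by decide) ?_ ?_ ?_)
  · intro s' hag
    exact (hag.1 13 (by decide)).trans h13
  · exact ⟨Grid.Mono.of_eq rfl, fun i hi => by omega⟩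
  · intro k s₁ hk k15 hInv hs₁ hag
    have e5 : s₁.var 5 = x := (hag.1 5 (by decide)).trans h5
    have e6 : s₁.var 6 = y := (hag.1 6 (by decide)).trans h6
    have e14 : s₁.var 14 = b := (hag.1 14 (by decide)).trans h14
    have e1 : s₁.var 1 = I.m := (hag.1 1 (by decide)).trans hL.m
    have a14 : s₁.arr 14 = s.arr 14 := hag.2 14 (by decide)
    have hb := hs.2 14 k
    simp only [wp_write, RExpr.eval_read, RExpr.eval_var, RExpr.eval_mul,
      RExpr.eval_add, RExpr.eval_one, k15, e5, e6, e14, e1, a14]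
    refine ⟨hb, ?_⟩
    have h := Grid.Mono.setArr (I := I) (s := s₁) (s' := (s₁.setArr 6 ((x + k + 1) * (I.m + 1) + (y + b))
      (s.arr 14 k)).setVar 15 (k + 1 : ℕ)) (p := x + k + 1) (q := y + b) hyb (hout k hk) (by
        simp [State.setArr_arr_apply])
    refine ⟨hInv.1.trans h.1, fun i hi => ?_⟩
    by_cases hik : i = k
    · subst hik; exact h.2
    · exact h.1 _ _ hyb (hInv.2 i (by omega))

theorem storeTop_runs (hI : I.Fine M.bd) (hs : Bdd M.bd s) (hL : I.Loaded s) (h5 : s.var 5 = x)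
    (h6 : s.var 6 = y) (h13 : s.var 13 = b) (h14 : s.var 14 = a)
    (hyb : y + b ≤ I.m) (hout : ∀ j < b, (1 ≤ s.arr 14 j ↔ Good I.free (x + a) (y + j + 1))) :
    Runs M storeTop s (100 * (b + 2)) (fun s' => I.Mono s s' ∧
      ∀ j < b, I.Ok s' (x + a) (y + j + 1)) := by
  have hsz := hI.size
  refine (counter_loop (fun k s' => I.Mono s s' ∧
      ∀ j < k, I.Ok s' (x + a) (y + j + 1)) b 60 100 hs
    (by omega) (by decide) (by decide) (by decide) (by decide) (by decide) ?_ ?_ ?_)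
  · intro s' hag
    exact (hag.1 13 (by decide)).trans h13
  · exact ⟨Grid.Mono.of_eq rfl, fun i hi => by omega⟩
  · intro k s₁ hk k15 hInv hs₁ hag
    have e5 : s₁.var 5 = x := (hag.1 5 (by decide)).trans h5
    have e6 : s₁.var 6 = y := (hag.1 6 (by decide)).trans h6
    have e14 : s₁.var 14 = a := (hag.1 14 (by decide)).trans h14
    have e1 : s₁.var 1 = I.m := (hag.1 1 (by decide)).trans hL.m
    have a14 : s₁.arr 14 = s.arr 14 := hag.2 14 (by decide)
    have hb := hs.2 14 k
    simp only [wp_write, RExpr.eval_read, RExpr.eval_var, RExpr.eval_mul,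
      RExpr.eval_add, RExpr.eval_one, k15, e5, e6, e14, e1, a14]
    refine ⟨hb, ?_⟩
    have h := Grid.Mono.setArr (I := I) (s := s₁) (s' := (s₁.setArr 6 ((x + a) * (I.m + 1) + (y + k + 1))
      (s.arr 14 k)).setVar 15 (k + 1 : ℕ)) (p := x + a) (q := y + k + 1) (by omega) (hout k hk) (by
        simp [State.setArr_arr_apply])
    refine ⟨hInv.1.trans h.1, fun i hi => ?_⟩
    by_cases hik : i = k
    · subst hik; exact h.2
    · exact h.1 _ _ (by omega) (hInv.2 i (by omega))

/-- The signs change because `f i ≤ g j` is the same as `-g j ≤ -f i`: in the exchanged grid `-g`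
belongs to the rows and `-f` to the columns. Running over `a + b` entries covers both lengths. -/
theorem swap_runs (hs : Bdd M.bd s) (h13 : s.var 13 = a) (h14 : s.var 14 = b)
    (hab : (a : ℤ) + b < M.bd) :
    Runs M swap s (100 * (a + b + 2) + 10) (fun s' => s'.var 13 = b ∧ s'.var 14 = a ∧
      ∀ i : ℕ, i < a + b → s'.arr 10 i = -s.arr 11 i ∧ s'.arr 11 i = -s.arr 10 i ∧
        s'.arr 12 i = s.arr 13 i ∧ s'.arr 13 i = s.arr 12 i) := by
  have hV := M.two_le
  refine Runs.seq (counter_loop (fun k s' => (∀ i : ℕ, i < k → s'.arr 10 i = -s.arr 11 i ∧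
      s'.arr 11 i = -s.arr 10 i ∧ s'.arr 12 i = s.arr 13 i ∧ s'.arr 13 i = s.arr 12 i) ∧
      ∀ i : ℕ, k ≤ i → s'.arr 10 i = s.arr 10 i ∧ s'.arr 11 i = s.arr 11 i ∧
        s'.arr 12 i = s.arr 12 i ∧ s'.arr 13 i = s.arr 13 i) (a + b) 60 100 hs
    (by push_cast; omega) (by decide) (by decide) (by decide) (by decide) (by decide) ?_ ?_ ?_) ?_
  · intro s' hag
    have e13 := hag.1 13 (by decide)
    have e14 := hag.1 14 (by decide)
    simp [e13, e14, h13, h14]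
  · exact ⟨fun i hi => by omega, fun i _ => by simp⟩
  · rintro k s₁ hk k15 ⟨hI1, hI2⟩ hs₁ hag
    obtain ⟨g10, g11, g12, g13⟩ := hI2 k le_rfl
    have b10 := hs₁.2 10 k
    have b11 := hs₁.2 11 k
    have b12 := hs₁.2 12 k
    have b13 := hs₁.2 13 k
    simp only [wp_seq, wp_assign, wp_write, RExpr.eval_read, RExpr.eval_var, RExpr.eval_sub,
      RExpr.eval_zero, State.setArr_var, State.setArr_arr_apply, State.setVar_arr,
      State.setVar_var, k15, reduceIte, Nat.reduceEqDiff, zero_sub]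
    refine ⟨by omega, by omega, by omega, by omega, by omega, by omega, ?_, ?_⟩
    · intro i hi
      by_cases hik : i = k
      · subst hik
        simp [g10, g11, g12, g13]
      · have hne : (i : ℤ) ≠ k := by omega
        simpa [Function.update_of_ne hne] using hI1 i (by omega)
    · intro i hi
      have hne : (i : ℤ) ≠ k := by omega
      simpa [Function.update_of_ne hne] using hI2 i (by omega)
  · rintro s₁ ⟨hI, -⟩ hs₁ hag
    have e13 : s₁.var 13 = a := (hag.1 13 (by decide)).trans h13
    have e14 : s₁.var 14 = b := (hag.1 14 (by decide)).trans h14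
    refine Runs.of_wp_le hs₁ (by decide) (by decide) ?_
    simp [e13, e14]
    exact ⟨by omega, by omega, by omega, hI⟩

theorem slowOn_sign_mul {h : ℕ → ℤ} {N x a : ℕ} (hh : SlowOn h N) (hσ : σ = 1 ∨ σ = -1)
    (hxa : x + a ≤ N) (c : ℤ) : SlowOn (fun i => σ * h (x + i) + c) a := by
  intro i hi
  have := hh (x + i) (by omega)
  rcases hσ with rfl | rfl <;> simp only [← add_assoc] <;> omega

theorem SlowOn.congr {f f' : ℕ → ℤ} {a : ℕ} (h : SlowOn f a) (hf : ∀ i < a, f' i = f i) :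
    SlowOn f' a := by
  intro i hi
  simp only [hf i (by omega), hf (i + 1) hi]
  exact h i hi

theorem SlowOn.neg {f : ℕ → ℤ} {a : ℕ} (h : SlowOn f a) : SlowOn (fun i => -f i) a := by
  intro i hi
  have := h i hi
  dsimp only
  omega

/-- The solver delivers only the last column. It leaves its input arrays intact, so after an
exchange of rows and columns a second run delivers the last row. -/
theorem leaf_runs (hI : I.Fine M.bd) (hs : Bdd M.bd s) (hL : I.Loaded s) (h5 : s.var 5 = x)
    (h6 : s.var 6 = y) (h8 : s.var 8 = kk) (hkk : kk < 3) (h12 : s.var 12 = σ)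
    (hσ : σ = 1 ∨ σ = -1) (h13 : s.var 13 = a) (h14 : s.var 14 = b) (ha0 : 0 < a) (hb0 : 0 < b)
    (hxa : x + a ≤ I.n) (hyb : y + b ≤ I.m)
    (hfree : ∀ i < a, ∀ j < b, I.free (x + i) (y + j) ↔
      σ * I.F kk (x + i) ≤ σ * I.G kk (y + j) + I.D)
    (hokL : ∀ i ≤ a, I.Ok s (x + i) y) (hokB : ∀ j ≤ b, I.Ok s x (y + j)) :
    Runs M leaf s (1200 * (a + b + 2)) (fun s' => I.Mono s s' ∧
      (∀ i < a, I.Ok s' (x + i + 1) (y + b)) ∧ ∀ j < b, I.Ok s' (x + a) (y + j + 1)) := by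
  have hsz := hI.size
  have hD := hI.nonneg
  have hF0 : |σ * I.F kk x| + I.D < M.bd := by
    rw [abs_sign_mul hσ]; exact hI.bddF kk hkk x (by omega)
  have hG0 : |σ * I.G kk y| + I.D < M.bd := by
    rw [abs_sign_mul hσ]; exact hI.bddG kk hkk y (by omega)
  have hF1 := neg_abs_le (σ * I.F kk x)
  have hF2 := le_abs_self (σ * I.F kk x)
  have hG1 := neg_abs_le (σ * I.G kk y)
  have hG2 := le_abs_self (σ * I.G kk y)
  refine Runs.mono (T := 100 * (a + 2) + (100 * (b + 2) + (310 * (a + b + 2) + (100 * (a + 2) +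
    ((100 * (a + b + 2) + 10) + (310 * (b + a + 2) + 100 * (b + 2)))))))
    (Runs.seq (fillRow_runs hI hs hL h5 h6 h8 hkk h12 hσ h13 hxa hokL) ?_) (by omega) fun _ => id
  intro s₁ hrow hs₁ hag₁
  have v₁ := fun x (hx : x ∉ fillRow.wvars) => hag₁.1 x hx
  have hM₁ : I.Mono s s₁ := Grid.Mono.of_eq (hag₁.2 6 (by decide))
  refine Runs.seq (fillCol_runs hI hs₁ (hL.agree hag₁ (by decide)) ((v₁ 5 (by decide)).trans h5)
    ((v₁ 6 (by decide)).trans h6) ((v₁ 8 (by decide)).trans h8) hkk ((v₁ 12 (by decide)).trans h12)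
    hσ ((v₁ 14 (by decide)).trans h14) hyb (fun j hj => hM₁ _ _ (by omega) (hokB j hj))) ?_
  intro s₂ hcol hs₂ hag₂
  have v₂ := fun x (hx : x ∉ fillRow.wvars ∧ x ∉ fillCol.wvars) =>
    (hag₂.1 x hx.2).trans (v₁ x hx.1)
  have hM₂ : I.Mono s s₂ := hM₁.trans (Grid.Mono.of_eq (hag₂.2 6 (by decide)))
  have hL₂ : I.Loaded s₂ := (hL.agree hag₁ (by decide)).agree hag₂ (by decide)
  rw [← hag₂.2 10 (by decide), ← hag₂.2 12 (by decide)] at hrow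
  have hslowF : SlowOn (fun i => s₂.arr 10 i) a :=
    SlowOn.congr (slowOn_sign_mul (hI.slowF kk hkk) hσ hxa 0) fun i hi => by
      simpa using (hrow i hi).1
  have hslowG : SlowOn (fun j => s₂.arr 11 j) b :=
    SlowOn.congr (slowOn_sign_mul (hI.slowG kk hkk) hσ hyb I.D) fun j hj => (hcol j hj).1
  have hf0 : s₂.arr 10 0 = σ * I.F kk x := (hrow 0 ha0).1
  have hg0 : s₂.arr 11 0 = σ * I.G kk y + I.D := (hcol 0 hb0).1
  have hhalf : ∀ i < a, ∀ j < b, I.free (x + i) (y + j) ↔ s₂.arr 10 i ≤ s₂.arr 11 j := by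
    intro i hi j hj
    rw [hfree i hi j hj, (hrow i hi).1, (hcol j hj).1]
  refine Runs.seq (Solver.solver_runs hs₂ ((v₂ 13 (by decide)).trans h13)
    ((v₂ 14 (by decide)).trans h14) ha0 hb0 hslowF hslowG (by omega) (by omega)) ?_
  intro s₃ hsol hs₃ hag₃
  have v₃ := fun x (hx : (x ∉ fillRow.wvars ∧ x ∉ fillCol.wvars) ∧ x ∉ Solver.solver.wvars) =>
    (hag₃.1 x hx.2).trans (v₂ x hx.1)
  have hM₃ : I.Mono s s₃ := hM₂.trans (Grid.Mono.of_eq (hag₃.2 6 (by decide)))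
  have hL₃ : I.Loaded s₃ := hL₂.agree hag₃ (by decide)
  refine Runs.seq (storeRight_runs hI hs₃ hL₃ ((v₃ 5 (by decide)).trans h5)
    ((v₃ 6 (by decide)).trans h6) ((v₃ 13 (by decide)).trans h13) ((v₃ 14 (by decide)).trans h14)
    hxa hyb (fun i hi => ?_)) ?_
  · rw [hsol i hi]
    exact rightReached_iff_good hhalf (fun i hi => (hrow i hi).2) (fun j hj => (hcol j hj).2) hi hb0
  rintro s₄ ⟨hM, hright⟩ hs₄ hag₄
  have v₄ := fun x (hx : ((x ∉ fillRow.wvars ∧ x ∉ fillCol.wvars) ∧ x ∉ Solver.solver.wvars) ∧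
    x ∉ storeRight.wvars) => (hag₄.1 x hx.2).trans (v₃ x hx.1)
  have hM₄ : I.Mono s s₄ := hM₃.trans hM
  have hL₄ : I.Loaded s₄ := hL₃.agree hag₄ (by decide)
  refine Runs.seq (swap_runs (a := a) (b := b) hs₄ ((v₄ 13 (by decide)).trans h13)
    ((v₄ 14 (by decide)).trans h14) (by omega)) ?_
  rintro s₅ ⟨k13, k14, hswap⟩ hs₅ hag₅
  have v₅ := fun x (hx : (((x ∉ fillRow.wvars ∧ x ∉ fillCol.wvars) ∧ x ∉ Solver.solver.wvars) ∧
    x ∉ storeRight.wvars) ∧ x ∉ swap.wvars) => (hag₅.1 x hx.2).trans (v₄ x hx.1)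
  have hM₅ : I.Mono s₄ s₅ := Grid.Mono.of_eq (hag₅.2 6 (by decide))
  have hL₅ : I.Loaded s₅ := hL₄.agree hag₅ (by decide)
  rw [(hag₄.2 10 (by decide)).trans (hag₃.2 10 (by decide)),
    (hag₄.2 11 (by decide)).trans (hag₃.2 11 (by decide)),
    (hag₄.2 12 (by decide)).trans (hag₃.2 12 (by decide)),
    (hag₄.2 13 (by decide)).trans (hag₃.2 13 (by decide))] at hswap
  have h10' := (hswap 0 (by omega)).1
  have h11' := (hswap 0 (by omega)).2.1
  simp only [Nat.cast_zero] at h10' h11'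
  refine Runs.seq (Solver.solver_runs (a := b) (b := a) hs₅ k13 k14 hb0 ha0
    (SlowOn.congr (SlowOn.neg hslowG) fun j hj => (hswap j (by omega)).1)
    (SlowOn.congr (SlowOn.neg hslowF) fun i hi => (hswap i (by omega)).2.1) (by omega) (by omega)) ?_
  intro s₆ hsol' hs₆ hag₆
  have v₆ := fun x (hx : ((((x ∉ fillRow.wvars ∧ x ∉ fillCol.wvars) ∧ x ∉ Solver.solver.wvars) ∧
    x ∉ storeRight.wvars) ∧ x ∉ swap.wvars) ∧ x ∉ Solver.solver.wvars) =>
    (hag₆.1 x hx.2).trans (v₅ x hx.1)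
  have hM₆ : I.Mono s₄ s₆ := hM₅.trans (Grid.Mono.of_eq (hag₆.2 6 (by decide)))
  have hL₆ : I.Loaded s₆ := hL₅.agree hag₆ (by decide)
  refine (storeTop_runs hI hs₆ hL₆ ((v₆ 5 (by decide)).trans h5)
    ((v₆ 6 (by decide)).trans h6) ((hag₆.1 13 (by decide)).trans k13)
    ((hag₆.1 14 (by decide)).trans k14) hyb (fun j hj => ?_)).mono le_rfl ?_
  -- The second run speaks about the transposed grid, whose reachable cells are the transposed ones.
  · rw [hsol' j hj, ← good_transpose_iff]
    refine rightReached_iff_good (fun j hj i hi => ?_) (fun j hj => ?_) (fun i hi => ?_) hj ha0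
    · rw [hhalf i hi j hj, (hswap j (by omega)).1, (hswap i (by omega)).2.1, neg_le_neg_iff]
    · rw [(hswap j (by omega)).2.2.1, (hcol j hj).2]
      exact or_congr good_transpose_iff.symm good_transpose_iff.symm
    · rw [(hswap i (by omega)).2.2.2, (hrow i hi).2]
      exact or_congr good_transpose_iff.symm good_transpose_iff.symm
  · rintro s₇ ⟨hM₇, htop⟩
    exact ⟨hM₄.trans (hM₆.trans hM₇),
      fun i hi => hM₇ _ _ hyb (hM₆ _ _ hyb (hright i hi)), htop⟩

end Leaf

/-! ## The recursion over the blocks -/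

/-- Finitely many rounds of a loop lead from `s` to a state with the property `Q`, in time `T`. -/
def LoopReach (M : Machine) (b : Test) (p : Program) (s : State) (T : ℕ) (Q : State → Prop) : Prop :=
  ∃ s' t, (∀ s'' t', Exec M.thr M.word (.loop b p) s' s'' t' →
      Exec M.thr M.word (.loop b p) s s'' (t + t')) ∧
    t ≤ T ∧ Bdd M.bd s' ∧ Agree p s s' ∧ Q s'

section LoopReach

variable {M : Machine} {b : Test} {p : Program} {s : State} {T T' : ℕ} {Q R : State → Prop}

theorem LoopReach.mono (h : LoopReach M b p s T Q) (hT : T ≤ T') (hQ : ∀ s', Q s' → R s') :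
    LoopReach M b p s T' R := by
  obtain ⟨s', t, h1, h2, h3, h4, h5⟩ := h
  exact ⟨s', t, h1, h2.trans hT, h3, h4, hQ _ h5⟩

theorem LoopReach.trans (h : LoopReach M b p s T Q)
    (h' : ∀ s', Q s' → Bdd M.bd s' → Agree p s s' → LoopReach M b p s' T' R) :
    LoopReach M b p s (T + T') R := by
  obtain ⟨s', t, h1, h2, h3, h4, h5⟩ := h
  obtain ⟨s'', t', h1', h2', h3', h4', h5'⟩ := h' s' h5 h3 h4
  refine ⟨s'', t + t', fun s₃ t₃ he => ?_, by omega, h3', h4.trans h4', h5'⟩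
  rw [add_assoc]
  exact h1 _ _ (h1' _ _ he)

theorem LoopReach.step (hs : Bdd M.bd s) (hd : b.maxDeg ≤ 12) (hb : b.Holds M.thr s)
    (hp : Runs M p s T Q) : LoopReach M b p s (b.time + 1 + T) Q := by
  obtain ⟨s', t, h1, h2, h3, h4⟩ := hp
  exact ⟨s', b.time + 1 + t, fun s'' t' he =>
    .loopStep (b.fits_of_maxDeg M.two_le hs M.pow_le hd) hb h1 he, by omega, h3, h1.agree, h4⟩

theorem LoopReach.runs (h : LoopReach M b p s T Q) (hd : b.maxDeg ≤ 12)
    (hb : ∀ s', Q s' → ¬ b.Holds M.thr s') : Runs M (.loop b p) s (T + b.time + 1) Q := by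
  obtain ⟨s', t, h1, h2, h3, h4, h5⟩ := h
  exact ⟨s', _, h1 _ _ (.loopStop (b.fits_of_maxDeg M.two_le h3 M.pow_le hd) (hb _ h5)), by omega,
    h3, h5⟩

end LoopReach

/-! ### Rough and flat blocks. -/

namespace Grid

/-- The difference of the triples at the lower left cell of a block. -/
def diff (I : Grid) (x y k : ℕ) : ℤ := I.F k x - I.G k y

/-- A block that is not of half-plane type: it may contain free cells, and two forms matter. -/
def Rough (I : Grid) (x y l : ℕ) : Prop :=
  (∀ k < 3, |I.diff x y k| ≤ I.D + 2 * (l - 1)) ∧ ∃ k₁ k₂, k₁ < k₂ ∧ k₂ < 3 ∧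
    I.D < |I.diff x y k₁| + 2 * (l - 1) ∧ I.D < |I.diff x y k₂| + 2 * (l - 1)

/-- In a block of half-plane type only the form `kk` matters. -/
def Flat (I : Grid) (x y l kk : ℕ) : Prop :=
  I.D + 2 * (l - 1) < |I.diff x y kk| ∨ ∀ k < 3, k ≠ kk → |I.diff x y k| + 2 * (l - 1) ≤ I.D

theorem SlowOn.abs_sub_le {f : ℕ → ℤ} {N x i : ℕ} (h : SlowOn f N) (hx : x + i < N) :
    |f (x + i) - f x| ≤ i := by
  induction i with
  | zero => simp
  | succ i ih =>
    have h1 := ih (by omega)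
    have h2 := h (x + i) (by omega)
    rw [abs_le] at *
    rw [← add_assoc]
    push_cast
    omega

variable {I : Grid} {x y l kk a b : ℕ} {V : ℤ}

/-- If the form `kk` blocks the whole block, its differences keep their sign, and the signed
inequality fails everywhere too. Otherwise the remaining forms are satisfied throughout, and only
`kk` has to be tested; with the sign `σ` taken at the lower left cell, only its upper bound can
fail. -/
theorem Flat.free_iff (hI : I.Fine V) (h : I.Flat x y l kk) (hkk : kk < 3) (ha : a ≤ l) (hb : b ≤ l)
    (hxa : x + a ≤ I.n) (hyb : y + b ≤ I.m) {σ : ℤ}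
    (hσ : 0 ≤ I.diff x y kk ∧ σ = 1 ∨ I.diff x y kk < 0 ∧ σ = -1) :
    ∀ i < a, ∀ j < b, I.free (x + i) (y + j) ↔
      σ * I.F kk (x + i) ≤ σ * I.G kk (y + j) + I.D := by
  intro i hi j hj
  have hdiff : ∀ k < 3, |I.F k (x + i) - I.G k (y + j) - I.diff x y k| ≤ 2 * (l - 1) := by
    intro k hk
    have h1 := SlowOn.abs_sub_le (hI.slowF k hk) (show x + i < I.n by omega)
    have h2 := SlowOn.abs_sub_le (hI.slowG k hk) (show y + j < I.m by omega)
    rw [diff]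
    rw [abs_le] at *
    omega
  have hd := hdiff kk hkk
  rcases h with h | h
  · refine iff_of_false (fun hf => ?_) ?_
    · have := hf kk hkk
      rw [abs_le] at *
      rcases lt_abs.1 h with h | h <;> omega
    · rw [abs_le] at hd
      rcases hσ with ⟨h1, rfl⟩ | ⟨h1, rfl⟩
      · rw [abs_of_nonneg h1] at h; omega
      · rw [abs_of_neg h1] at h; omega
  · have hw : (2 : ℤ) * (l - 1) ≤ I.D := by
      obtain ⟨k, hk, hne⟩ : ∃ k < 3, k ≠ kk := by
        by_cases h0 : kk = 0
        · exact ⟨1, by omega, by omega⟩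
        · exact ⟨0, by omega, by omega⟩
      have := h k hk hne
      have := abs_nonneg (I.diff x y k)
      omega
    constructor
    · intro hf
      have := abs_le.1 (hf kk hkk)
      rcases hσ with ⟨h1, rfl⟩ | ⟨h1, rfl⟩ <;> omega
    · intro hf k hk
      by_cases hne : k = kk
      · subst hne
        rw [abs_le] at *
        rcases hσ with ⟨h1, rfl⟩ | ⟨h1, rfl⟩ <;> omega
      · have h1 := hdiff k hk
        have h2 := h k hk hne
        rw [abs_le] at *
        rcases abs_cases (I.diff x y k) with h3 | h3 <;> omega

end Grid

/-! ### One round of the block stack: programs and the classification of a block. -/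

namespace Tree

/-- Take a block from the stack. -/
def pop : Program :=
  3 ⟵ .var 3 - 1 ⨟ 5 ⟵ .read 7 (.var 3) ⨟ 6 ⟵ .read 8 (.var 3) ⨟ 7 ⟵ .read 9 (.var 3)

/-- Find out which of the three forms matter in the block. -/
def classify : Program :=
  (8 ⟵ 0 ⨟ 9 ⟵ 0 ⨟ 10 ⟵ 0) ⨟ forTo 3 (
    11 ⟵ .read 4 (3 * .var 5 + .var 15) - .read 5 (3 * .var 6 + .var 15) ⨟
    28 ⟵ 0 - .var 11 ⨟ setMax 28 (.var 11) ⨟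
    .cond (.lt (.var 4 + 2 * (.var 7 - 1)) (.var 28)) (10 ⟵ 1 ⨟ 8 ⟵ .var 15)
      (.cond (.and (.eq (.var 10) 0) (.lt (.var 4) (.var 28 + 2 * (.var 7 - 1))))
        (9 ⟵ .var 9 + 1 ⨟ 8 ⟵ .var 15) .skip))

/-- Prepare the treatment of a block of half-plane type. -/
def prepare : Program :=
  .cond (.le (.read 5 (3 * .var 6 + .var 8)) (.read 4 (3 * .var 5 + .var 8)))
    (12 ⟵ 1) (12 ⟵ 0 - 1) ⨟
  13 ⟵ .var 0 - .var 5 ⨟ setMin 13 (.var 7) ⨟ 14 ⟵ .var 1 - .var 6 ⨟ setMin 14 (.var 7)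

/-- Put the four parts of a block on the stack. -/
def push : Program :=
  7 ⟵ .var 7 / 2 ⨟
  .write 7 (.var 3) (.var 5 + .var 7) ⨟ .write 8 (.var 3) (.var 6 + .var 7) ⨟
  .write 9 (.var 3) (.var 7) ⨟
  .write 7 (.var 3 + 1) (.var 5 + .var 7) ⨟ .write 8 (.var 3 + 1) (.var 6) ⨟
  .write 9 (.var 3 + 1) (.var 7) ⨟
  .write 7 (.var 3 + 2) (.var 5) ⨟ .write 8 (.var 3 + 2) (.var 6 + .var 7) ⨟
  .write 9 (.var 3 + 2) (.var 7) ⨟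
  .write 7 (.var 3 + 3) (.var 5) ⨟ .write 8 (.var 3 + 3) (.var 6) ⨟
  .write 9 (.var 3 + 3) (.var 7) ⨟
  3 ⟵ .var 3 + 4

/-- Treat the block on top of the stack. -/
def body : Program :=
  pop ⨟ .cond (.and (.lt (.var 5) (.var 0)) (.lt (.var 6) (.var 1)))
    (classify ⨟ .cond (.or (.eq (.var 10) 1) (.le (.var 9) 1)) (prepare ⨟ Leaf.leaf) push) .skip

variable {M : Machine} {s : State} {I : Grid} {x y l t : ℕ}

/-- Variable `10` records that some form blocks the whole block, variable `9` counts the undecided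
forms seen before that, and variable `8` remembers the decisive form. If no form matters, it keeps
the value `0`, and any form would do. -/
theorem classify_runs (hI : I.Fine M.bd) (hs : Bdd M.bd s) (hL : I.Loaded s) (h5 : s.var 5 = x)
    (h6 : s.var 6 = y) (h7 : s.var 7 = l) (hx : x < I.n) (hy : y < I.m) (hV : 4 ≤ M.bd) :
    Runs M classify s 1000 (fun s' => ∃ kk : ℕ, kk < 3 ∧ s'.var 8 = kk ∧
      ((I.Rough x y l ∧ s'.var 10 = 0 ∧ 2 ≤ s'.var 9) ∨
      (¬ I.Rough x y l ∧ I.Flat x y l kk ∧ (s'.var 10 = 1 ∨ s'.var 9 ≤ 1)))) := by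
  refine Runs.mono (T := 10 + 100 * (3 + 2)) (Q := fun s' => ∃ kk : ℕ, kk < 3 ∧ s'.var 8 = kk ∧
      0 ≤ s'.var 9 ∧ s'.var 9 ≤ (3 : ℕ) ∧
      ((s'.var 10 = 1 ∧ I.D + 2 * (l - 1) < |I.diff x y kk|) ∨
      (s'.var 10 = 0 ∧ (∀ k < 3, |I.diff x y k| ≤ I.D + 2 * (l - 1)) ∧
        ((s'.var 9 = 0 ∧ ∀ k < 3, |I.diff x y k| + 2 * (l - 1) ≤ I.D) ∨
        (s'.var 9 = 1 ∧ kk < 3 ∧ I.D < |I.diff x y kk| + 2 * (l - 1) ∧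
          ∀ k < 3, k ≠ kk → |I.diff x y k| + 2 * (l - 1) ≤ I.D) ∨
        (2 ≤ s'.var 9 ∧ ∃ k₁ k₂, k₁ < k₂ ∧ k₂ < 3 ∧
          I.D < |I.diff x y k₁| + 2 * (l - 1) ∧ I.D < |I.diff x y k₂| + 2 * (l - 1)))))) ?_
    (by norm_num) ?_
  · refine Runs.seq (Runs.of_wp_le (Q := fun s' => s'.var 8 = 0 ∧ s'.var 9 = 0 ∧ s'.var 10 = 0) hs
      (by decide) (by decide) (by simp; omega)) ?_
    rintro s₁ ⟨k8, k9, k10⟩ hs₁ hag₁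
    refine counter_loop (fun K s' => ∃ kk : ℕ, kk < 3 ∧ s'.var 8 = kk ∧
      0 ≤ s'.var 9 ∧ s'.var 9 ≤ K ∧
      ((s'.var 10 = 1 ∧ I.D + 2 * (l - 1) < |I.diff x y kk|) ∨
      (s'.var 10 = 0 ∧ (∀ k < K, |I.diff x y k| ≤ I.D + 2 * (l - 1)) ∧
        ((s'.var 9 = 0 ∧ ∀ k < K, |I.diff x y k| + 2 * (l - 1) ≤ I.D) ∨
        (s'.var 9 = 1 ∧ kk < K ∧ I.D < |I.diff x y kk| + 2 * (l - 1) ∧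
          ∀ k < K, k ≠ kk → |I.diff x y k| + 2 * (l - 1) ≤ I.D) ∨
        (2 ≤ s'.var 9 ∧ ∃ k₁ k₂, k₁ < k₂ ∧ k₂ < K ∧
          I.D < |I.diff x y k₁| + 2 * (l - 1) ∧ I.D < |I.diff x y k₂| + 2 * (l - 1)))))) 3 80 100
      hs₁ (by omega) (by decide) (by decide) (by decide) (by decide) (by decide) (fun _ _ => rfl)
      ?_ ?_
    · exact ⟨0, by norm_num, by simp [k8], by simp [k9], by simp [k9], .inr ⟨by simp [k10],
        fun k hk => by omega, .inl ⟨by simp [k9], fun k hk => by omega⟩⟩⟩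
    · rintro k s₂ hk k15 ⟨kk, hkk, h8, h9, h9', hinv⟩ hs₂ hag
      have e5 : s₂.var 5 = x := (hag.1 5 (by decide)).trans ((hag₁.1 5 (by decide)).trans h5)
      have e6 : s₂.var 6 = y := (hag.1 6 (by decide)).trans ((hag₁.1 6 (by decide)).trans h6)
      have e7 : s₂.var 7 = l := (hag.1 7 (by decide)).trans ((hag₁.1 7 (by decide)).trans h7)
      have e4 : s₂.var 4 = I.D := (hag.1 4 (by decide)).trans ((hag₁.1 4 (by decide)).trans hL.D)
      have a4 : s₂.arr 4 (3 * x + k) = I.F k x := by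
        rw [show s₂.arr 4 = s.arr 4 from (hag.2 4 (by decide)).trans (hag₁.2 4 (by decide))]
        exact hL.F k hk x hx
      have a5 : s₂.arr 5 (3 * y + k) = I.G k y := by
        rw [show s₂.arr 5 = s.arr 5 from (hag.2 5 (by decide)).trans (hag₁.2 5 (by decide))]
        exact hL.G k hk y hy
      have hdk := abs_lt.1 (hI.bddDiff k hk x hx y hy)
      change -M.bd < I.diff x y k ∧ I.diff x y k < M.bd at hdk
      have hmax : max (-I.diff x y k) (I.diff x y k) = |I.diff x y k| := by
        rw [max_comm]; rfl
      have hd' : I.F k x - I.G k y = I.diff x y k := rfl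
      simp only [wp_seq, wp_assign, wp_setMax, wp_cond, wp_skip, RExpr.eval_read, RExpr.eval_var,
        RExpr.eval_mul, RExpr.eval_add, RExpr.eval_sub, RExpr.eval_one, RExpr.eval_zero,
        RExpr.eval_two, RExpr.eval_three, Test.holds_lt, Test.holds_and, Test.holds_eq,
        State.setVar_var, reduceIte, Nat.reduceEqDiff, k15, e4, e5, e6, e7, a4, a5,
        hd', zero_sub, hmax]
      refine ⟨by omega, by omega, by omega, fun hc => ⟨by omega, by omega, ?_⟩,
        fun hc => ⟨fun hc2 => ⟨by omega, by omega, ?_⟩, fun hc2 => ?_⟩⟩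
      · exact ⟨k, hk, rfl, h9, by push_cast; omega, .inl ⟨trivial, hc⟩⟩
      · obtain ⟨h10, hact⟩ := hc2
        refine ⟨k, hk, rfl, by omega, by push_cast; omega, .inr ⟨h10, ?_, ?_⟩⟩
        · obtain ⟨h10', -⟩ | ⟨-, hub, -⟩ := hinv
          · omega
          · intro k' hk'
            by_cases he : k' = k
            · subst he; omega
            · exact hub k' (by omega)
        · obtain ⟨h10', -⟩ | ⟨-, -, hi | hi | hi⟩ := hinv
          · omega
          · exact .inr (.inl ⟨by omega, by omega, hact, fun k' hk' hne => hi.2 k' (by omega)⟩)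
          · exact .inr (.inr ⟨by omega, kk, k, hi.2.1, by omega, hi.2.2.1, hact⟩)
          · obtain ⟨hi1, k₁, k₂, hi2, hi3, hi4⟩ := hi
            exact .inr (.inr ⟨by omega, k₁, k₂, hi2, by omega, hi4⟩)
      · refine ⟨kk, hkk, h8, h9, by push_cast; omega, ?_⟩
        rcases hinv with hinv | ⟨h10, hub, hi⟩
        · exact .inl hinv
        · have hina : |I.diff x y k| + 2 * (l - 1) ≤ I.D := by
            by_contra hcon
            exact hc2 ⟨h10, by omega⟩
          have ext : ∀ {P : ℕ → Prop}, (∀ k' < k, P k') → P k → ∀ k' < k + 1, P k' := by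
            intro P h1 h2 k' hk'
            by_cases he : k' = k
            · subst he; exact h2
            · exact h1 k' (by omega)
          refine .inr ⟨h10, ext hub (by omega), ?_⟩
          rcases hi with hi | hi | ⟨hi1, k₁, k₂, hi2, hi3, hi4⟩
          · exact .inl ⟨hi.1, ext hi.2 hina⟩
          · exact .inr (.inl ⟨hi.1, by omega, hi.2.2.1, ext hi.2.2.2 fun _ => hina⟩)
          · exact .inr (.inr ⟨hi1, k₁, k₂, hi2, by omega, hi4⟩)
  · rintro s' ⟨kk, hkk, h8, -, -, h⟩
    refine ⟨kk, hkk, h8, ?_⟩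
    rcases h with ⟨h10, h⟩ | ⟨h10, hub, ⟨h9, h⟩ | ⟨h9, -, hact, h⟩ | ⟨h9, h⟩⟩
    · exact .inr ⟨fun hR => by have := hR.1 kk hkk; omega, .inl h, .inl h10⟩
    · refine .inr ⟨?_, .inr fun k hk _ => h k hk, .inr (by omega)⟩
      rintro ⟨-, k₁, k₂, h1, h2, h3, h4⟩
      have := h k₁ (by omega)
      omega
    · refine .inr ⟨?_, .inr h, .inr (by omega)⟩
      rintro ⟨-, k₁, k₂, h1, h2, h3, h4⟩
      by_cases he : k₁ = kk
      · have := h k₂ h2 (by omega)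
        omega
      · have := h k₁ (by omega) he
        omega
    · exact .inl ⟨⟨hub, h⟩, h10, h9⟩

end Tree

/-! ### The three outcomes of a round: skip, split, solve. -/

namespace Tree

/-- The entry `i` of the stack is the block at `(x, y)` of size `l`. -/
def At (s : State) (i x y l : ℕ) : Prop := s.arr 7 i = x ∧ s.arr 8 i = y ∧ s.arr 9 i = l

/-- The entries of the stack below `t` are the same. -/
def Below (t : ℕ) (s s' : State) : Prop := ∀ i : ℕ, i < t →
  s'.arr 7 i = s.arr 7 i ∧ s'.arr 8 i = s.arr 8 i ∧ s'.arr 9 i = s.arr 9 i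

theorem Below.trans {t t' : ℕ} {s s' s'' : State} (h : Below t s s') (h' : Below t' s' s'')
    (ht : t ≤ t') : Below t s s'' := fun i hi => by
  obtain ⟨h1, h2, h3⟩ := h i hi
  obtain ⟨h4, h5, h6⟩ := h' i (by omega)
  exact ⟨h4.trans h1, h5.trans h2, h6.trans h3⟩

theorem Below.of_eq {t : ℕ} {s s' : State} (h7 : s'.arr 7 = s.arr 7) (h8 : s'.arr 8 = s.arr 8)
    (h9 : s'.arr 9 = s.arr 9) : Below t s s' := fun i _ => by simp [h7, h8, h9]

theorem At.below {t i x y l : ℕ} {s s' : State} (h : At s i x y l) (hb : Below t s s') (hi : i < t) :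
    At s' i x y l := by
  obtain ⟨h1, h2, h3⟩ := hb i hi
  exact ⟨h1.trans h.1, h2.trans h.2.1, h3.trans h.2.2⟩

variable {M : Machine} {s : State} {I : Grid} {x y l t : ℕ}

theorem pop_runs (hs : Bdd M.bd s) (h3 : s.var 3 = t + 1) (hat : At s t x y l) :
    Runs M pop s 20 (fun s' => s'.var 3 = t ∧ s'.var 5 = x ∧ s'.var 6 = y ∧ s'.var 7 = l) := by
  refine Runs.of_wp_le hs (by decide) (by decide) ?_
  obtain ⟨h7, h8, h9⟩ := hat
  have hV := M.two_le
  have b3 := hs.1 3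
  have b7 := hs.2 7 t
  have b8 := hs.2 8 t
  have b9 := hs.2 9 t
  simp only [pop, wp_seq, wp_assign, RExpr.eval_read, RExpr.eval_var, RExpr.eval_sub,
    RExpr.eval_one, State.setVar_var, State.setVar_arr, reduceIte, Nat.reduceEqDiff, h3,
    add_sub_cancel_right, h7, h8, h9]
  exact ⟨by omega, by omega, by omega, by omega, trivial, trivial, trivial, trivial⟩

theorem body_skip (hs : Bdd M.bd s) (hL : I.Loaded s) (h3 : s.var 3 = t + 1) (hat : At s t x y l)
    (hxy : ¬ (x < I.n ∧ y < I.m)) :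
    Runs M body s 50 (fun s' => s'.var 3 = t ∧ I.Mono s s' ∧ Below t s s') := by
  refine Runs.seq (T := 20) (T' := 30) (pop_runs hs h3 hat) ?_
  rintro s₁ ⟨k3, k5, k6, k7⟩ hs₁ hag₁
  have hL₁ := hL.agree hag₁ (by decide)
  refine (Runs.cond (T := 10) (Q := fun s' => s' = s₁) hs₁ (by decide) (fun h => ?_) fun _ =>
    Runs.of_wp_le hs₁ (by decide) (by decide) (by simp)).mono (by decide) ?_
  · simp only [Test.holds_and, Test.holds_lt, RExpr.eval_var, k5, k6, hL₁.n, hL₁.m] at h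
    exact absurd ⟨by exact_mod_cast h.1, by exact_mod_cast h.2⟩ hxy
  · rintro _ rfl
    exact ⟨k3, Grid.Mono.of_eq (hag₁.2 6 (by decide)), Below.of_eq (hag₁.2 7 (by decide))
      (hag₁.2 8 (by decide)) (hag₁.2 9 (by decide))⟩

/-- The lower left part ends on top of the stack and the upper right part lowest, so each part is
treated after those it depends on. -/
theorem push_runs {h : ℕ} (hs : Bdd M.bd s) (h3 : s.var 3 = t) (h5 : s.var 5 = x) (h6 : s.var 6 = y)
    (h7 : s.var 7 = (2 * h : ℕ)) (hx : (x : ℤ) + h ≤ M.bd) (hy : (y : ℤ) + h ≤ M.bd)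
    (ht : (t : ℤ) + 4 ≤ M.bd) :
    Runs M push s 200 (fun s' => s'.var 3 = ((t + 3 : ℕ) : ℤ) + 1 ∧ Below t s s' ∧
      At s' t (x + h) (y + h) h ∧ At s' (t + 1) (x + h) y h ∧ At s' (t + 2) x (y + h) h ∧
      At s' (t + 3) x y h) := by
  refine Runs.of_wp_le hs (by decide) (by decide) ?_
  have hV := M.two_le
  have e7 : ((2 * h : ℕ) : ℤ) / 2 = h := by omega
  have e4 : ∀ s, (4 : RExpr).eval s = 4 := fun _ => rfl
  simp only [push, wp_seq, wp_assign, wp_write, RExpr.eval_var, RExpr.eval_add, RExpr.eval_div,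
    RExpr.eval_one, RExpr.eval_two, RExpr.eval_three, e4, State.setVar_var,
    State.setArr_var, reduceIte, Nat.reduceEqDiff, h3, h5, h6, h7, e7]
  refine ⟨by omega, by omega, by omega, by omega, by omega, by omega, by omega, by omega, by omega,
    by omega, by omega, by omega, by omega, by omega, ?_, ?_⟩
  · push_cast; ring
  · have hne : ∀ i : ℕ, i < t → (i : ℤ) ≠ t ∧ (i : ℤ) ≠ t + 1 ∧ (i : ℤ) ≠ t + 2 ∧ (i : ℤ) ≠ t + 3 :=
      fun i hi => by omega
    refine ⟨fun i hi => ?_, ?_, ?_, ?_, ?_⟩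
    · obtain ⟨h1, h2, h3, h4⟩ := hne i hi
      simp [h1, h2, h3, h4]
    all_goals
      simp only [At, State.setVar_arr, State.setArr_arr_apply, reduceIte, Nat.reduceEqDiff,
        Nat.cast_add, Nat.cast_one, Nat.cast_ofNat, Function.update_apply]
      simp

theorem body_split {h : ℕ} (hI : I.Fine M.bd) (hs : Bdd M.bd s) (hL : I.Loaded s) (hV : 4 ≤ M.bd)
    (h3 : s.var 3 = t + 1) (hat : At s t x y (2 * h)) (hxn : x < I.n) (hym : y < I.m)
    (hx : (x : ℤ) + h ≤ M.bd) (hy : (y : ℤ) + h ≤ M.bd) (ht : (t : ℤ) + 4 ≤ M.bd)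
    (hR : I.Rough x y (2 * h)) :
    Runs M body s 1300 (fun s' => s'.var 3 = ((t + 3 : ℕ) : ℤ) + 1 ∧ I.Mono s s' ∧ Below t s s' ∧
      At s' t (x + h) (y + h) h ∧ At s' (t + 1) (x + h) y h ∧ At s' (t + 2) x (y + h) h ∧
      At s' (t + 3) x y h) := by
  refine Runs.seq (T := 20) (T' := 1280) (pop_runs hs h3 hat) ?_
  rintro s₁ ⟨k3, k5, k6, k7⟩ hs₁ hag₁
  have hL₁ := hL.agree hag₁ (by decide)
  refine (Runs.cond (T := 1260) (Q := fun s' => s'.var 3 = ((t + 3 : ℕ) : ℤ) + 1 ∧ I.Mono s₁ s' ∧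
      Below t s₁ s' ∧ At s' t (x + h) (y + h) h ∧ At s' (t + 1) (x + h) y h ∧
      At s' (t + 2) x (y + h) h ∧ At s' (t + 3) x y h) hs₁ (by decide) (fun _ => ?_)
      fun hn => absurd ?_ hn).mono (by decide) ?_
  · refine Runs.seq (T := 1000) (T' := 260) (classify_runs hI hs₁ hL₁ k5 k6 k7 hxn hym hV) ?_
    rintro s₂ ⟨kk, hkk, k8, hcase⟩ hs₂ hag₂
    rcases hcase with ⟨-, k10, k9⟩ | ⟨hnR, -⟩
    · refine (Runs.cond (T := 200) (Q := fun s' => s'.var 3 = ((t + 3 : ℕ) : ℤ) + 1 ∧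
        I.Mono s₂ s' ∧ Below t s₂ s' ∧ At s' t (x + h) (y + h) h ∧ At s' (t + 1) (x + h) y h ∧
        At s' (t + 2) x (y + h) h ∧ At s' (t + 3) x y h) hs₂ (by decide) (fun hn => absurd hn ?_)
        (fun _ => ?_)).mono (by decide) ?_
      · simp [k10]; omega
      · refine (push_runs hs₂ ((hag₂.1 3 (by decide)).trans k3) ((hag₂.1 5 (by decide)).trans k5)
          ((hag₂.1 6 (by decide)).trans k6) ((hag₂.1 7 (by decide)).trans k7) hx hy ht).agree.mono
          le_rfl ?_
        rintro s₃ ⟨⟨h1, h2⟩, -, hag₃⟩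
        exact ⟨h1, Grid.Mono.of_eq (hag₃.2 6 (by decide)), h2⟩
      · rintro s₃ ⟨h1, h2, h3, h4⟩
        exact ⟨h1, (Grid.Mono.of_eq (hag₂.2 6 (by decide))).trans h2,
          (Below.of_eq (hag₂.2 7 (by decide)) (hag₂.2 8 (by decide)) (hag₂.2 9 (by decide))).trans h3
            le_rfl, h4⟩
    · exact absurd hR hnR
  · simp [k5, k6, hL₁.n, hL₁.m, hxn, hym]
  · rintro s₃ ⟨h1, h2, h3, h4⟩
    exact ⟨h1, (Grid.Mono.of_eq (hag₁.2 6 (by decide))).trans h2,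
      (Below.of_eq (hag₁.2 7 (by decide)) (hag₁.2 8 (by decide)) (hag₁.2 9 (by decide))).trans h3
        le_rfl, h4⟩

/-- The table is correct just before a block. -/
def Ready (I : Grid) (s : State) (x y l : ℕ) : Prop := x < I.n → y < I.m →
  (∀ p, x ≤ p → p ≤ x + l → p ≤ I.n → I.Ok s p y) ∧
    ∀ q, y ≤ q → q ≤ y + l → q ≤ I.m → I.Ok s x q

/-- The table is correct in the last column and in the last row of a block. -/
def Done (I : Grid) (s : State) (x y l : ℕ) : Prop := x < I.n → y < I.m →
  (∀ p, x < p → p ≤ x + l → p ≤ I.n → I.Ok s p (min (y + l) I.m)) ∧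
    ∀ q, y < q → q ≤ y + l → q ≤ I.m → I.Ok s (min (x + l) I.n) q

theorem prepare_runs (hI : I.Fine M.bd) (hs : Bdd M.bd s) (hL : I.Loaded s) (h5 : s.var 5 = x)
    (h6 : s.var 6 = y) (h7 : s.var 7 = l) {kk : ℕ} (h8 : s.var 8 = kk) (hkk : kk < 3)
    (hx : x < I.n) (hy : y < I.m) :
    Runs M prepare s 100 (fun s' => ∃ σ, s'.var 12 = σ ∧
      (0 ≤ I.diff x y kk ∧ σ = 1 ∨ I.diff x y kk < 0 ∧ σ = -1) ∧
      s'.var 13 = (min (I.n - x) l : ℕ) ∧ s'.var 14 = (min (I.m - y) l : ℕ)) := by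
  refine Runs.of_wp_le hs (by decide) (by decide) ?_
  have hV := M.two_le
  have hsz := hI.size
  have b7 := hs.1 7
  have a4 := hL.F kk hkk x hx
  have a5 := hL.G kk hkk y hy
  simp only [prepare, wp_seq, wp_assign, wp_setMin, wp_cond, RExpr.eval_read, RExpr.eval_var,
    RExpr.eval_add, RExpr.eval_sub, RExpr.eval_mul, RExpr.eval_one, RExpr.eval_zero,
    RExpr.eval_three, State.setVar_var, reduceIte, Nat.reduceEqDiff, h5, h6, h7, h8, hL.n,
    hL.m, Test.holds_le, a4, a5]
  have e13 : min ((I.n : ℤ) - x) l = (min (I.n - x) l : ℕ) := by omega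
  have e14 : min ((I.m : ℤ) - y) l = (min (I.m - y) l : ℕ) := by omega
  rw [e13, e14]
  refine ⟨fun h => ⟨by omega, by omega, by omega, by omega, by omega, _, rfl, ?_, rfl, rfl⟩,
    fun h => ⟨by omega, by omega, by omega, by omega, by omega, _, rfl, ?_, rfl, rfl⟩⟩
  · exact .inl ⟨by rw [Grid.diff]; omega, rfl⟩
  · exact .inr ⟨by rw [Grid.diff]; omega, rfl⟩

theorem body_leaf (hI : I.Fine M.bd) (hs : Bdd M.bd s) (hL : I.Loaded s) (hV : 4 ≤ M.bd)
    (h3 : s.var 3 = t + 1) (hat : At s t x y l) (hl : 0 < l) (hxn : x < I.n) (hym : y < I.m)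
    (hready : Ready I s x y l) (hR : ¬ I.Rough x y l) :
    Runs M body s (7000 * l) (fun s' => s'.var 3 = t ∧ I.Mono s s' ∧ Below t s s' ∧
      Done I s' x y l) := by
  refine Runs.mono (T := 20 + (1200 * (l + l + 2) + 1200)) (Runs.seq (pop_runs hs h3 hat) ?_)
    (by omega) fun _ => id
  rintro s₁ ⟨k3, k5, k6, k7⟩ hs₁ hag₁
  have hL₁ := hL.agree hag₁ (by decide)
  have hM₁ : I.Mono s s₁ := Grid.Mono.of_eq (hag₁.2 6 (by decide))
  refine (Runs.cond (T := 1200 * (l + l + 2) + 1180) (Q := fun s' => s'.var 3 = t ∧ I.Mono s s' ∧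
      Below t s s' ∧ Done I s' x y l) hs₁ (by decide) (fun _ => ?_)
      fun hn => absurd ?_ hn).mono ?_ fun _ => id
  · refine Runs.mono (T := 1000 + (1200 * (l + l + 2) + 180)) (Runs.seq
      (classify_runs hI hs₁ hL₁ k5 k6 k7 hxn hym hV) ?_) (by omega) fun _ => id
    rintro s₂ ⟨kk, hkk, k8, hcase⟩ hs₂ hag₂
    have hM₂ : I.Mono s s₂ := hM₁.trans (Grid.Mono.of_eq (hag₂.2 6 (by decide)))
    have hL₂ := hL₁.agree hag₂ (by decide)
    rcases hcase with ⟨hR', -⟩ | ⟨-, hflat, hc⟩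
    · exact absurd hR' hR
    have e5 := (hag₂.1 5 (by decide)).trans k5
    have e6 := (hag₂.1 6 (by decide)).trans k6
    have e7 := (hag₂.1 7 (by decide)).trans k7
    refine (Runs.cond (T := 1200 * (l + l + 2) + 160) hs₂ (by decide) (fun _ => ?_)
      fun hn => absurd ?_ hn).mono ?_ fun _ => id
    · refine Runs.mono (T := 100 + 1200 * (l + l + 2)) (Runs.seq (prepare_runs hI hs₂ hL₂ e5 e6 e7 k8 hkk hxn hym) ?_) (by omega)
        fun _ => id
      rintro s₃ ⟨σ, k12, hσ, k13, k14⟩ hs₃ hag₃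
      have hM₃ : I.Mono s s₃ := hM₂.trans (Grid.Mono.of_eq (hag₃.2 6 (by decide)))
      have hL₃ := hL₂.agree hag₃ (by decide)
      obtain ⟨hr1, hr2⟩ := hready hxn hym
      refine (Leaf.leaf_runs hI hs₃ hL₃ ((hag₃.1 5 (by decide)).trans e5)
        ((hag₃.1 6 (by decide)).trans e6) ((hag₃.1 8 (by decide)).trans k8) hkk k12 (by tauto) k13 k14
        (by omega) (by omega) (by omega) (by omega)
        (hflat.free_iff hI hkk (min_le_right _ _) (min_le_right _ _) (by omega) (by omega) hσ)
        (fun i hi => hM₃ _ _ (by omega) (hr1 _ (by omega) (by omega) (by omega)))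
        (fun j hj => hM₃ _ _ (by omega) (hr2 _ (by omega) (by omega) (by omega)))).agree.mono
        (by omega) ?_
      rintro s₄ ⟨⟨hM₄, hd1, hd2⟩, -, hag₄⟩
      refine ⟨?_, hM₃.trans hM₄, ?_, fun _ _ => ⟨fun p h1 h2 h3 => ?_, fun q h1 h2 h3 => ?_⟩⟩
      · exact (hag₄.1 3 (by decide)).trans ((hag₃.1 3 (by decide)).trans
          ((hag₂.1 3 (by decide)).trans k3))
      · exact Below.of_eq
          ((hag₄.2 7 (by decide)).trans ((hag₃.2 7 (by decide)).trans
            ((hag₂.2 7 (by decide)).trans (hag₁.2 7 (by decide)))))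
          ((hag₄.2 8 (by decide)).trans ((hag₃.2 8 (by decide)).trans
            ((hag₂.2 8 (by decide)).trans (hag₁.2 8 (by decide)))))
          ((hag₄.2 9 (by decide)).trans ((hag₃.2 9 (by decide)).trans
            ((hag₂.2 9 (by decide)).trans (hag₁.2 9 (by decide)))))
      · have := hd1 (p - x - 1) (by omega)
        rwa [show x + (p - x - 1) + 1 = p by omega,
          show y + min (I.m - y) l = min (y + l) I.m by omega] at this
      · have := hd2 (q - y - 1) (by omega)
        rwa [show y + (q - y - 1) + 1 = q by omega,
          show x + min (I.n - x) l = min (x + l) I.n by omega] at this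
    · simp only [Test.holds_or, Test.holds_eq, Test.holds_le, RExpr.eval_var, RExpr.eval_one]
      exact hc
    · have : (Test.or (.eq (.var 10) 1) (.le (.var 9) 1)).time ≤ 15 := by decide
      omega
  · simp [k5, k6, hL₁.n, hL₁.m, hxn, hym]
  · have : (Test.and (.lt (.var 5) (.var 0)) (.lt (.var 6) (.var 1))).time ≤ 15 := by decide
    omega

end Tree

/-! ### Correctness and cost of the recursion. -/

namespace Tree

open Classical in
/-- A bound for the time spent in the block at `(x, y)` of size `2 ^ k`. -/
noncomputable def cost (I : Grid) (c : ℕ) : ℕ → ℕ → ℕ → ℕ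
  | 0, _, _ => c
  | k + 1, x, y => if x < I.n ∧ y < I.m ∧ I.Rough x y (2 ^ (k + 1)) then
      c + (cost I c k x y + (cost I c k x (y + 2 ^ k) + (cost I c k (x + 2 ^ k) y +
        cost I c k (x + 2 ^ k) (y + 2 ^ k))))
    else c * 2 ^ (k + 1)

/-- A single cell is decided exactly, so the subdivision stops at side `1`. -/
theorem not_rough_one {I : Grid} {x y : ℕ} : ¬ I.Rough x y 1 := by
  rintro ⟨h, k₁, k₂, h1, h2, h3, -⟩
  have := h k₁ (by omega)
  push_cast at *
  omega

variable {M : Machine} {I : Grid}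

/-- The loop that empties the stack. -/
abbrev loopTest : Test := .le 1 (.var 3)

theorem loop_step {s : State} {t T T' : ℕ} {Q : State → Prop} (hs : Bdd M.bd s)
    (h3 : s.var 3 = t + 1) (h : Runs M body s T Q) (hT : T + 4 ≤ T') :
    LoopReach M loopTest body s T' Q := by
  refine (LoopReach.step hs (by decide) ?_ h).mono ?_ fun _ => id
  · simp [h3]
  · have : loopTest.time = 3 := by decide
    omega

theorem loaded_agree {s s' : State} (h : I.Loaded s) (ha : Agree body s s') : I.Loaded s' :=
  h.agree ha (by decide)

/-- Induction on the level. The iterative loop imitates the recursion because treating a block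
removes it from the stack, leaves the entries below it alone and keeps every correct table entry
correct. A split replaces one entry by four, whence the bound on `t + 3 * k + 1` for the height of
the stack. -/
theorem block_reach (hI : I.Fine M.bd) (hV : 4 ≤ M.bd) (k : ℕ) : ∀ (t x y : ℕ) (s : State),
    Bdd M.bd s → I.Loaded s → s.var 3 = t + 1 → At s t x y (2 ^ k) → (x : ℤ) + 2 ^ k ≤ M.bd →
    (y : ℤ) + 2 ^ k ≤ M.bd → (t : ℤ) + 3 * k + 1 ≤ M.bd → Ready I s x y (2 ^ k) →
    LoopReach M loopTest body s (cost I 8000 k x y) (fun s' => s'.var 3 = t ∧ I.Mono s s' ∧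
      Below t s s' ∧ Done I s' x y (2 ^ k)) := by
  have hflat : ∀ (k t x y : ℕ) (s : State), Bdd M.bd s → I.Loaded s → s.var 3 = t + 1 →
      At s t x y (2 ^ k) → Ready I s x y (2 ^ k) → ¬ (x < I.n ∧ y < I.m ∧ I.Rough x y (2 ^ k)) →
      LoopReach M loopTest body s (8000 * 2 ^ k) (fun s' => s'.var 3 = t ∧ I.Mono s s' ∧
        Below t s s' ∧ Done I s' x y (2 ^ k)) := by
    intro k t x y s hs hL h3 hat hready hn
    have hpos : 0 < 2 ^ k := by positivity
    by_cases hxy : x < I.n ∧ y < I.m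
    · exact loop_step hs h3 (body_leaf hI hs hL hV h3 hat hpos hxy.1 hxy.2 hready
        fun hR => hn ⟨hxy.1, hxy.2, hR⟩) (by omega)
    · refine (loop_step hs h3 (body_skip hs hL h3 hat hxy) (by omega)).mono le_rfl ?_
      rintro s' ⟨h1, h2, h3⟩
      exact ⟨h1, h2, h3, fun hx hy => absurd ⟨hx, hy⟩ hxy⟩
  induction k with
  | zero =>
    intro t x y s hs hL h3 hat _ _ _ hready
    exact hflat 0 t x y s hs hL h3 hat hready fun h => not_rough_one h.2.2
  | succ k ih =>
    intro t x y s hs hL h3 hat hxV hyV htV hready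
    rw [cost]
    split_ifs with hR
    swap
    · exact hflat _ t x y s hs hL h3 hat hready hR
    obtain ⟨hx, hy, hR⟩ := hR
    obtain ⟨h, hh⟩ : ∃ h, h = 2 ^ k := ⟨_, rfl⟩
    have hpos : 0 < h := by rw [hh]; positivity
    have hh' : 2 ^ (k + 1) = 2 * h := by rw [hh, pow_succ]; ring
    have hhz : (2 : ℤ) ^ k = h := by rw [hh]; push_cast; rfl
    have hhz' : (2 : ℤ) ^ (k + 1) = 2 * h := by rw [pow_succ, hhz]; ring
    rw [← hh] at ih ⊢
    rw [hh'] at hat hready hR ⊢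
    rw [hhz'] at hxV hyV
    rw [hhz] at ih
    push_cast at htV
    obtain ⟨hr1, hr2⟩ := hready hx hy
    refine LoopReach.trans (loop_step hs h3 (body_split hI hs hL hV h3 hat hx hy (by omega) (by omega)
      (by omega) hR) (by norm_num)) ?_
    rintro s₀ ⟨k3, hM₀, hB₀, hUR, hUL, hLR, hLL⟩ hs₀ hag₀
    have hL₀ := loaded_agree hL hag₀
    -- The parts are treated in the order lower left, `(x, y + h)`, `(x + h, y)`, upper right. The
    -- entries each one needs come from the boundary of the block or from parts already done.
    refine LoopReach.trans (ih (t + 3) x y s₀ hs₀ hL₀ k3 hLL (by omega) (by omega)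
      (by push_cast; omega) fun _ _ => ⟨fun p h1 h2 h3 => hM₀ _ _ (by omega)
        (hr1 p h1 (by omega) h3), fun q h1 h2 h3 => hM₀ _ _ h3 (hr2 q h1 (by omega) h3)⟩) ?_
    rintro s₁ ⟨j3, hM₁, hB₁, hD₁⟩ hs₁ hag₁
    have hL₁ := loaded_agree hL₀ hag₁
    obtain ⟨d1, d1'⟩ := hD₁ hx hy
    have hM₁' := hM₀.trans hM₁
    refine LoopReach.trans (ih (t + 2) x (y + h) s₁ hs₁ hL₁ (by rw [j3]; push_cast; ring)
      (hLR.below hB₁ (by omega)) (by omega) (by push_cast; omega)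
      (by push_cast; omega) fun _ hyh => ⟨fun p h1 h2 h3 => ?_, fun q h1 h2 h3 => ?_⟩) ?_
    · by_cases hp : p = x
      · subst hp
        exact hM₁' _ _ (by omega) (hr2 _ (by omega) (by omega) (by omega))
      · have := d1 p (by omega) h2 h3
        rwa [min_eq_left (by omega)] at this
    · exact hM₁' _ _ h3 (hr2 q (by omega) (by omega) h3)
    rintro s₂ ⟨i3, hM₂, hB₂, hD₂⟩ hs₂ hag₂
    have hL₂ := loaded_agree hL₁ hag₂
    have hM₂' := hM₁'.trans hM₂
    refine LoopReach.trans (ih (t + 1) (x + h) y s₂ hs₂ hL₂ (by rw [i3]; push_cast; ring)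
      ((hUL.below hB₁ (by omega)).below hB₂ (by omega)) (by push_cast; omega) (by omega)
      (by push_cast; omega) fun hxh _ => ⟨fun p h1 h2 h3 => ?_, fun q h1 h2 h3 => ?_⟩) ?_
    · exact hM₂' _ _ (by omega) (hr1 p (by omega) (by omega) h3)
    · by_cases hq : q = y
      · subst hq
        exact hM₂' _ _ (by omega) (hr1 _ (by omega) (by omega) (by omega))
      · have := d1' q (by omega) h2 h3
        rw [min_eq_left (by omega)] at this
        exact hM₂ _ _ h3 this
    rintro s₃ ⟨l3, hM₃, hB₃, hD₃⟩ hs₃ hag₃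
    have hL₃ := loaded_agree hL₂ hag₃
    have hM₃' := hM₂'.trans hM₃
    refine (ih t (x + h) (y + h) s₃ hs₃ hL₃ (by rw [l3]; push_cast; ring)
      (((hUR.below hB₁ (by omega)).below hB₂ (by omega)).below hB₃ (by omega)) (by push_cast; omega)
      (by omega) (by omega)
      fun hxh hyh => ⟨fun p h1 h2 h3 => ?_, fun q h1 h2 h3 => ?_⟩).mono le_rfl ?_
    -- The corner entry before the upper right part comes from the lower left part; the others come
    -- from the two middle parts.
    · by_cases hp : p = x + h
      · subst hp
        have := d1 (x + h) (by omega) (by omega) h3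
        rw [min_eq_left (by omega)] at this
        exact hM₃ _ _ (by omega) (hM₂ _ _ (by omega) this)
      · have := (hD₃ hxh hy).1 p (by omega) h2 h3
        rwa [min_eq_left (by omega)] at this
    · by_cases hq : q = y + h
      · subst hq
        have := d1' (y + h) (by omega) (by omega) h3
        rw [min_eq_left (by omega)] at this
        exact hM₃ _ _ (by omega) (hM₂ _ _ (by omega) this)
      · have := (hD₂ hx hyh).2 q (by omega) h2 h3
        rw [min_eq_left (by omega)] at this
        exact hM₃ _ _ (by omega) this
    rintro s₄ ⟨m3, hM₄, hB₄, hD₄⟩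
    refine ⟨m3, hM₃'.trans hM₄, ?_, fun _ _ => ⟨fun p h1 h2 h3 => ?_, fun q h1 h2 h3 => ?_⟩⟩
    · exact (((hB₀.trans hB₁ (by omega)).trans hB₂ (by omega)).trans hB₃ (by omega)).trans hB₄ le_rfl
    -- The last column belongs to the parts starting at `y + h`, unless the grid ends before them;
    -- then the parts at `y` already provide it.
    · by_cases hyh : y + h < I.m <;> by_cases hp : p ≤ x + h
      · have := (hD₂ hx hyh).1 p h1 hp h3
        rw [show y + h + h = y + 2 * h by ring] at this
        exact hM₄ _ _ (by omega) (hM₃ _ _ (by omega) this)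
      · have := (hD₄ (by omega) hyh).1 p (by omega) (by omega) h3
        rwa [show y + h + h = y + 2 * h by ring] at this
      · have := d1 p h1 hp h3
        rw [show min (y + h) I.m = min (y + 2 * h) I.m by omega] at this
        exact hM₄ _ _ (by omega) (hM₃ _ _ (by omega) (hM₂ _ _ (by omega) this))
      · have := (hD₃ (by omega) hy).1 p (by omega) (by omega) h3
        rw [show min (y + h) I.m = min (y + 2 * h) I.m by omega] at this
        exact hM₄ _ _ (by omega) this
    · by_cases hxh : x + h < I.n <;> by_cases hq : q ≤ y + h
      · have := (hD₃ hxh hy).2 q h1 hq h3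
        rw [show x + h + h = x + 2 * h by ring] at this
        exact hM₄ _ _ (by omega) this
      · have := (hD₄ hxh (by omega)).2 q (by omega) (by omega) h3
        rwa [show x + h + h = x + 2 * h by ring] at this
      · have := d1' q h1 hq h3
        rw [show min (x + h) I.n = min (x + 2 * h) I.n by omega] at this
        exact hM₄ _ _ (by omega) (hM₃ _ _ (by omega) (hM₂ _ _ (by omega) this))
      · have := (hD₂ hx (by omega)).2 q (by omega) (by omega) h3
        rw [show min (x + h) I.n = min (x + 2 * h) I.n by omega] at this
        exact hM₄ _ _ (by omega) (hM₃ _ _ (by omega) this)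

end Tree

/-! ## Counting the rough blocks -/

namespace Tree

section Count

variable (I : Grid)

open Classical in
/-- The indicator of the rough blocks of size `2 ^ j`. -/
noncomputable def rough (j p q : ℕ) : ℕ :=
  if p * 2 ^ j < I.n ∧ q * 2 ^ j < I.m ∧ I.Rough (p * 2 ^ j) (q * 2 ^ j) (2 ^ j) then 1 else 0

/-- The number of the rough blocks of size `2 ^ j` in a block of size `2 ^ (j + d)`. -/
noncomputable def roughSum (j d p q : ℕ) : ℕ :=
  ∑ p' ∈ Finset.Ico (p * 2 ^ d) ((p + 1) * 2 ^ d),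
    ∑ q' ∈ Finset.Ico (q * 2 ^ d) ((q + 1) * 2 ^ d), rough I j p' q'

theorem sum_Ico_double (f : ℕ → ℕ) (d p : ℕ) :
    ∑ i ∈ Finset.Ico (p * 2 ^ (d + 1)) ((p + 1) * 2 ^ (d + 1)), f i =
      ∑ i ∈ Finset.Ico ((2 * p) * 2 ^ d) ((2 * p + 1) * 2 ^ d), f i +
        ∑ i ∈ Finset.Ico ((2 * p + 1) * 2 ^ d) ((2 * p + 1 + 1) * 2 ^ d), f i := by
  rw [Finset.sum_Ico_consecutive _ (by gcongr; omega) (by gcongr; omega)]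
  congr 2 <;> ring

theorem roughSum_succ (j d p q : ℕ) : roughSum I j (d + 1) p q =
    roughSum I j d (2 * p) (2 * q) + (roughSum I j d (2 * p) (2 * q + 1) +
      (roughSum I j d (2 * p + 1) (2 * q) + roughSum I j d (2 * p + 1) (2 * q + 1))) := by
  simp only [roughSum, sum_Ico_double, Finset.sum_add_distrib]
  ring

theorem roughSum_zero (j p q : ℕ) : roughSum I j 0 p q = rough I j p q := by
  simp [roughSum]

/-- Each rough block pays for its own split and for the flat solution of its four parts. With side
`2 ^ (k + 1)` this is `c + 4 * c * 2 ^ k`, within the allowance of `4 * c * 2 ^ (k + 1)` made up of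
the base term and the new summand. -/
theorem cost_le (c k : ℕ) : ∀ p q, cost I c k (p * 2 ^ k) (q * 2 ^ k) ≤
    c * 2 ^ k + 3 * c * ∑ j ∈ Finset.range (k + 1), 2 ^ j * roughSum I j (k - j) p q := by
  induction k with
  | zero => intro p q; simp [cost]
  | succ k ih =>
    intro p q
    rw [cost]
    split_ifs with h
    swap
    · exact Nat.le_add_right _ _
    have e : ∀ p, p * 2 ^ (k + 1) = (2 * p) * 2 ^ k := fun p => by ring
    have e' : ∀ p, (2 * p) * 2 ^ k + 2 ^ k = (2 * p + 1) * 2 ^ k := fun p => by ring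
    have hS : ∑ j ∈ Finset.range (k + 1 + 1), 2 ^ j * roughSum I j (k + 1 - j) p q =
        ∑ j ∈ Finset.range (k + 1), 2 ^ j * roughSum I j (k - j) (2 * p) (2 * q) +
        (∑ j ∈ Finset.range (k + 1), 2 ^ j * roughSum I j (k - j) (2 * p) (2 * q + 1) +
        (∑ j ∈ Finset.range (k + 1), 2 ^ j * roughSum I j (k - j) (2 * p + 1) (2 * q) +
        ∑ j ∈ Finset.range (k + 1), 2 ^ j * roughSum I j (k - j) (2 * p + 1) (2 * q + 1))) +
        2 ^ (k + 1) := by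
      rw [Finset.sum_range_succ, Nat.sub_self, roughSum_zero, rough, if_pos h, mul_one,
        ← Finset.sum_add_distrib, ← Finset.sum_add_distrib, ← Finset.sum_add_distrib]
      congr 1
      refine Finset.sum_congr rfl fun j hj => ?_
      rw [Finset.mem_range] at hj
      rw [show k + 1 - j = (k - j) + 1 by omega, roughSum_succ]
      ring
    rw [hS, e, e, e', e']
    have h1 := ih (2 * p) (2 * q)
    have h2 := ih (2 * p) (2 * q + 1)
    have h3 := ih (2 * p + 1) (2 * q)
    have h4 := ih (2 * p + 1) (2 * q + 1)
    have h5 : c ≤ c * 2 ^ k := Nat.le_mul_of_pos_right _ (by positivity)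
    have h6 : 2 ^ (k + 1) = 2 * 2 ^ k := by ring
    rw [h6]
    nlinarith

variable {I} {V : ℤ}

/-- A long path meets a window of the plane only a few times. -/
theorem rough_row_le (hI : I.Fine V)
    (hinj : ∀ k₁ k₂, k₁ < k₂ → k₂ < 3 → ∀ i < I.m, ∀ j < I.m, I.G k₁ i = I.G k₁ j →
      I.G k₂ i = I.G k₂ j → i = j) (j p N : ℕ) :
    ∑ q ∈ Finset.Ico 0 N, rough I j p q ≤ 1297 * 2 ^ j := by
  classical
  obtain ⟨l, hl⟩ : ∃ l, l = 2 ^ j := ⟨_, rfl⟩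
  have hl0 : 0 < l := by rw [hl]; positivity
  set R := (Finset.Ico 0 N).filter fun q => p * l < I.n ∧ q * l < I.m ∧ I.Rough (p * l) (q * l) l
    with hR
  have hsum : ∑ q ∈ Finset.Ico 0 N, rough I j p q = R.card := by
    simp only [rough, ← hl, hR, Finset.card_filter]
  rw [hsum, ← hl]
  -- At most one block of the row is truncated by the end of `Q`; the others contain `l` vertices
  -- each.
  set R' := R.filter fun q => (q + 1) * l ≤ I.m with hR'
  have hRR' : R.card ≤ R'.card + 1 := by
    have h1 : (R.filter fun q => ¬ (q + 1) * l ≤ I.m).card ≤ 1 := by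
      refine Finset.card_le_one.2 fun q hq q' hq' => ?_
      simp only [hR, Finset.mem_filter, not_le] at hq hq'
      have h1 : q < q' + 1 := lt_of_mul_lt_mul_right (hq.1.2.2.1.trans hq'.2) (Nat.zero_le l)
      have h2 : q' < q + 1 := lt_of_mul_lt_mul_right (hq'.1.2.2.1.trans hq.2) (Nat.zero_le l)
      omega
    have : R'.card + _ = R.card := Finset.card_filter_add_card_filter_not (s := R) (fun q => (q + 1) * l ≤ I.m)
    omega
  -- In a rough block a form that matters starts within `2 (l - 1)` of `D` or `-D`, and it moves by
  -- at most `l - 1` along the columns of the block; this explains the radius `3 * l`.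
  set W : Finset ℤ := Finset.Ioo (I.D - 3 * l) (I.D + 3 * l) ∪ Finset.Ioo (-I.D - 3 * l) (-I.D + 3 * l)
    with hW
  have hWcard : W.card ≤ 12 * l := by
    refine (Finset.card_union_le _ _).trans ?_
    simp only [Int.card_Ioo]
    omega
  have hmem : ∀ q ∈ R', ∃ k₁ k₂, k₁ < k₂ ∧ k₂ < 3 ∧ ∀ r < l,
      I.F k₁ (p * l) - I.G k₁ (q * l + r) ∈ W ∧ I.F k₂ (p * l) - I.G k₂ (q * l + r) ∈ W := by
    intro q hq
    simp only [hR', hR, Finset.mem_filter] at hq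
    obtain ⟨⟨-, hn, hm, hall, k₁, k₂, h1, h2, h3, h4⟩, hfull⟩ := hq
    refine ⟨k₁, k₂, h1, h2, fun r hr => ?_⟩
    have hwin : ∀ k < 3, I.D < |I.diff (p * l) (q * l) k| + 2 * (l - 1) →
        I.F k (p * l) - I.G k (q * l + r) ∈ W := by
      intro k hk hact
      have hub := hall k hk
      have hs := Grid.SlowOn.abs_sub_le (hI.slowG k hk) (x := q * l) (i := r)
        (by rw [add_mul] at hfull; omega)
      rw [Grid.diff] at hact hub
      simp only [hW, Finset.mem_union, Finset.mem_Ioo]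
      rw [abs_le] at hs
      rcases abs_cases (I.F k (p * l) - I.G k (q * l)) with h | h
      · left; omega
      · right; omega
    exact ⟨hwin k₁ (by omega) h3, hwin k₂ h2 h4⟩
  choose! K₁ K₂ hK using hmem
  -- A vertex of `Q` is recovered from the two forms that matter in its block and their values.
  -- Injectivity of `Q` then recovers its index, and so its block and its offset.
  have hcard : (R' ×ˢ Finset.range l).card ≤
      (Finset.range 3 ×ˢ Finset.range 3 ×ˢ W ×ˢ W).card := by
    refine Finset.card_le_card_of_injOn (fun z => (K₁ z.1, K₂ z.1,
      I.F (K₁ z.1) (p * l) - I.G (K₁ z.1) (z.1 * l + z.2),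
      I.F (K₂ z.1) (p * l) - I.G (K₂ z.1) (z.1 * l + z.2))) ?_ ?_
    · rintro ⟨q, r⟩ hz
      simp only [Finset.coe_product, Set.mem_prod, Finset.mem_coe, Finset.mem_range] at hz ⊢
      obtain ⟨h1, h2, h3⟩ := hK q hz.1
      obtain ⟨h4, h5⟩ := h3 r hz.2
      exact ⟨by omega, h2, h4, h5⟩
    · rintro ⟨q, r⟩ hz ⟨q', r'⟩ hz' he
      simp only [Finset.coe_product, Set.mem_prod, Finset.mem_coe, Finset.mem_range] at hz hz'
      simp only [Prod.mk.injEq] at he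
      obtain ⟨e1, e2, e3, e4⟩ := he
      rw [← e1] at e3
      rw [← e2] at e4
      obtain ⟨h1, h2, -⟩ := hK q hz.1
      have hq := (Finset.mem_filter.1 hz.1).2
      have hq' := (Finset.mem_filter.1 hz'.1).2
      rw [add_mul] at hq hq'
      have heq := hinj _ _ h1 h2 (q * l + r) (by omega) (q' * l + r') (by omega) (by omega) (by omega)
      have hqq : q = q' := by
        have h1 : q * l < (q' + 1) * l := by rw [add_mul]; omega
        have h2 : q' * l < (q + 1) * l := by rw [add_mul]; omega
        have h3 := lt_of_mul_lt_mul_right h1 (Nat.zero_le l)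
        have h4 := lt_of_mul_lt_mul_right h2 (Nat.zero_le l)
        omega
      subst hqq
      simp only [Prod.mk.injEq, true_and]
      omega
  simp only [Finset.card_product, Finset.card_range] at hcard
  -- Nine pairs of forms and at most `(12 * l) ^ 2` pairs of values.
  have h1 : R'.card * l ≤ 1296 * l * l := by
    refine hcard.trans ?_
    have := Nat.mul_le_mul hWcard hWcard
    nlinarith
  have h2 := Nat.le_of_mul_le_mul_right h1 hl0
  omega

/-- The minimum is a geometric progression rising to the middle and falling again. Passing from `K`
to `K + 2` doubles the inner terms and adds two end terms of size at most one; the summand `2` on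
the left absorbs them. -/
theorem sum_min_le (K : ℕ) :
    ∑ j ∈ Finset.range (K + 1), min (2 ^ (K - j)) (2 ^ j) + 2 ≤ 4 * 2 ^ (K / 2) := by
  induction K using Nat.twoStepInduction with
  | zero => simp
  | one => decide
  | more K ih _ =>
    rw [Finset.sum_range_succ, Finset.sum_range_succ']
    have h : ∑ j ∈ Finset.range (K + 1), min (2 ^ (K + 2 - (j + 1))) (2 ^ (j + 1)) =
        2 * ∑ j ∈ Finset.range (K + 1), min (2 ^ (K - j)) (2 ^ j) := by
      rw [Finset.mul_sum]
      refine Finset.sum_congr rfl fun j hj => ?_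
      rw [Finset.mem_range] at hj
      rw [show K + 2 - (j + 1) = (K - j) + 1 by omega, pow_succ, pow_succ, Nat.mul_min_mul_right,
        mul_comm]
    have e : (K + 2) / 2 = K / 2 + 1 := by omega
    have h1 : min (2 ^ (K + 2 - 0)) (2 ^ 0) ≤ 1 := min_le_right _ _
    rw [h, e, pow_succ, Nat.sub_self]
    omega

/-- The constant is `1 + 3 * 1297 * 4`: the base term, then the factors of `cost_le`, `rough_row_le`
and `sum_min_le`. -/
theorem cost_le_pow (hI : I.Fine V)
    (hinj : ∀ k₁ k₂, k₁ < k₂ → k₂ < 3 → ∀ i < I.m, ∀ j < I.m, I.G k₁ i = I.G k₁ j →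
      I.G k₂ i = I.G k₂ j → i = j) (c K : ℕ) :
    cost I c K 0 0 ≤ 15565 * c * (2 ^ K * 2 ^ (K / 2)) := by
  have h := cost_le I c K 0 0
  rw [zero_mul] at h
  have hS : ∀ j ∈ Finset.range (K + 1), 2 ^ j * roughSum I j (K - j) 0 0 ≤
      1297 * 2 ^ K * min (2 ^ (K - j)) (2 ^ j) := by
    intro j hj
    rw [Finset.mem_range] at hj
    have h1 : roughSum I j (K - j) 0 0 ≤
        2 ^ (K - j) * (1297 * min (2 ^ (K - j)) (2 ^ j)) := by
      rw [roughSum]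
      refine (Finset.sum_le_card_nsmul _ _ (1297 * min (2 ^ (K - j)) (2 ^ j)) fun p _ => ?_).trans
        (by simp)
      -- Two bounds for a row of blocks: the path argument, useful for small blocks, and the number
      -- of all blocks in the row, useful for large ones.
      rw [← Nat.mul_min_mul_left, zero_mul]
      refine le_min ?_ (rough_row_le hI hinj _ _ _)
      refine (Finset.sum_le_card_nsmul _ _ 1 fun q _ => ?_).trans ?_
      · rw [rough]; split_ifs <;> simp
      · simp only [Nat.card_Ico, smul_eq_mul]
        omega
    have h2 : 2 ^ K = 2 ^ j * 2 ^ (K - j) := by rw [← pow_add]; congr 1; omega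
    calc 2 ^ j * roughSum I j (K - j) 0 0
        ≤ 2 ^ j * (2 ^ (K - j) * (1297 * min (2 ^ (K - j)) (2 ^ j))) := Nat.mul_le_mul_left _ h1
      _ = _ := by rw [h2]; ring
  have h1 := Finset.sum_le_sum hS
  rw [← Finset.mul_sum] at h1
  have h2 := sum_min_le K
  have h3 : ∑ j ∈ Finset.range (K + 1), min (2 ^ (K - j)) (2 ^ j) ≤ 4 * 2 ^ (K / 2) := by omega
  have h4 := h1.trans (Nat.mul_le_mul_left _ h3)
  have h5 : 1 ≤ 2 ^ (K / 2) := Nat.one_le_two_pow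
  have h6 := Nat.mul_le_mul_left (3 * c) h4
  have h7 : c * 2 ^ K ≤ c * 2 ^ K * 2 ^ (K / 2) := Nat.le_mul_of_pos_right _ (by omega)
  calc cost I c K 0 0 ≤ _ := h
    _ ≤ c * 2 ^ K * 2 ^ (K / 2) + 3 * c * (1297 * 2 ^ K * (4 * 2 ^ (K / 2))) := add_le_add h7 h6
    _ = _ := by ring

end Count

end Tree

/-! ## Distances in the tilings -/

namespace RegularTiling

/-- Three integer forms on the lattice; their largest difference is the graph distance. -/
def form : RegularTiling → ℕ → ℤ × ℤ → ℤ
  | square, 0, p => p.1 + p.2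
  | square, 1, p => p.1 - p.2
  | square, _, p => p.1
  | triangular, 0, p => p.1
  | triangular, 1, p => p.2
  | triangular, _, p => p.1 + p.2
  | hexagonal, 0, p => p.1 + p.2 + (p.1 - p.2) / 3
  | hexagonal, 1, p => -p.1 - p.2 + (p.1 - p.2) / 3
  | hexagonal, _, p => -p.1 + p.2 + (p.1 - p.2) / 3

theorem forall_lt_three {P : ℕ → Prop} : (∀ k < 3, P k) ↔ P 0 ∧ P 1 ∧ P 2 := by
  constructor
  · intro h; exact ⟨h 0 (by omega), h 1 (by omega), h 2 (by omega)⟩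
  · rintro ⟨h0, h1, h2⟩ k hk
    interval_cases k <;> assumption

theorem square_adj_iff {u v : square.Vertex} : square.graph.Adj u v ↔
    (u.1.1 - v.1.1) ^ 2 + (u.1.2 - v.1.2) ^ 2 = 1 := by
  have h : square.graph.Adj u v ↔ dist (square.pos u.1) (square.pos v.1) = 1 := Iff.rfl
  rw [h, ← pow_eq_one_iff_of_nonneg dist_nonneg two_ne_zero, Complex.dist_eq, Complex.sq_norm, Complex.normSq_apply]
  simp only [pos, Complex.sub_re, Complex.sub_im]
  rw [← @Int.cast_inj ℝ]
  push_cast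
  ring_nf

/-- The squared Euclidean distance is an integer quadratic form in the lattice coordinates, so
adjacency reduces to finitely many differences. -/
theorem triangular_dist_eq (p q : ℤ × ℤ) :
    dist (triangular.pos p) (triangular.pos q) = 1 ↔
      (p.1 - q.1) ^ 2 + (p.1 - q.1) * (p.2 - q.2) + (p.2 - q.2) ^ 2 = 1 := by
  rw [← pow_eq_one_iff_of_nonneg dist_nonneg two_ne_zero, Complex.dist_eq, Complex.sq_norm, Complex.normSq_apply]
  simp only [pos, Complex.sub_re, Complex.sub_im]
  rw [← @Int.cast_inj ℝ]
  have h3 : Real.sqrt 3 * Real.sqrt 3 = 3 := Real.mul_self_sqrt (by norm_num)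
  have e : ((p.2 : ℝ) * (Real.sqrt 3 / 2) - q.2 * (Real.sqrt 3 / 2)) *
      (p.2 * (Real.sqrt 3 / 2) - q.2 * (Real.sqrt 3 / 2)) = 3 / 4 * (p.2 - q.2) ^ 2 := by
    linear_combination (((p.2 : ℝ) - q.2) ^ 2 / 4) * h3
  rw [e]
  push_cast
  ring_nf

theorem triangular_adj_iff {u v : triangular.Vertex} : triangular.graph.Adj u v ↔
    (u.1.1 - v.1.1) ^ 2 + (u.1.1 - v.1.1) * (u.1.2 - v.1.2) + (u.1.2 - v.1.2) ^ 2 = 1 :=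
  triangular_dist_eq u.1 v.1

theorem hexagonal_adj_iff {u v : hexagonal.Vertex} : hexagonal.graph.Adj u v ↔
    (u.1.1 - v.1.1) ^ 2 + (u.1.1 - v.1.1) * (u.1.2 - v.1.2) + (u.1.2 - v.1.2) ^ 2 = 1 :=
  triangular_dist_eq u.1 v.1

theorem sq_add_sq_eq_one {x y : ℤ} (h : x ^ 2 + y ^ 2 = 1) :
    (x = 1 ∧ y = 0) ∨ (x = -1 ∧ y = 0) ∨ (x = 0 ∧ y = 1) ∨ (x = 0 ∧ y = -1) := by
  have hx : -1 ≤ x ∧ x ≤ 1 := by constructor <;> nlinarith [sq_nonneg y]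
  have hy : -1 ≤ y ∧ y ≤ 1 := by constructor <;> nlinarith [sq_nonneg x]
  obtain ⟨h1, h2⟩ := hx
  obtain ⟨h3, h4⟩ := hy
  interval_cases x <;> interval_cases y <;> simp_all

theorem sq_add_mul_add_sq_eq_one {x y : ℤ} (h : x ^ 2 + x * y + y ^ 2 = 1) :
    (x = 1 ∧ y = 0) ∨ (x = -1 ∧ y = 0) ∨ (x = 0 ∧ y = 1) ∨ (x = 0 ∧ y = -1) ∨
      (x = 1 ∧ y = -1) ∨ (x = -1 ∧ y = 1) := by
  have hx : -1 ≤ x ∧ x ≤ 1 := by constructor <;> nlinarith [sq_nonneg (x + 2 * y)]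
  have hy : -1 ≤ y ∧ y ≤ 1 := by constructor <;> nlinarith [sq_nonneg (2 * x + y)]
  obtain ⟨h1, h2⟩ := hx
  obtain ⟨h3, h4⟩ := hy
  interval_cases x <;> interval_cases y <;> simp_all

variable {T : RegularTiling}

theorem form_adj {u v : T.Vertex} (h : T.graph.Adj u v) :
    ∀ k < 3, |T.form k u.1 - T.form k v.1| ≤ 1 := by
  rw [forall_lt_three]
  obtain ⟨⟨a, b⟩, hu⟩ := u
  obtain ⟨⟨c, d⟩, hv⟩ := v
  cases T
  · have h' := sq_add_sq_eq_one (square_adj_iff.1 h)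
    simp only [form, abs_le] at *
    omega
  · have h' := sq_add_mul_add_sq_eq_one (triangular_adj_iff.1 h)
    simp only [form, abs_le] at *
    omega
  · have h' := sq_add_mul_add_sq_eq_one (hexagonal_adj_iff.1 h)
    have hu' : (a - b) % 3 ≠ 2 := hu
    have hv' : (c - d) % 3 ≠ 2 := hv
    simp only [form, abs_le] at *
    omega

/-- Any two of the forms are independent. In the hexagonal case they leave only a choice between
residues of `a - b` modulo `3`, which is settled because the centres are excluded. -/
theorem form_injective {u v : T.Vertex} {k₁ k₂ : ℕ} (h1 : k₁ < k₂) (h2 : k₂ < 3)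
    (e1 : T.form k₁ u.1 = T.form k₁ v.1) (e2 : T.form k₂ u.1 = T.form k₂ v.1) : u = v := by
  obtain ⟨⟨a, b⟩, hu⟩ := u
  obtain ⟨⟨c, d⟩, hv⟩ := v
  have key : a = c ∧ b = d := by
    obtain ⟨rfl, rfl⟩ | ⟨rfl, rfl⟩ | ⟨rfl, rfl⟩ :
        (k₁ = 0 ∧ k₂ = 1) ∨ (k₁ = 0 ∧ k₂ = 2) ∨ (k₁ = 1 ∧ k₂ = 2) := by omega
    all_goals
      cases T
      · simp only [form] at e1 e2
        omega
      · simp only [form] at e1 e2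
        omega
      · have hu' : (a - b) % 3 ≠ 2 := hu
        have hv' : (c - d) % 3 ≠ 2 := hv
        simp only [form] at e1 e2
        omega
  obtain ⟨rfl, rfl⟩ := key
  rfl

/-- Serves the hexagonal tiling. Its forms place the vertices at points with coordinates of equal
parity and sum `0` or `-1`, and every edge changes all three coordinates by one. From a point of sum
`0` the possible steps raise one coordinate and lower two; one of them brings a point at distance `N
+ 1` nearer to the target. -/
theorem toward_of_sum_nonneg {d0 d1 d2 N : ℤ} (hN : 0 ≤ N)
    (hp : (d0 - d1) % 2 = 0 ∧ (d0 - d2) % 2 = 0) (hs : 0 ≤ d0 + d1 + d2 ∧ d0 + d1 + d2 ≤ 1)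
    (h : |d0| ≤ N + 1 ∧ |d1| ≤ N + 1 ∧ |d2| ≤ N + 1)
    (h' : ¬ (|d0| ≤ N ∧ |d1| ≤ N ∧ |d2| ≤ N)) :
    (|d0 + 1| ≤ N ∧ |d1 - 1| ≤ N ∧ |d2 - 1| ≤ N) ∨
      (|d0 - 1| ≤ N ∧ |d1 + 1| ≤ N ∧ |d2 - 1| ≤ N) ∨
      (|d0 - 1| ≤ N ∧ |d1 - 1| ≤ N ∧ |d2 + 1| ≤ N) := by
  simp only [abs_le] at *
  have key : (d0 ≤ N - 1 ∧ -N + 1 ≤ d1 ∧ -N + 1 ≤ d2) ∨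
      (d1 ≤ N - 1 ∧ -N + 1 ≤ d0 ∧ -N + 1 ≤ d2) ∨
      (d2 ≤ N - 1 ∧ -N + 1 ≤ d0 ∧ -N + 1 ≤ d1) := by
    by_cases a0 : d0 ≤ N - 1 <;> by_cases a1 : d1 ≤ N - 1 <;> by_cases a2 : d2 ≤ N - 1 <;> omega
  omega

theorem toward_of_sum_nonpos {d0 d1 d2 N : ℤ} (hN : 0 ≤ N)
    (hp : (d0 - d1) % 2 = 0 ∧ (d0 - d2) % 2 = 0) (hs : -1 ≤ d0 + d1 + d2 ∧ d0 + d1 + d2 ≤ 0)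
    (h : |d0| ≤ N + 1 ∧ |d1| ≤ N + 1 ∧ |d2| ≤ N + 1)
    (h' : ¬ (|d0| ≤ N ∧ |d1| ≤ N ∧ |d2| ≤ N)) :
    (|d0 - 1| ≤ N ∧ |d1 + 1| ≤ N ∧ |d2 + 1| ≤ N) ∨
      (|d0 + 1| ≤ N ∧ |d1 - 1| ≤ N ∧ |d2 + 1| ≤ N) ∨
      (|d0 + 1| ≤ N ∧ |d1 + 1| ≤ N ∧ |d2 - 1| ≤ N) := by
  have e : ∀ x y : ℤ, |-x - y| = |x + y| ∧ |-x + y| = |x - y| := fun x y =>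
    ⟨by rw [← abs_neg]; ring_nf, by rw [← abs_neg]; ring_nf⟩
  have := toward_of_sum_nonneg (d0 := -d0) (d1 := -d1) (d2 := -d2) hN (by omega) (by omega)
    (by simpa only [abs_neg] using h) (by simpa only [abs_neg] using h')
  simpa only [e] using this

/-- If some form attains the largest difference, one step reduces all of them. -/
theorem exists_adj_closer {u v : T.Vertex} {N : ℤ} (hN : 0 ≤ N)
    (h : ∀ k < 3, |T.form k u.1 - T.form k v.1| ≤ N + 1)
    (h' : ¬ ∀ k < 3, |T.form k u.1 - T.form k v.1| ≤ N) :
    ∃ w, T.graph.Adj u w ∧ ∀ k < 3, |T.form k w.1 - T.form k v.1| ≤ N := by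
  obtain ⟨⟨a, b⟩, hu⟩ := u
  obtain ⟨⟨c, d⟩, hv⟩ := v
  rw [forall_lt_three] at h h'
  cases T
  · suffices H : ∃ x y : ℤ, x ^ 2 + y ^ 2 = 1 ∧ ∀ k < 3,
        |square.form k (a + x, b + y) - square.form k (c, d)| ≤ N by
      obtain ⟨x, y, h1, h2⟩ := H
      exact ⟨⟨(a + x, b + y), trivial⟩, square_adj_iff.2 (by simpa using h1), h2⟩
    simp only [forall_lt_three, form, abs_le] at *
    by_cases h1 : a < c
    · exact ⟨1, 0, by norm_num, by omega⟩
    by_cases h2 : c < a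
    · exact ⟨-1, 0, by norm_num, by omega⟩
    by_cases h3 : b < d
    · exact ⟨0, 1, by norm_num, by omega⟩
    · exact ⟨0, -1, by norm_num, by omega⟩
  · suffices H : ∃ x y : ℤ, x ^ 2 + x * y + y ^ 2 = 1 ∧ ∀ k < 3,
        |triangular.form k (a + x, b + y) - triangular.form k (c, d)| ≤ N by
      obtain ⟨x, y, h1, h2⟩ := H
      exact ⟨⟨(a + x, b + y), trivial⟩, triangular_adj_iff.2 (by simpa using h1), h2⟩
    simp only [forall_lt_three, form, abs_le] at *
    by_cases h1 : a < c <;> by_cases h2 : b < d <;> by_cases h3 : d < b <;> by_cases h4 : c < a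
    all_goals first
      | omega
      | exact ⟨1, 0, by norm_num, by omega⟩
      | exact ⟨-1, 0, by norm_num, by omega⟩
      | exact ⟨0, 1, by norm_num, by omega⟩
      | exact ⟨0, -1, by norm_num, by omega⟩
      | exact ⟨1, -1, by norm_num, by omega⟩
      | exact ⟨-1, 1, by norm_num, by omega⟩
  · suffices H : ∃ x y : ℤ, x ^ 2 + x * y + y ^ 2 = 1 ∧ (a + x - (b + y)) % 3 ≠ 2 ∧ ∀ k < 3,
        |hexagonal.form k (a + x, b + y) - hexagonal.form k (c, d)| ≤ N by
      obtain ⟨x, y, h1, h2, h3⟩ := H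
      exact ⟨⟨(a + x, b + y), h2⟩, hexagonal_adj_iff.2 (by simpa using h1), h3⟩
    simp only [IsVertex] at hu hv
    simp only [forall_lt_three, form] at *
    obtain ⟨q, hq⟩ : ∃ q, q = (a - b) / 3 := ⟨_, rfl⟩
    obtain ⟨q', hq'⟩ : ∃ q', q' = (c - d) / 3 := ⟨_, rfl⟩
    rw [← hq, ← hq'] at h h'
    simp only [← hq']
    obtain ⟨d0, h0⟩ : ∃ d0, d0 = a + b + q - (c + d + q') := ⟨_, rfl⟩
    obtain ⟨d1, h1⟩ : ∃ d1, d1 = -a - b + q - (-c - d + q') := ⟨_, rfl⟩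
    obtain ⟨d2, h2⟩ : ∃ d2, d2 = -a + b + q - (-c + d + q') := ⟨_, rfl⟩
    have hp : (d0 - d1) % 2 = 0 ∧ (d0 - d2) % 2 = 0 := by omega
    rw [← h0, ← h1, ← h2] at h h'
    -- The two classes of hexagonal vertices. The forms sum to `3 * q - (a - b)`, which is `0` in
    -- the first class and `-1` in the second; the edges point in opposite directions.
    rcases (show a - b = 3 * q ∨ a - b = 3 * q + 1 by omega) with hr | hr
    · have hsum : 0 ≤ d0 + d1 + d2 ∧ d0 + d1 + d2 ≤ 1 := by omega
      obtain ⟨e0, e1, e2⟩ : (a + 1 - (b + 0)) / 3 = q ∧ (a + 0 - (b + -1)) / 3 = q ∧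
          (a + -1 - (b + 1)) / 3 = q - 1 := by omega
      rcases toward_of_sum_nonneg hN hp hsum h h' with hc | hc | hc
      · refine ⟨1, 0, by norm_num, by omega, ?_⟩
        rw [e0]
        exact ⟨by convert hc.1 using 2; omega, by convert hc.2.1 using 2; omega,
          by convert hc.2.2 using 2; omega⟩
      · refine ⟨0, -1, by norm_num, by omega, ?_⟩
        rw [e1]
        exact ⟨by convert hc.1 using 2; omega, by convert hc.2.1 using 2; omega,
          by convert hc.2.2 using 2; omega⟩
      · refine ⟨-1, 1, by norm_num, by omega, ?_⟩
        rw [e2]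
        exact ⟨by convert hc.1 using 2; omega, by convert hc.2.1 using 2; omega,
          by convert hc.2.2 using 2; omega⟩
    · have hsum : -1 ≤ d0 + d1 + d2 ∧ d0 + d1 + d2 ≤ 0 := by omega
      obtain ⟨e0, e1, e2⟩ : (a + -1 - (b + 0)) / 3 = q ∧ (a + 0 - (b + 1)) / 3 = q ∧
          (a + 1 - (b + -1)) / 3 = q + 1 := by omega
      rcases toward_of_sum_nonpos hN hp hsum h h' with hc | hc | hc
      · refine ⟨-1, 0, by norm_num, by omega, ?_⟩
        rw [e0]
        exact ⟨by convert hc.1 using 2; omega, by convert hc.2.1 using 2; omega,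
          by convert hc.2.2 using 2; omega⟩
      · refine ⟨0, 1, by norm_num, by omega, ?_⟩
        rw [e1]
        exact ⟨by convert hc.1 using 2; omega, by convert hc.2.1 using 2; omega,
          by convert hc.2.2 using 2; omega⟩
      · refine ⟨1, -1, by norm_num, by omega, ?_⟩
        rw [e2]
        exact ⟨by convert hc.1 using 2; omega, by convert hc.2.1 using 2; omega,
          by convert hc.2.2 using 2; omega⟩

theorem exists_walk_of_form {u v : T.Vertex} {N : ℕ}
    (h : ∀ k < 3, |T.form k u.1 - T.form k v.1| ≤ N) : ∃ p : T.graph.Walk u v, p.length ≤ N := by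
  induction N generalizing u with
  | zero =>
    have e : ∀ k < 3, T.form k u.1 = T.form k v.1 := fun k hk => by
      have := h k hk
      rw [abs_le] at this
      push_cast at this
      omega
    obtain rfl := form_injective (show 0 < 1 by omega) (by omega) (e 0 (by omega)) (e 1 (by omega))
    exact ⟨.nil, le_rfl⟩
  | succ N ih =>
    by_cases h' : ∀ k < 3, |T.form k u.1 - T.form k v.1| ≤ N
    · obtain ⟨p, hp⟩ := ih h'
      exact ⟨p, by omega⟩
    · push_cast at h
      obtain ⟨w, hw, hw'⟩ := exists_adj_closer (by omega) h h'
      obtain ⟨p, hp⟩ := ih hw'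
      exact ⟨.cons hw p, by simpa using hp⟩

theorem form_walk {u v : T.Vertex} (p : T.graph.Walk u v) :
    ∀ k < 3, |T.form k u.1 - T.form k v.1| ≤ p.length := by
  induction p with
  | nil => simp
  | cons h p ih =>
    intro k hk
    have h1 := form_adj h k hk
    have h2 := ih k hk
    rw [SimpleGraph.Walk.length_cons]
    rw [abs_le] at *
    push_cast
    omega

/-- The graph distance is the largest difference of the three forms. -/
theorem dist_le_iff {u v : T.Vertex} {N : ℕ} :
    T.graph.dist u v ≤ N ↔ ∀ k < 3, |T.form k u.1 - T.form k v.1| ≤ N := by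
  constructor
  · intro h k hk
    -- Between unreachable vertices `dist` would be `0`, so some walk has to be found before a
    -- shortest one can be taken.
    obtain ⟨M, hM⟩ : ∃ M : ℕ, ∀ k < 3, |T.form k u.1 - T.form k v.1| ≤ M := by
      refine ⟨(|T.form 0 u.1 - T.form 0 v.1| + |T.form 1 u.1 - T.form 1 v.1| +
        |T.form 2 u.1 - T.form 2 v.1|).toNat, ?_⟩
      rw [forall_lt_three]
      have h0 := abs_nonneg (T.form 0 u.1 - T.form 0 v.1)
      have h1 := abs_nonneg (T.form 1 u.1 - T.form 1 v.1)
      have h2 := abs_nonneg (T.form 2 u.1 - T.form 2 v.1)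
      omega
    obtain ⟨p, -⟩ := exists_walk_of_form hM
    obtain ⟨q, hq⟩ := SimpleGraph.Reachable.exists_walk_length_eq_dist ⟨p⟩
    have := form_walk q k hk
    omega
  · intro h
    obtain ⟨p, hp⟩ := exists_walk_of_form h
    exact (SimpleGraph.dist_le p).trans hp

end RegularTiling

/-! ## The discrete Fréchet distance and the grid of free cells -/

theorem exists_monotoneWalk_iff {free : ℕ → ℕ → Prop} {k l : ℕ} :
    (∃ F, IsMonotoneWalk k l F ∧ ∀ ij ∈ F, free ij.1 ij.2) ↔ Conn free 0 0 k l := by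
  constructor
  · rintro ⟨F, ⟨h1, h2, h3⟩, h4⟩
    suffices H : ∀ (F : List (ℕ × ℕ)) (u v : ℕ × ℕ), F.head? = some u → F.getLast? = some v →
        F.IsChain MonotoneStep → (∀ ij ∈ F, free ij.1 ij.2) → Conn free u.1 u.2 v.1 v.2 from
      H F (0, 0) (k, l) h1 h2 h3 h4
    clear h1 h2 h3 h4 F k l
    intro F
    induction F with
    | nil => simp
    | cons w F ih =>
      intro u v h1 h2 h3 h4
      obtain rfl : w = u := by simpa using h1
      cases F with
      | nil =>
        obtain rfl : w = v := by simpa using h2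
        exact .refl (h4 w (by simp))
      | cons w' F =>
        rw [List.isChain_cons_cons] at h3
        have hc := ih w' v rfl (by simpa using h2) h3.2 fun ij hij => h4 ij (by simp [hij])
        have hf := h4 w (by simp)
        refine Conn.trans ?_ hc
        have hf' := Conn.free_left hc
        obtain ⟨⟨e1 | e1, e2 | e2⟩, -⟩ := h3 <;> rw [e1, e2] at hf' ⊢
        · exact .refl hf
        · exact .right (.refl hf) hf'
        · exact .up (.refl hf) hf'
        · exact .diag (.refl hf) hf'
  · intro h
    have hstep : ∀ {k l k' l' : ℕ}, (∃ F, IsMonotoneWalk k l F ∧ ∀ ij ∈ F, free ij.1 ij.2) →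
        MonotoneStep (k, l) (k', l') → free k' l' →
        ∃ F, IsMonotoneWalk k' l' F ∧ ∀ ij ∈ F, free ij.1 ij.2 := by
      rintro k l k' l' ⟨F, ⟨h1, h2, h3⟩, h4⟩ hs hf
      refine ⟨F ++ [(k', l')], ⟨by simp [List.head?_append, h1], by simp, ?_⟩, ?_⟩
      · rw [List.isChain_append]
        refine ⟨h3, by simp, ?_⟩
        intro x hx y hy
        rw [h2] at hx
        obtain rfl : (k, l) = x := by simpa using hx
        obtain rfl : (k', l') = y := by simpa using hy
        exact hs
      · intro ij hij
        rcases List.mem_append.1 hij with hij | hij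
        · exact h4 ij hij
        · obtain rfl : ij = (k', l') := by simpa using hij
          exact hf
    induction h with
    | refl h => exact ⟨[(0, 0)], ⟨rfl, rfl, by simp⟩, by simpa using h⟩
    | up _ hf ih => exact hstep ih ⟨.inr rfl, .inl rfl⟩ hf
    | right _ hf ih => exact hstep ih ⟨.inl rfl, .inr rfl⟩ hf
    | diag _ hf ih => exact hstep ih ⟨.inr rfl, .inr rfl⟩ hf

section Frechet

variable {V : Type*} {G : SimpleGraph V} {u v u' v' : V}

theorem walkCost_le_iff {P : G.Walk u v} {Q : G.Walk u' v'} {F : List (ℕ × ℕ)} {N : ℕ} :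
    walkCost P Q F ≤ N ↔ ∀ ij ∈ F, G.dist (P.getVert ij.1) (Q.getVert ij.2) ≤ N := by
  simp only [walkCost, Finset.sup_le_iff, List.mem_toFinset]

theorem frechetDist_le_iff {P : G.Walk u v} {Q : G.Walk u' v'} {N : ℕ} : frechetDist P Q ≤ N ↔
    Conn (fun i j => G.dist (P.getVert i) (Q.getVert j) ≤ N) 0 0 P.length Q.length := by
  rw [← exists_monotoneWalk_iff]
  simp only [← walkCost_le_iff]
  constructor
  · intro h
    -- Some monotone walk exists, so the infimum is attained and is not the default value `0` of an
    -- empty set.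
    obtain ⟨F, hF, -⟩ := (exists_monotoneWalk_iff (free := fun _ _ => True)).2
      ((Conn.of_row (Nat.zero_le Q.length) fun _ _ _ => trivial).trans
        (Conn.of_col (Nat.zero_le P.length) fun _ _ _ => trivial))
    obtain ⟨F', hF', hc⟩ := Nat.sInf_mem (s := {d | ∃ F, IsMonotoneWalk P.length Q.length F ∧
      walkCost P Q F = d}) ⟨_, F, hF, rfl⟩
    exact ⟨F', hF', hc.trans_le h⟩
  · rintro ⟨F, hF, hc⟩
    exact le_trans (Nat.sInf_le (m := walkCost P Q F) ⟨F, hF, rfl⟩) hc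

end Frechet

/-! ### The grid of two paths and the reduction to an integer threshold. -/

section WalkGrid

variable {T : RegularTiling} {u v u' v' : T.Vertex} {U : ℕ}

/-- The values of the three forms along two walks. -/
noncomputable def walkGrid (P : T.graph.Walk u v) (Q : T.graph.Walk u' v') (D : ℤ) : Grid where
  F k i := T.form k (P.getVert i).1
  G k j := T.form k (Q.getVert j).1
  n := P.length + 1
  m := Q.length + 1
  D := D

/-- The distance of the first vertices. -/
noncomputable def startDist (P : T.graph.Walk u v) (Q : T.graph.Walk u' v') : ℤ :=
  max (max |T.form 0 (P.getVert 0).1 - T.form 0 (Q.getVert 0).1|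
    |T.form 1 (P.getVert 0).1 - T.form 1 (Q.getVert 0).1|)
    |T.form 2 (P.getVert 0).1 - T.form 2 (Q.getVert 0).1|

variable {P : T.graph.Walk u v} {Q : T.graph.Walk u' v'}

theorem startDist_le_iff {D : ℤ} : startDist P Q ≤ D ↔ (walkGrid P Q D).free 0 0 := by
  rw [Grid.free, RegularTiling.forall_lt_three, startDist, max_le_iff, max_le_iff, and_assoc]
  rfl

theorem startDist_nonneg : 0 ≤ startDist P Q := le_max_of_le_right (abs_nonneg _)

theorem frechetDist_le_iff_good {N : ℕ} : frechetDist P Q ≤ N ↔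
    Good (walkGrid P Q N).free (walkGrid P Q N).n (walkGrid P Q N).m := by
  rw [frechetDist_le_iff]
  simp only [RegularTiling.dist_le_iff]
  rfl

theorem startDist_le_frechetDist : startDist P Q ≤ frechetDist P Q :=
  startDist_le_iff.2 (Conn.free_left (frechetDist_le_iff_good.1 le_rfl))

theorem slowOn_getVert (P : T.graph.Walk u v) {k : ℕ} (hk : k < 3) :
    SlowOn (fun i => T.form k (P.getVert i).1) (P.length + 1) := by
  intro i hi
  have := RegularTiling.form_adj (P.adj_getVert_succ (show i < P.length by omega)) k hk
  rw [abs_le] at this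
  simp only
  omega

/-- Along the two paths each form drifts by at most their lengths, so at this threshold all cells
are free. This justifies the cap on the integer threshold. -/
theorem frechetDist_le_startDist : (frechetDist P Q : ℤ) ≤
    startDist P Q + (P.length + 1 : ℕ) + (Q.length + 1 : ℕ) := by
  obtain ⟨N, hN⟩ : ∃ N : ℕ, (N : ℤ) = startDist P Q + (P.length + 1 : ℕ) + (Q.length + 1 : ℕ) :=
    ⟨_, Int.toNat_of_nonneg (by have := startDist_nonneg (P := P) (Q := Q); omega)⟩
  rw [← hN]
  refine Nat.cast_le.2 (frechetDist_le_iff_good.2 ?_)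
  have hfree : ∀ i j, i ≤ P.length → j ≤ Q.length → (walkGrid P Q N).free i j := by
    intro i j hi hj k hk
    have h1 := Grid.SlowOn.abs_sub_le (slowOn_getVert P hk) (show 0 + i < _ by omega)
    have h2 := Grid.SlowOn.abs_sub_le (slowOn_getVert Q hk) (show 0 + j < _ by omega)
    have h3 := startDist_le_iff.1 (le_refl (startDist P Q)) k hk
    simp only [walkGrid, abs_le, zero_add] at *
    push_cast at *
    omega
  exact ((Conn.of_row (Nat.zero_le Q.length) fun c _ hc => hfree 0 c (by omega) hc).trans
        (Conn.of_col (Nat.zero_le P.length) fun c _ hc => hfree c _ hc le_rfl))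

/-- The threshold may be replaced by an integer near the distance of the first vertices. -/
theorem frechetDist_le_threshold_iff {Δ : ℝ} (h : (startDist P Q : ℝ) ≤ Δ) {D : ℤ}
    (hD : D = min ⌊Δ⌋ (startDist P Q + (P.length + 1 : ℕ) + (Q.length + 1 : ℕ))) :
    (frechetDist P Q : ℝ) ≤ Δ ↔ Good (walkGrid P Q D).free (P.length + 1) (Q.length + 1) := by
  have h1 : startDist P Q ≤ ⌊Δ⌋ := Int.le_floor.2 h
  have h0 := startDist_nonneg (P := P) (Q := Q)
  have h2 := frechetDist_le_startDist (P := P) (Q := Q)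
  have h3 : (frechetDist P Q : ℝ) ≤ Δ ↔ (frechetDist P Q : ℤ) ≤ ⌊Δ⌋ := by
    rw [Int.le_floor]
    simp
  lift D to ℕ using (by omega)
  rw [h3]
  refine Iff.trans ?_ frechetDist_le_iff_good
  omega

theorem frechetDist_not_le {Δ : ℝ} (h : ¬ (startDist P Q : ℝ) ≤ Δ) :
    ¬ (frechetDist P Q : ℝ) ≤ Δ := fun h' => h <| le_trans (by
      have := startDist_le_frechetDist (P := P) (Q := Q)
      exact_mod_cast this) h'

theorem abs_form_le {p : ℤ × ℤ} (h : |p.1| ≤ U ∧ |p.2| ≤ U) (k : ℕ) : |T.form k p| ≤ 2 * U := by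
  obtain ⟨a, b⟩ := p
  rw [abs_le, abs_le] at h
  simp only at h
  rw [abs_le]
  unfold RegularTiling.form
  split <;> simp only <;> omega

theorem injective_form_getVert (hQ : Q.IsPath) {k₁ k₂ : ℕ} (h1 : k₁ < k₂) (h2 : k₂ < 3) {i j : ℕ}
    (hi : i < Q.length + 1) (hj : j < Q.length + 1)
    (e1 : T.form k₁ (Q.getVert i).1 = T.form k₁ (Q.getVert j).1)
    (e2 : T.form k₂ (Q.getVert i).1 = T.form k₂ (Q.getVert j).1) : i = j :=
  hQ.getVert_injOn (by simp; omega) (by simp; omega) (RegularTiling.form_injective h1 h2 e1 e2)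

/-- The forms are at most `2 * U` and the first vertices at most `4 * U` apart, hence the `6 * U` in
the bound for a value plus `D`. -/
theorem walkGrid_fine (hP : ∀ i, |(P.getVert i).1.1| ≤ (U : ℤ) ∧ |(P.getVert i).1.2| ≤ (U : ℤ))
    (hQ : ∀ i, |(Q.getVert i).1.1| ≤ (U : ℤ) ∧ |(Q.getVert i).1.2| ≤ (U : ℤ)) {D V : ℤ}
    (h0 : 0 ≤ D) (hD : D ≤ startDist P Q + (P.length + 1 : ℕ) + (Q.length + 1 : ℕ))
    (hV : 6 * (U : ℤ) + (P.length + 1 : ℕ) + (Q.length + 1 : ℕ) < V) : (walkGrid P Q D).Fine V := by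
  have hs : startDist P Q ≤ 4 * U := by
    rw [startDist_le_iff]
    intro k hk
    have h1 := abs_form_le (T := T) (hP 0) k
    have h2 := abs_form_le (T := T) (hQ 0) k
    simp only [walkGrid, abs_le] at *
    omega
  refine ⟨fun k hk => slowOn_getVert P hk, fun k hk => slowOn_getVert Q hk, fun k hk i _ => ?_,
    fun k hk j _ => ?_, fun k hk i _ j _ => ?_, h0, ?_⟩
  · have h1 := abs_form_le (T := T) (hP i) k
    simp only [walkGrid] at *
    omega
  · have h1 := abs_form_le (T := T) (hQ j) k
    simp only [walkGrid] at *
    omega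
  · have h1 := abs_form_le (T := T) (hP i) k
    have h2 := abs_form_le (T := T) (hQ j) k
    simp only [walkGrid, abs_le, abs_lt] at *
    omega
  · simp only [walkGrid]
    omega

end WalkGrid

/-! ## The algorithm -/

namespace Main

/-- The forms as expressions. -/
def formExpr (T : RegularTiling) (k : ℕ) (a b : RExpr) : RExpr :=
  match T, k with
  | .square, 0 => a + b
  | .square, 1 => a - b
  | .square, _ => a
  | .triangular, 0 => a
  | .triangular, 1 => b
  | .triangular, _ => a + b
  | .hexagonal, 0 => a + b + (a - b) / 3
  | .hexagonal, 1 => 0 - a - b + (a - b) / 3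
  | .hexagonal, _ => 0 - a + b + (a - b) / 3

/-- Store in the array `c` the forms of the points in the arrays `a` and `b`. -/
def fill (T : RegularTiling) (e : RExpr) (a b c : ℕ) : Program := forTo e (
  .write c (3 * .var 15) (formExpr T 0 (.read a (.var 15)) (.read b (.var 15))) ⨟
  .write c (3 * .var 15 + 1) (formExpr T 1 (.read a (.var 15)) (.read b (.var 15))) ⨟
  .write c (3 * .var 15 + 2) (formExpr T 2 (.read a (.var 15)) (.read b (.var 15))))

/-- Compute a power of two that is at least the number of rows and of columns. -/
def side : Program := 2 ⟵ 1 ⨟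
  .loop (.or (.lt (.var 2) (.var 0)) (.lt (.var 2) (.var 1))) (2 ⟵ .var 2 + .var 2)

/-- Compute the distance of the first vertices. -/
def start : Program :=
  4 ⟵ 0 ⨟
  11 ⟵ .read 4 0 - .read 5 0 ⨟ setMax 4 (.var 11) ⨟ setMax 4 (0 - .var 11) ⨟
  11 ⟵ .read 4 1 - .read 5 1 ⨟ setMax 4 (.var 11) ⨟ setMax 4 (0 - .var 11) ⨟
  11 ⟵ .read 4 2 - .read 5 2 ⨟ setMax 4 (.var 11) ⨟ setMax 4 (0 - .var 11)

/-- Compute an integer threshold. -/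
def threshold : Program := 10 ⟵ .var 4 + .var 0 + .var 1 ⨟
  .loop (.and (.leThreshold (.var 4 + 1)) (.lt (.var 4) (.var 10))) (4 ⟵ .var 4 + 1)

/-- Push the block of all cells on the stack. -/
def root : Program := .write 6 0 1 ⨟ 3 ⟵ 1 ⨟ .write 7 0 0 ⨟ .write 8 0 0 ⨟ .write 9 0 (.var 2)

/-- Read off whether the last cell is reachable. -/
def answer : Program :=
  .cond (.le 1 (.read 6 (.var 0 * (.var 1 + 1) + .var 1))) (0 ⟵ 1) (0 ⟵ 0)

/-- Search the cells, if the first one is free. -/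
def search : Program := threshold ⨟ root ⨟ .loop Tree.loopTest Tree.body ⨟ answer

/-- Decide whether the discrete Fréchet distance is at most the threshold. -/
def main (T : RegularTiling) : Program :=
  side ⨟ fill T (.var 0) 0 1 4 ⨟ fill T (.var 1) 2 3 5 ⨟ start ⨟
  .cond (.leThreshold (.var 4)) search (0 ⟵ 0)

variable {M : Machine} {s : State} {T : RegularTiling} {n m : ℕ}

/-! ### Running times and correctness of the stages of the algorithm. -/

theorem exists_side (n m : ℕ) (h : 0 < n + m) : ∃ K, n ≤ 2 ^ K ∧ m ≤ 2 ^ K ∧ 2 ^ K ≤ 2 * (n + m) ∧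
    ∀ k < K, 2 ^ k < n ∨ 2 ^ k < m := by
  classical
  have hex : ∃ K, n ≤ 2 ^ K ∧ m ≤ 2 ^ K :=
    ⟨n + m, (Nat.lt_two_pow_self.le.trans (Nat.pow_le_pow_right (by omega) (by omega))),
      (Nat.lt_two_pow_self.le.trans (Nat.pow_le_pow_right (by omega) (by omega)))⟩
  have hmin : ∀ k < Nat.find hex, 2 ^ k < n ∨ 2 ^ k < m := fun k hk => by
    have := Nat.find_min hex hk
    omega
  refine ⟨Nat.find hex, (Nat.find_spec hex).1, (Nat.find_spec hex).2, ?_, hmin⟩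
  rcases hK : Nat.find hex with _ | K
  · omega
  · have := hmin K (by omega)
    rw [pow_succ]
    omega

theorem side_runs {K : ℕ} (hs : Bdd M.bd s) (h0 : s.var 0 = n) (h1 : s.var 1 = m)
    (hn : n ≤ 2 ^ K) (hm : m ≤ 2 ^ K) (hk : ∀ k < K, 2 ^ k < n ∨ 2 ^ k < m)
    (hV : (2 : ℤ) ^ K ≤ M.bd) :
    Runs M side s (2 + 30 * (K + 1)) (fun s' => s'.var 2 = 2 ^ K) := by
  have hM := M.two_le
  refine Runs.seq (R := fun s' => s'.var 2 = 1 ∧ s'.var 0 = n ∧ s'.var 1 = m)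
    (Runs.of_wp_le hs (by decide) (by decide) (by simp [h0, h1]; omega)) ?_
  rintro s₁ ⟨k2, k0, k1⟩ hs₁ -
  refine Runs.loop_le (fun k s' => s'.var 2 = 2 ^ k) K 4 30 (by decide) hs₁ (by decide)
    (by simpa using k2) ?_ ?_
  · intro k s₂ hkK h2 hs₂ hag
    have e0 := (hag.1 0 (by decide)).trans k0
    have e1 := (hag.1 1 (by decide)).trans k1
    have h3 : (2 : ℤ) ^ (k + 1) ≤ 2 ^ K := pow_le_pow_right₀ (by norm_num) hkK
    have h4 : (0 : ℤ) < 2 ^ (k + 1) := by positivity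
    constructor
    · simp only [Test.holds_or, Test.holds_lt, RExpr.eval_var, h2, e0, e1]
      exact_mod_cast hk k hkK
    · refine Runs.of_wp_le hs₂ (by decide) (by decide) ?_
      simp only [wp_assign, RExpr.eval_add, RExpr.eval_var, h2, State.setVar_var, reduceIte]
      rw [← two_mul, ← pow_succ']
      exact ⟨by omega, rfl⟩
  · intro s₂ h2 hag
    have e0 := (hag.1 0 (by decide)).trans k0
    have e1 := (hag.1 1 (by decide)).trans k1
    simp only [Test.holds_or, Test.holds_lt, RExpr.eval_var, h2, e0, e1, not_or, not_lt]
    exact ⟨by exact_mod_cast hn, by exact_mod_cast hm⟩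

theorem formExpr_eval (k : ℕ) (a b : RExpr) :
    (formExpr T k a b).eval s = T.form k (a.eval s, b.eval s) := by
  unfold formExpr RegularTiling.form
  split <;> simp

theorem fill_runs {e : RExpr} {a b c N U : ℕ} (hs : Bdd M.bd s) (hN : (N : ℤ) < M.bd)
    (hU : 2 * (U : ℤ) ≤ M.bd) (he : (e = .var 0 ∧ a = 0 ∧ b = 1 ∧ c = 4) ∨ 
      (e = .var 1 ∧ a = 2 ∧ b = 3 ∧ c = 5)) (heN : e.eval s = N) {p : ℕ → ℤ × ℤ}
    (hp : ∀ i < N, |(p i).1| ≤ U ∧ |(p i).2| ≤ U)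
    (ha : ∀ i : ℕ, i < N → s.arr a i = (p i).1) (hb : ∀ i : ℕ, i < N → s.arr b i = (p i).2) :
    Runs M (fill T e a b c) s (100 * (N + 2)) (fun s' => ∀ k : ℕ, k < 3 → ∀ i : ℕ, i < N →
      s'.arr c (3 * i + k) = T.form k (p i)) := by
  have hac : a ≠ c ∧ b ≠ c := by omega
  refine counter_loop (fun j s' => ∀ k : ℕ, k < 3 → ∀ i : ℕ, i < j →
      s'.arr c (3 * i + k) = T.form k (p i)) N 80 100 hs hN ?_ ?_ ?_ ?_ ?_ ?_ ?_ ?_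
  · rcases he with ⟨rfl, -⟩ | ⟨rfl, -⟩ <;> decide
  · rcases he with ⟨rfl, rfl, rfl, rfl⟩ | ⟨rfl, rfl, rfl, rfl⟩ <;> cases T <;> decide
  · rcases he with ⟨rfl, rfl, rfl, rfl⟩ | ⟨rfl, rfl, rfl, rfl⟩ <;> cases T <;> decide
  · rcases he with ⟨rfl, -⟩ | ⟨rfl, -⟩ <;> decide
  · simp [Program.wvars]
  · intro s' hag
    rcases he with ⟨rfl, -⟩ | ⟨rfl, -⟩
    · rw [← heN]
      exact hag.1 0 (by simp [Program.wvars])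
    · rw [← heN]
      exact hag.1 1 (by simp [Program.wvars])
  · intro k _ i hi
    omega
  · intro j s₁ hj k15 hInv hs₁ hag
    have aa : s₁.arr a j = (p j).1 := by
      rw [← ha j hj, hag.2 a (by simp [Program.warrs, hac])]
      rfl
    have ab : s₁.arr b j = (p j).2 := by
      rw [← hb j hj, hag.2 b (by simp [Program.warrs, hac])]
      rfl
    have hf : ∀ k, -M.bd ≤ T.form k (p j) ∧ T.form k (p j) ≤ M.bd := fun k => by
      have := abs_form_le (T := T) (hp j hj) k
      rw [abs_le] at this
      omega
    simp only [wp_seq, wp_write, formExpr_eval, RExpr.eval_read, RExpr.eval_var, RExpr.eval_mul,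
      RExpr.eval_add, RExpr.eval_one, RExpr.eval_two, RExpr.eval_three, State.setArr_var,
      State.setArr_arr_apply, State.setVar_arr, k15, aa, ab, hac.1, hac.2, reduceIte,
      Prod.mk.eta]
    refine ⟨hf 0, hf 1, hf 2, fun k hk i hi => ?_⟩
    by_cases hij : i = j
    · subst hij
      interval_cases k <;> simp
    · rw [Function.update_of_ne (by omega), Function.update_of_ne (by omega),
        Function.update_of_ne (by omega)]
      exact hInv k hk i (by omega)

theorem start_runs {f g : ℕ → ℤ} {d : ℤ} (hs : Bdd M.bd s)
    (h4 : ∀ k : ℕ, k < 3 → s.arr 4 k = f k) (h5 : ∀ k : ℕ, k < 3 → s.arr 5 k = g k)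
    (hb : ∀ k < 3, |f k - g k| ≤ M.bd)
    (hd : d = max (max |f 0 - g 0| |f 1 - g 1|) |f 2 - g 2|) :
    Runs M start s 200 (fun s' => s'.var 4 = d) := by
  refine Runs.of_wp_le hs (by decide) (by decide) ?_
  have hV := M.two_le
  have a0 := h4 0 (by omega)
  have a1 := h4 1 (by omega)
  have a2 := h4 2 (by omega)
  have b0 := h5 0 (by omega)
  have b1 := h5 1 (by omega)
  have b2 := h5 2 (by omega)
  have c0 := hb 0 (by omega)
  have c1 := hb 1 (by omega)
  have c2 := hb 2 (by omega)
  push_cast at a0 a1 a2 b0 b1 b2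
  rw [abs_le] at c0 c1 c2
  simp only [start, wp_seq, wp_assign, wp_setMax, RExpr.eval_read, RExpr.eval_var, RExpr.eval_sub,
    RExpr.eval_zero, RExpr.eval_one, RExpr.eval_two, State.setVar_var, State.setVar_arr, reduceIte,
    Nat.reduceEqDiff, a0, a1, a2, b0, b1, b2, abs_eq_max_neg] at hd ⊢
  omega

/-- The real threshold is seen only through comparisons, so its integer part is found by counting up
from `d`; the cap limits this to `n + m` steps. -/
theorem threshold_runs {d : ℤ} {D : ℤ} (hs : Bdd M.bd s) (h0 : s.var 0 = n) (h1 : s.var 1 = m)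
    (h4 : s.var 4 = d) (hd : (d : ℝ) ≤ M.thr) (hD : D = min ⌊M.thr⌋ (d + n + m))
    (hV : d + n + m ≤ M.bd) (hd0 : 0 ≤ d) :
    Runs M threshold s (6 + 30 * (n + m + 1)) (fun s' => s'.var 4 = D) := by
  have hM := M.two_le
  have hfl : d ≤ ⌊M.thr⌋ := Int.le_floor.2 hd
  obtain ⟨N, hN⟩ : ∃ N : ℕ, (N : ℤ) = D - d := ⟨_, Int.toNat_of_nonneg (by omega)⟩
  refine (Runs.seq (T := 6) (T' := 30 * (N + 1))
    (R := fun s' => s'.var 10 = d + n + m ∧ s'.var 4 = d)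
    (Runs.of_wp_le hs (by decide) (by decide) (by simp [h0, h1, h4]; omega)) ?_).mono (by omega)
    fun _ => id
  rintro s₁ ⟨k10, k4⟩ hs₁ -
  refine (Runs.loop_le (fun k s' => s'.var 4 = d + k) N 4 30 (by decide) hs₁ (by decide)
    (by simpa using k4) ?_ ?_).mono le_rfl fun s' h => by omega
  · intro k s₂ hkK h2 hs₂ hag
    have e10 := (hag.1 10 (by decide)).trans k10
    constructor
    · simp only [Test.holds_and, Test.holds_lt, Test.holds_leThreshold, RExpr.eval_add,
        RExpr.eval_one, RExpr.eval_var, h2, e10, ← Int.le_floor]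
      omega
    · refine Runs.of_wp_le hs₂ (by decide) (by decide) ?_
      simp only [wp_assign, RExpr.eval_add, RExpr.eval_var, RExpr.eval_one, h2, State.setVar_var,
        reduceIte]
      push_cast
      omega
  · intro s₂ h2 hag
    have e10 := (hag.1 10 (by decide)).trans k10
    simp only [Test.holds_and, Test.holds_lt, Test.holds_leThreshold, RExpr.eval_add,
      RExpr.eval_one, RExpr.eval_var, h2, e10, ← Int.le_floor]
    omega

/-- The loop over the blocks, started with the block of all cells. -/
theorem root_tree_runs {I : Grid} {K : ℕ} (hI : I.Fine M.bd) (hV : 4 ≤ M.bd) (hs : Bdd M.bd s)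
    (hL : I.Loaded s) (h2 : s.var 2 = 2 ^ K) (h6 : s.arr 6 = fun _ => 0) (hn : 0 < I.n)
    (hm : 0 < I.m) (hnK : I.n ≤ 2 ^ K) (hmK : I.m ≤ 2 ^ K) (hK : (2 : ℤ) ^ K ≤ M.bd)
    (hK3 : 3 * (K : ℤ) + 1 ≤ M.bd) :
    Runs M (root ⨟ .loop Tree.loopTest Tree.body ⨟ answer) s (Tree.cost I 8000 K 0 0 + 100)
      (fun s' => (Good I.free I.n I.m → s'.var 0 = 1) ∧ (¬ Good I.free I.n I.m → s'.var 0 = 0)) := by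
  have hM := M.two_le
  have hbd2 := hs.1 2
  refine (Runs.seq (T := 50) (R := fun s' => s'.var 3 = 1 ∧ Tree.At s' 0 0 0 (2 ^ K) ∧
      s'.arr 6 = Function.update (fun _ => 0) 0 1) (T' := Tree.cost I 8000 K 0 0 + 50)
      (Runs.of_wp_le hs (by decide) (by decide) ?_) ?_).mono (by omega) fun _ => id
  · simp [root, Tree.At, h6, h2] at hbd2 ⊢
    omega
  rintro s₁ ⟨k3, kat, k6⟩ hs₁ hag₁
  have hL₁ : I.Loaded s₁ := hL.agree hag₁ (by decide)
  have hpos : (0 : ℤ) < (I.m : ℤ) + 1 := by omega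
  -- Apart from the virtual cell, nothing on the boundary is reachable, and the memory is `0` at the
  -- start; so writing one entry initializes the table.
  have hready : Tree.Ready I s₁ 0 0 (2 ^ K) := by
    refine fun _ _ => ⟨fun p _ _ _ => ?_, fun q _ _ _ => ?_⟩
    · rcases p with _ | p
      · exact iff_of_true (by simp [k6]) trivial
      · refine iff_of_false ?_ id
        have : (0 : ℤ) < ((p + 1 : ℕ) : ℤ) * (I.m + 1) := by positivity
        rw [k6, Function.update_of_ne (by push_cast at *; omega)]
        norm_num
    · rcases q with _ | q
      · exact iff_of_true (by simp [k6]) trivial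
      · refine iff_of_false ?_ id
        rw [k6, Function.update_of_ne (by push_cast; omega)]
        norm_num
  have hrun := (Tree.block_reach hI hV K 0 0 0 s₁ hs₁ hL₁ (by simpa using k3) kat (by simpa using hK)
    (by simpa using hK) (by simpa using hK3) hready).runs (by decide) (fun s' h => by
      simp [Tree.loopTest, h.1])
  refine (Runs.seq (T' := 20) (hrun.mono (T' := Tree.cost I 8000 K 0 0 + 30)
    (by have : Tree.loopTest.time = 3 := by decide
        omega) fun _ => id) ?_).mono (by omega) fun _ => id
  rintro s₂ ⟨-, -, -, hdone⟩ hs₂ hag₂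
  have hL₂ : I.Loaded s₂ := hL₁.agree (p := .loop Tree.loopTest Tree.body) hag₂ (by decide)
  have hok := (hdone hn hm).1 I.n hn (by omega) le_rfl
  rw [min_eq_right (by omega), Grid.Ok] at hok
  refine Runs.of_wp_le hs₂ (by decide) (by decide) ?_
  simp only [answer, wp_cond, wp_assign, Test.holds_le, RExpr.eval_one, RExpr.eval_zero,
    RExpr.eval_read, RExpr.eval_add, RExpr.eval_mul, RExpr.eval_var, hL₂.n, hL₂.m, hok,
    State.setVar_var, reduceIte]
  refine ⟨fun h => ⟨by omega, fun _ => trivial, fun h' => absurd h h'⟩, fun h => ⟨by omega, fun h' => absurd h' h, fun _ => trivial⟩⟩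

end Main

/-! ### The input in memory and the assembly of the algorithm. -/

theorem listArray_map_support {T : RegularTiling} {u v : T.Vertex} (P : T.graph.Walk u v)
    (f : T.Vertex → ℤ) {i : ℕ} (hi : i < P.length + 1) :
    listArray (P.support.map f) i = f (P.getVert i) := by
  have h : i < P.support.length := by rw [P.length_support]; exact hi
  rw [listArray, if_pos (by omega), Int.toNat_natCast, List.getD_eq_getElem _ _ (by simpa using h),
    List.getElem_map, P.getVert_eq_support_getElem (by omega)]

theorem abs_listArray_le {l : List ℤ} {U : ℤ} (h0 : 0 ≤ U) (h : ∀ a ∈ l, |a| ≤ U) (i : ℤ) :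
    |listArray l i| ≤ U := by
  unfold listArray
  split_ifs
  · by_cases hi : i.toNat < l.length
    · rw [List.getD_eq_getElem _ _ hi]
      exact h _ (List.getElem_mem hi)
    · rw [List.getD_eq_default _ _ (by omega)]
      simpa using h0
  · simpa using h0

section InputState

variable {T : RegularTiling} {u v u' v' : T.Vertex} {P : T.graph.Walk u v} {Q : T.graph.Walk u' v'}
  {U : ℕ}

theorem inputState_bdd (hU : ∀ w ∈ P.support ++ Q.support, |w.1.1| ≤ (U : ℤ) ∧ |w.1.2| ≤ (U : ℤ))
    {V : ℤ} (hV : (P.length + 1 : ℕ) + (Q.length + 1 : ℕ) + (U : ℤ) ≤ V) :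
    Bdd V (inputState P Q) := by
  have harr : ∀ a i, |(inputState P Q).arr a i| ≤ U := by
    intro a i
    rcases a with _ | _ | _ | _ | a
    · refine abs_listArray_le (by omega) ?_ i
      simp only [List.mem_map, forall_exists_index, and_imp, forall_apply_eq_imp_iff₂]
      exact fun w hw => (hU w (by simp [hw])).1
    · refine abs_listArray_le (by omega) ?_ i
      simp only [List.mem_map, forall_exists_index, and_imp, forall_apply_eq_imp_iff₂]
      exact fun w hw => (hU w (by simp [hw])).2
    · refine abs_listArray_le (by omega) ?_ i
      simp only [List.mem_map, forall_exists_index, and_imp, forall_apply_eq_imp_iff₂]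
      exact fun w hw => (hU w (by simp [hw])).1
    · refine abs_listArray_le (by omega) ?_ i
      simp only [List.mem_map, forall_exists_index, and_imp, forall_apply_eq_imp_iff₂]
      exact fun w hw => (hU w (by simp [hw])).2
    · simp [inputState]
  refine ⟨fun x => ?_, fun a i => ?_⟩
  · rcases x with _ | _ | x
    · simp only [inputState, P.length_support]
      omega
    · simp only [inputState, Q.length_support]
      omega
    · simp only [inputState]
      omega
  · have := abs_le.1 (harr a i)
    omega

/-- The algorithm is correct, and fast. -/
theorem Main.main_runs {M : Machine} (hQ : Q.IsPath)
    (hU : ∀ w ∈ P.support ++ Q.support, |w.1.1| ≤ (U : ℤ) ∧ |w.1.2| ≤ (U : ℤ)) {n m K : ℕ}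
    (hn : P.length + 1 = n) (hm : Q.length + 1 = m) (hnK : n ≤ 2 ^ K) (hmK : m ≤ 2 ^ K)
    (hmin : ∀ k < K, 2 ^ k < n ∨ 2 ^ k < m) (hK : 2 ^ K ≤ 2 * (n + m))
    (hV : 12 * ((n : ℤ) + m + U) ≤ M.bd) :
    Runs M (main T) (inputState P Q) (2000 * (n + m) + 15565 * 8000 * (2 ^ K * 2 ^ (K / 2)))
      (fun s' => ((frechetDist P Q : ℝ) ≤ M.thr → s'.var 0 = 1) ∧
        (¬ (frechetDist P Q : ℝ) ≤ M.thr → s'.var 0 = 0)) := by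
  have hP' : ∀ i, |(P.getVert i).1.1| ≤ (U : ℤ) ∧ |(P.getVert i).1.2| ≤ (U : ℤ) := fun i =>
    hU _ (by simp [P.getVert_mem_support])
  have hQ' : ∀ i, |(Q.getVert i).1.1| ≤ (U : ℤ) ∧ |(Q.getVert i).1.2| ≤ (U : ℤ) := fun i =>
    hU _ (by simp [Q.getVert_mem_support])
  have hs : Bdd M.bd (inputState P Q) := inputState_bdd hU (by omega)
  have h0 : (inputState P Q).var 0 = n := by simp [inputState, ← hn]
  have h1 : (inputState P Q).var 1 = m := by simp [inputState, ← hm]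
  have hKz : (2 : ℤ) ^ K ≤ 2 * (n + m) := by exact_mod_cast hK
  have hKlt : K < 2 ^ K := Nat.lt_two_pow_self
  refine Runs.mono (T := (2 + 30 * (K + 1)) + (100 * (n + 2) + (100 * (m + 2) + (200 +
    (1 + 1 + 1 + ((6 + 30 * (n + m + 1)) + (15565 * 8000 * (2 ^ K * 2 ^ (K / 2)) + 100)))))))
    ?_ (by omega) fun _ => id
  refine (side_runs hs h0 h1 hnK hmK hmin (by omega)).seq fun s₁ k2 hs₁ ag₁ => ?_
  have a0 : s₁.var 0 = n := (ag₁.1 0 (by decide)).trans h0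
  have a1 : s₁.var 1 = m := (ag₁.1 1 (by decide)).trans h1
  refine (fill_runs (T := T) (N := n) (U := U) hs₁ (by omega) (by omega)
    (.inl ⟨rfl, rfl, rfl, rfl⟩) a0 (p := fun i => (P.getVert i).1) (fun i _ => hP' i)
    (fun i hi => ?_) (fun i hi => ?_)).seq fun s₂ hF hs₂ ag₂ => ?_
  · rw [ag₁.2 0 (by decide)]
    exact listArray_map_support P (fun w => w.1.1) (by omega)
  · rw [ag₁.2 1 (by decide)]
    exact listArray_map_support P (fun w => w.1.2) (by omega)
  have b0 : s₂.var 0 = n := (ag₂.1 0 (by cases T <;> decide)).trans a0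
  have b1 : s₂.var 1 = m := (ag₂.1 1 (by cases T <;> decide)).trans a1
  refine (fill_runs (T := T) (N := m) (U := U) hs₂ (by omega) (by omega)
    (.inr ⟨rfl, rfl, rfl, rfl⟩) b1 (p := fun i => (Q.getVert i).1) (fun i _ => hQ' i)
    (fun i hi => ?_) (fun i hi => ?_)).seq fun s₃ hG hs₃ ag₃ => ?_
  · rw [ag₂.2 2 (by cases T <;> decide), ag₁.2 2 (by decide)]
    exact listArray_map_support Q (fun w => w.1.1) (by omega)
  · rw [ag₂.2 3 (by cases T <;> decide), ag₁.2 3 (by decide)]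
    exact listArray_map_support Q (fun w => w.1.2) (by omega)
  rw [← ag₃.2 4 (by cases T <;> decide)] at hF
  have hdle : ∀ k < 3, |T.form k (P.getVert 0).1 - T.form k (Q.getVert 0).1| ≤ 4 * U := fun k _ => by
    have h1 := abs_form_le (T := T) (hP' 0) k
    have h2 := abs_form_le (T := T) (hQ' 0) k
    rw [abs_le] at *
    omega
  have hd4 : startDist P Q ≤ 4 * U :=
    max_le (max_le (hdle 0 (by omega)) (hdle 1 (by omega))) (hdle 2 (by omega))
  have hd0 := startDist_nonneg (P := P) (Q := Q)
  refine (start_runs (f := fun k => T.form k (P.getVert 0).1)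
    (g := fun k => T.form k (Q.getVert 0).1) (d := startDist P Q) hs₃
    (fun k hk => by simpa using hF k hk 0 (by omega))
    (fun k hk => by simpa using hG k hk 0 (by omega))
    (fun k hk => (hdle k hk).trans (by omega)) rfl).seq fun s₄ h4 hs₄ ag₄ => ?_
  have ag : ∀ x, x ≠ 2 → x ≠ 4 → x ≠ 11 → x ≠ 15 → s₄.var x = (inputState P Q).var x := by
    intro x e1 e2 e3 e4
    refine (ag₄.1 x ?_).trans ((ag₃.1 x ?_).trans ((ag₂.1 x ?_).trans (ag₁.1 x ?_))) <;>
      simp [start, fill, forTo, side, setMax, Program.wvars, *]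
  have c2 : s₄.var 2 = 2 ^ K := (ag₄.1 2 (by decide)).trans ((ag₃.1 2 (by cases T <;> decide)).trans
    ((ag₂.1 2 (by cases T <;> decide)).trans k2))
  have c0 : s₄.var 0 = n := (ag 0 (by decide) (by decide) (by decide) (by decide)).trans h0
  have c1 : s₄.var 1 = m := (ag 1 (by decide) (by decide) (by decide) (by decide)).trans h1
  have c6 : s₄.arr 6 = fun _ => 0 := by
    rw [ag₄.2 6 (by decide), ag₃.2 6 (by cases T <;> decide), ag₂.2 6 (by cases T <;> decide),
      ag₁.2 6 (by decide)]
    rfl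
  refine (Runs.cond (T := (6 + 30 * (n + m + 1)) + (15565 * 8000 * (2 ^ K * 2 ^ (K / 2)) + 100))
    hs₄ (by decide) (fun hthr => ?_) fun hthr => ?_).mono ?_ fun _ => id
  · simp only [Test.holds_leThreshold, RExpr.eval_var, h4] at hthr
    obtain ⟨D, hD⟩ : ∃ D, D = min ⌊M.thr⌋ (startDist P Q + n + m) := ⟨_, rfl⟩
    have hfl : startDist P Q ≤ ⌊M.thr⌋ := Int.le_floor.2 hthr
    refine (threshold_runs hs₄ c0 c1 h4 hthr hD (by omega) hd0).seq fun s₅ h5 hs₅ ag₅ => ?_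
    have hI : (walkGrid P Q D).Fine M.bd := walkGrid_fine hP' hQ' (by omega) (by omega) (by omega)
    have hL : (walkGrid P Q D).Loaded s₅ := by
      refine ⟨?_, ?_, h5, fun k hk i hi => ?_, fun k hk j hj => ?_⟩
      · rw [ag₅.1 0 (by decide), c0, ← hn]
        rfl
      · rw [ag₅.1 1 (by decide), c1, ← hm]
        rfl
      · rw [ag₅.2 4 (by decide), ag₄.2 4 (by decide)]
        exact hF k hk i (lt_of_lt_of_eq hi hn)
      · rw [ag₅.2 5 (by decide), ag₄.2 5 (by decide)]
        exact hG k hk j (lt_of_lt_of_eq hj hm)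
    have hcost := Tree.cost_le_pow hI (fun k₁ k₂ h1 h2 i hi j hj e1 e2 =>
      injective_form_getVert hQ h1 h2 hi hj e1 e2) 8000 K
    have hiff := frechetDist_le_threshold_iff hthr (D := D) (by rw [hD, hn, hm])
    refine (root_tree_runs hI (by omega) hs₅ hL ((ag₅.1 2 (by decide)).trans c2)
      ((ag₅.2 6 (by decide)).trans c6) (Nat.succ_pos _) (Nat.succ_pos _) (hn.trans_le hnK)
      (hm.trans_le hmK) (by omega) (by omega)).mono (by omega) fun s' h' => ?_
    rw [hiff]
    exact h'
  · simp only [Test.holds_leThreshold, RExpr.eval_var, h4] at hthr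
    refine Runs.of_wp_le hs₄ (by decide) (T := (6 + 30 * (n + m + 1)) +
      (15565 * 8000 * (2 ^ K * 2 ^ (K / 2)) + 100)) ?_ ?_
    · have : (0 ⟵ 0).wtime = 2 := by decide
      omega
    · simp only [wp_assign, RExpr.eval_zero, State.setVar_var, reduceIte]
      exact ⟨by omega, fun h => absurd h (frechetDist_not_le hthr), fun _ => trivial⟩
  · have : (Test.leThreshold (.var 4)).time = 2 := by decide
    omega

end InputState

/-- `2 ^ K` is at most `2 * N` and `2 ^ (K / 2)` at most `2 * √N`, so the time is of order `N ^ (3 /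
2)`. The logarithm enters only through `Real.log N ≥ 1 / 2` for `N ≥ 2`. -/
theorem time_bound {n m K T : ℕ} (hnm : 2 ≤ n + m) (hK : 2 ^ K ≤ 2 * (n + m))
    (hT : T ≤ 2000 * (n + m) + 15565 * 8000 * (2 ^ K * 2 ^ (K / 2))) :
    (T : ℝ) ≤ 10 ^ 10 * (((n : ℝ) + m) ^ (3 / 2 : ℝ) * Real.log ((n : ℝ) + m)) := by
  obtain ⟨N, hN⟩ : ∃ N : ℝ, N = (n : ℝ) + m := ⟨_, rfl⟩
  have hN2 : 2 ≤ N := by rw [hN]; exact_mod_cast hnm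
  have hx : (2 : ℝ) ^ K ≤ 2 * N := by rw [hN]; exact_mod_cast hK
  have hy : (2 : ℝ) ^ (K / 2) ≤ 2 * Real.sqrt N := by
    refine abs_le_of_sq_le_sq' ?_ (by positivity) |>.2
    rw [mul_pow, Real.sq_sqrt (by linarith), ← pow_mul]
    have : (2 : ℝ) ^ (K / 2 * 2) ≤ 2 ^ K := pow_le_pow_right₀ (by norm_num) (by omega)
    linarith
  have hT' : (T : ℝ) ≤ 2000 * N + 15565 * 8000 * (2 ^ K * 2 ^ (K / 2)) := by
    rw [hN]; exact_mod_cast hT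
  have hpow : N ^ (3 / 2 : ℝ) = N * Real.sqrt N := by
    rw [Real.sqrt_eq_rpow, ← Real.rpow_one_add' (by linarith) (by norm_num)]
    norm_num
  have hs1 : 1 ≤ Real.sqrt N := Real.one_le_sqrt.2 (by linarith)
  have hlog : 1 / 2 ≤ Real.log N := by
    have h1 := Real.log_two_gt_d9
    have h2 := Real.log_le_log (by norm_num) hN2
    linarith
  rw [← hN, hpow]
  have h3 : (2 : ℝ) ^ K * 2 ^ (K / 2) ≤ 2 * N * (2 * Real.sqrt N) :=
    mul_le_mul hx hy (by positivity) (by linarith)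
  have h4 : N ≤ N * Real.sqrt N := le_mul_of_one_le_right (by linarith) hs1
  have h5 : N * Real.sqrt N * (1 / 2) ≤ N * Real.sqrt N * Real.log N :=
    mul_le_mul_of_nonneg_left hlog (by positivity)
  nlinarith

end FrechetTiling

theorem mainTheorem2 (T : FrechetTiling.RegularTiling) :
    ∃ (A : FrechetTiling.Program) (C : ℝ) (c : ℕ),
      ∀ (n m : ℕ) (u v u' v' : T.Vertex) (P : T.graph.Walk u v) (Q : T.graph.Walk u' v'),
        P.IsPath → Q.IsPath → P.support.length = n → Q.support.length = m →
        ∀ U : ℕ, (∀ w ∈ P.support ++ Q.support, |w.1.1| ≤ (U : ℤ) ∧ |w.1.2| ≤ (U : ℤ)) →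
        ∀ Δ : ℝ, ∃ (s : FrechetTiling.State) (t : ℕ),
          FrechetTiling.Exec Δ ((n + m + U) ^ c) A (FrechetTiling.inputState P Q) s t ∧
          (t : ℝ) ≤ C * (((n : ℝ) + m) ^ (3 / 2 : ℝ) * Real.log ((n : ℝ) + m)) ∧
          ((FrechetTiling.frechetDist P Q : ℝ) ≤ Δ → s.var 0 = 1) ∧
          (¬ (FrechetTiling.frechetDist P Q : ℝ) ≤ Δ → s.var 0 = 0) := by
  -- With `B = n + m + U` the memory is bounded by `B ^ 5`, and words reach its twelfth power `B ^
  -- 60`.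
  refine ⟨FrechetTiling.Main.main T, 10 ^ 10, 60, ?_⟩
  intro n m u v u' v' P Q _ hQ hn hm U hU Δ
  rw [SimpleGraph.Walk.length_support] at hn hm
  obtain ⟨K, hnK, hmK, hK, hmin⟩ := FrechetTiling.Main.exists_side n m (by omega)
  have hB : (2 : ℤ) ≤ (n + m + U : ℕ) := by omega
  -- Since `B ≥ 2`, the factor `B ^ 4 ≥ 16` absorbs the `12` needed for the memory bound.
  have hB5 : 12 * ((n + m + U : ℕ) : ℤ) ≤ ((n + m + U : ℕ) : ℤ) ^ 5 := by
    have : (2 : ℤ) ^ 4 ≤ ((n + m + U : ℕ) : ℤ) ^ 4 := pow_le_pow_left₀ (by norm_num) hB 4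
    rw [pow_succ]
    nlinarith
  obtain ⟨s, t, he, ht, -, hr⟩ := FrechetTiling.Main.main_runs (M := ⟨Δ, (n + m + U) ^ 60,
    ((n + m + U : ℕ) : ℤ) ^ 5, by omega, by rw [← pow_mul]; push_cast; exact le_rfl⟩) hQ hU hn hm
    hnK hmK hmin hK (by push_cast at hB5 ⊢; exact hB5)
  exact ⟨s, t, he, FrechetTiling.time_bound (by omega) hK ht, hr⟩
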